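/- For $b=(b_1,b_2,b_3,b_4)\in\mathbb{R}^4$ let $$B(b)=\begin{bmatrix} b_1&b_2&1-b_1-b_2\\ b_3&b_4&1-b_3-b_4\\ 1-b_1-b_3&1-b_2-b_4&b_1+b_2+b_3+b_4-1\end{bmatrix},\qquad Q(b)=4b_1b_2b_3b_4-(b_1+b_2+b_3+b_4-1-b_1b_4-b_2b_3)^2 .$$ For a complex $3\times3$ matrix $U$ let $f(U)=(|U_{ij}|^2)_{i,j}$ and $J(U)=\operatorname{Im}(U_{11}U_{22}\overline{U_{12}}\,\overline{U_{21}})$, and let $\mathcal U_3=\{f(U):U\in U(3)\}$ be the set of unistochastic matrices of order three. For $B=B(b)$ write $Q(B)=Q(b)$ and $X(B)=27\,Q(B)$. For $k>\frac12$ let $\mu_k$ be the image under $b\mapsto B(b)$ of the measure $Q(b)^{k-3/2}\,db$ on $\{b\in\mathbb{R}^4:B(b)\in\mathcal U_3\}$, where $db$ is Lebesgue measure. For $0<x\le1$ let $$P_k(x)=c_k\left(k-\tfrac12\right)x^{k-3/2}\int_x^1{}_2F_1\!\left(\tfrac13,\tfrac23;1;1-t\right)t^{-1/2}\,dt,\qquad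 c_k=\frac{\Gamma(k+\frac13)\,\Gamma(k+\frac23)}{\Gamma(k)^2}.$$ Then the following hold. 1. For every $U\in U(3)$ one has $X(f(U))=27\,Q(f(U))=108\,J(U)^2$. 2. For every real $k>\frac12$: (a) $0<\mu_k(\mathcal U_3)<\infty$, so that $\mathbb P_k=\mu_k/\mu_k(\mathcal U_3)$ is a probability measure; (b) if $X_0,X_1,X_2$ are independent random variables with the beta densities $$\left(k-\tfrac12\right)x^{k-3/2},\qquad \frac{\Gamma(k+\frac13)}{\Gamma(k)\Gamma(\frac13)}x^{k-1}(1-x)^{-2/3},\qquad \frac{\Gamma(k+\frac23)}{\Gamma(k)\Gamma(\frac23)}x^{k-1}(1-x)^{-1/3}$$ on $(0,1)$ respectively, then $X$ under $\mathbb P_k$ has the same law as the product $X_0X_1X_2$; (c) for every $0<x\le1$ the integral defining $P_k(x)$ converges and $P_k(x)\ge0$; and the law of $X$ under $\mathbb P_k$ is absolutely continuous with respect to Lebesgue measure, with density $P_k$ on $(0,1]$ and density zero elsewhere. 3. Let $U$ be distributed according to the normalized Haar measure on $U(3)$. Then $f(U)$ has law $\mathbb P_1$; the variable $108\,J(U)^2$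 has density $P_1$ on $(0,1]$ and zero elsewhere; and $|J(U)|$ has density $216\,y\,P_1(108\,y^2)$ for $0<y\le\frac1{6\sqrt3}$ and zero elsewhere. -/

import Mathlib

open MeasureTheory ProbabilityTheory Set

noncomputable section

/-- The matrix `f(U)` of squared moduli of the entries of a complex matrix. -/
def sqModuli {n : ℕ} (U : Matrix (Fin n) (Fin n) ℂ) : Matrix (Fin n) (Fin n) ℝ :=
  Matrix.of fun i j => ‖U i j‖ ^ 2

/-- The set of unistochastic matrices of order `n` (they are automatically bistochastic). -/
def unistochastic (n : ℕ) : Set (Matrix (Fin n) (Fin n) ℝ) :=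
  {B | ∃ U ∈ Matrix.unitaryGroup (Fin n) ℂ, B = sqModuli U}

/-- The matrix `B(b)` with unit row and column sums and upper left block
`b₁ b₂ / b₃ b₄`. -/
def birkhoffParam (b : Fin 4 → ℝ) : Matrix (Fin 3) (Fin 3) ℝ :=
  !![b 0, b 1, 1 - b 0 - b 1;
     b 2, b 3, 1 - b 2 - b 3;
     1 - b 0 - b 2, 1 - b 1 - b 3, b 0 + b 1 + b 2 + b 3 - 1]

/-- The polynomial `Q = 4 b₁ b₂ b₃ b₄ - (b₁ + b₂ + b₃ + b₄ - 1 - b₁ b₄ - b₂ b₃)²` as a function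
of the matrix whose upper left block is `b₁ b₂ / b₃ b₄`. -/
def areaQ (B : Matrix (Fin 3) (Fin 3) ℝ) : ℝ :=
  4 * B 0 0 * B 0 1 * B 1 0 * B 1 1 -
    (B 0 0 + B 0 1 + B 1 0 + B 1 1 - 1 - B 0 0 * B 1 1 - B 0 1 * B 1 0) ^ 2

/-- The Jarlskog invariant `J(U) = Im (U₁₁ U₂₂ U₁₂^* U₂₁^*)`. -/
def jarlskog (U : Matrix (Fin 3) (Fin 3) ℂ) : ℝ :=
  (U 0 0 * U 1 1 * star (U 0 1) * star (U 1 0)).im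

instance matrixMeasurableSpace {R : Type*} [MeasurableSpace R] :
    MeasurableSpace (Matrix (Fin 3) (Fin 3) R) :=
  inferInstanceAs (MeasurableSpace (Fin 3 → Fin 3 → R))

instance matrixBorelSpace {R : Type*} [TopologicalSpace R] [SecondCountableTopology R]
    [MeasurableSpace R] [BorelSpace R] : BorelSpace (Matrix (Fin 3) (Fin 3) R) :=
  inferInstanceAs (BorelSpace (Fin 3 → Fin 3 → R))

/-- The measure `Q^(k - 3/2) db` on the set of unistochastic matrices of order three, where `db`
is Lebesgue measure in the coordinates `b`. -/
def unistochasticMeasure (k : ℝ) : Measure (Matrix (Fin 3) (Fin 3) ℝ) :=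
  (((volume : Measure (Fin 4 → ℝ)).restrict {b | birkhoffParam b ∈ unistochastic 3}).withDensity
    fun b => ENNReal.ofReal (areaQ (birkhoffParam b) ^ (k - 3 / 2))).map birkhoffParam

/-- The measure `Q^(k - 3/2) db` normalized to total mass one. -/
def unistochasticProb (k : ℝ) : Measure (Matrix (Fin 3) (Fin 3) ℝ) :=
  (unistochasticMeasure k univ)⁻¹ • unistochasticMeasure k

/-- The random variable `X = 27 Q`. -/
def jarlskogX (B : Matrix (Fin 3) (Fin 3) ℝ) : ℝ := 27 * areaQ B

/-- The constant `c_k = Γ(k + 1/3) Γ(k + 2/3) / Γ(k)²`. -/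
def normConst (k : ℝ) : ℝ :=
  Real.Gamma (k + 1 / 3) * Real.Gamma (k + 2 / 3) / Real.Gamma k ^ 2

/-- The integrand `₂F₁(1/3, 2/3; 1; 1 - t) t^(-1/2)`. -/
def densityIntegrand (t : ℝ) : ℝ :=
  ordinaryHypergeometric (1 / 3 : ℝ) (2 / 3 : ℝ) (1 : ℝ) (1 - t) * t ^ (-1 / 2 : ℝ)

/-- `P_k(x) = c_k (k - 1/2) x^(k - 3/2) ∫_x^1 ₂F₁(1/3, 2/3; 1; 1 - t) t^(-1/2) dt`. -/
def jarlskogDensity (k x : ℝ) : ℝ :=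
  normConst k * (k - 1 / 2) * x ^ (k - 3 / 2) * ∫ t in x..1, densityIntegrand t

/-- The measure on `ℝ` with density `p` on `(0, r]` and density zero elsewhere. -/
def lawWithDensity (r : ℝ) (p : ℝ → ℝ) : Measure ℝ :=
  volume.withDensity ((Ioc 0 r).indicator fun x => ENNReal.ofReal (p x))

end

open MeasureTheory ProbabilityTheory Set

/-! Write w = U₁₁U₂₂ conj(U₁₂U₂₁). Then |w|² is the product of the four squared moduli in the upper
left block, and orthogonality of the first two rows determines 2 Re w from those moduli. Hence Q =
4|w|² - (2 Re w)² = 4 (Im w)², which is part 1 (`areaQ_sqModuli`).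

For part 2, let (x, y) be the first two entries of the first row of B, put z = 1 - x - y, and write
the entry below x as (1 - x)t. Then Q is a constant minus a square in the remaining entry v, so the
condition Q > 0 confines v to an interval, which is parametrized by an angle θ in (0, π). In these
coordinates Q = 4xyz t(1 - t) sin²θ, and the Jacobian of b is exactly √Q (`lintegral_slice`). Up to
null sets the unistochastic region is the image of triangle × (0, 1) × (0, π)
(`preimage_unistochastic_ae_eq`), so Q^(k - 3/2) db becomes Q^(k - 1) times the flat measure
(`unistochasticMeasure_eq`).

At k = 1 the moments of X under the flat measure split into a Dirichlet integral, a beta integral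
and a Wallis integral. They agree, up to the total mass π/2, with the moments of the product of
three beta variables, and moments determine a finite measure on [0, 1] (`map_paramX`). For general k
the extra weight is a power of X itself, so the law of X is proportional to x^(k - 1) P₁(x), that
is, to P_k. That P_k is the density of the product of the beta variables is a double multiplicative
convolution, whose inner integral is Euler's integral for ₂F₁ (`betaMeasure_mconv`).

For part 3, the first two rows of a Haar unitary matrix may be obtained by Gram-Schmidt from two
Gaussian vectors in ℂ³, since the Gaussian weight is invariant under right multiplication
(`lintegral_gaussian_gramSchmidtBlock`). Polar coordinates turn squared moduli into exponential
variables, whose ratios are uniform; the relative phase is uniform as well. So the parameters have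
the normalized flat law (`lintegral_blockModuli_haar`), which is the case k = 1. -/

/-! ### Hypergeometric and binomial series, beta integrals. -/

theorem ordinaryHypergeometric_hasSum {a b c x : ℝ} (ha : 0 < a) (hb : 0 < b) (hc : 0 < c)
    (hx : |x| < 1) :
    HasSum (fun n => ordinaryHypergeometricCoefficient a b c n * x ^ n)
      (ordinaryHypergeometric a b c x) := by
  have hr : (ordinaryHypergeometricSeries ℝ a b c).radius = 1 :=
    ordinaryHypergeometricSeries_radius_eq_one ℝ a b c fun n => by
      have := n.cast_nonneg (α := ℝ)
      refine ⟨?_, ?_, ?_⟩ <;> linarith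
  have h := ((ordinaryHypergeometricSeries ℝ a b c).hasFPowerSeriesOnBall
    (by simp [hr])).hasSum (y := x) (by
      rw [hr, Metric.mem_eball, edist_zero_right, ← ofReal_norm, ENNReal.ofReal_lt_one]
      simpa using hx)
  simp_rw [ordinaryHypergeometricSeries_apply_eq, zero_add, smul_eq_mul] at h
  exact h

theorem ordinaryHypergeometricCoefficient_pos {a b c : ℝ} (ha : 0 < a) (hb : 0 < b) (hc : 0 < c)
    (n : ℕ) : 0 < ordinaryHypergeometricCoefficient a b c n := by
  have := ascPochhammer_pos n a ha
  have := ascPochhammer_pos n b hb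
  have := ascPochhammer_pos n c hc
  unfold ordinaryHypergeometricCoefficient
  positivity

theorem ordinaryHypergeometric_nonneg {a b c x : ℝ} (ha : 0 < a) (hb : 0 < b) (hc : 0 < c)
    (hx0 : 0 ≤ x) (hx : x < 1) : 0 ≤ ordinaryHypergeometric a b c x :=
  (ordinaryHypergeometric_hasSum ha hb hc (by rwa [abs_of_nonneg hx0])).nonneg fun n =>
    mul_nonneg (ordinaryHypergeometricCoefficient_pos ha hb hc n).le (pow_nonneg hx0 n)

theorem ordinaryHypergeometric_continuousOn {a b c : ℝ} (ha : 0 < a) (hb : 0 < b) (hc : 0 < c) :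
    ContinuousOn (fun x : ℝ => ordinaryHypergeometric a b c x) {x | |x| < 1} := by
  have hr : (ordinaryHypergeometricSeries ℝ a b c).radius = 1 :=
    ordinaryHypergeometricSeries_radius_eq_one ℝ a b c fun n => by
      have := n.cast_nonneg (α := ℝ)
      refine ⟨?_, ?_, ?_⟩ <;> linarith
  have h := ((ordinaryHypergeometricSeries ℝ a b c).hasFPowerSeriesOnBall
    (by simp [hr])).continuousOn
  refine h.mono fun x hx => ?_
  rw [hr, Metric.mem_eball, edist_zero_right, ← ofReal_norm, ENNReal.ofReal_lt_one]
  simpa using hx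

theorem one_sub_rpow_neg_hasSum (a : ℝ) {x : ℝ} (hx : |x| < 1) :
    HasSum (fun n : ℕ => (ascPochhammer ℝ n).eval a / n.factorial * x ^ n) ((1 - x) ^ (-a)) := by
  have h := (Real.one_div_one_sub_rpow_hasFPowerSeriesOnBall_zero a).hasSum (y := x) (by
      rw [Metric.mem_eball, edist_zero_right, ← ofReal_norm, ENNReal.ofReal_lt_one]
      simpa using hx)
  have hx' : 0 ≤ 1 - x := by linarith [(abs_lt.1 hx).2]
  rw [zero_add, one_div, ← Real.rpow_neg hx'] at h
  have key : ∀ n : ℕ, FormalMultilinearSeries.ofScalars ℝ (fun n : ℕ => Ring.choose (a + n - 1) n) n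
      (fun _ => x) = (ascPochhammer ℝ n).eval a / n.factorial * x ^ n := by
    intro n
    -- The generalized binomial coefficient choose(a + n - 1, n) is multichoose(a, n), and n! times
    -- it is the rising factorial of a.
    have h2 := Ring.factorial_nsmul_multichoose_eq_ascPochhammer a n
    rw [Polynomial.ascPochhammer_smeval_eq_eval] at h2
    have h3 : Ring.choose (a + n - 1) n = Ring.multichoose a n := by
      rw [Ring.choose]; congr 1; ring
    rw [FormalMultilinearSeries.ofScalars_apply_eq, h3, ← h2, nsmul_eq_mul, smul_eq_mul,
      mul_div_cancel_left₀ _ (by positivity)]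
  simp_rw [key] at h
  exact h

theorem Gamma_add_natCast {a : ℝ} (ha : 0 < a) (n : ℕ) :
    Real.Gamma (a + n) = (ascPochhammer ℝ n).eval a * Real.Gamma a := by
  induction n with
  | zero => simp
  | succ n ih =>
    rw [Nat.cast_succ, ← add_assoc, Real.Gamma_add_one (by positivity), ih,
      ascPochhammer_succ_eval]
    ring

theorem setLIntegral_rpow_mul_one_sub_rpow {a b : ℝ} (ha : 0 < a) (hb : 0 < b) :
    ∫⁻ x in Ioo (0 : ℝ) 1, ENNReal.ofReal (x ^ (a - 1) * (1 - x) ^ (b - 1)) =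
      ENNReal.ofReal (beta a b) := by
  have h := lintegral_betaPDF_eq_one ha hb
  have hB := beta_pos ha hb
  rw [lintegral_betaPDF] at h
  simp_rw [mul_assoc, ENNReal.ofReal_mul (one_div_pos.2 hB).le] at h
  rw [lintegral_const_mul _ (by fun_prop)] at h
  calc _ = ENNReal.ofReal (beta a b) * (ENNReal.ofReal (1 / beta a b) *
        ∫⁻ x in Ioo (0 : ℝ) 1, ENNReal.ofReal (x ^ (a - 1) * (1 - x) ^ (b - 1))) := by
        rw [← mul_assoc, ← ENNReal.ofReal_mul hB.le, mul_one_div_cancel hB.ne', ENNReal.ofReal_one,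
          one_mul]
    _ = _ := by rw [h, mul_one]

theorem beta_natCast_add {b d : ℝ} (hb : 0 < b) (hd : 0 < d) (n : ℕ) :
    beta (b + n) d = beta b d * ((ascPochhammer ℝ n).eval b / (ascPochhammer ℝ n).eval (b + d)) := by
  have h1 := ascPochhammer_pos n (b + d) (by positivity)
  have h2 := Real.Gamma_pos_of_pos (add_pos hb hd)
  rw [beta, beta, show b + n + d = b + d + n by ring, Gamma_add_natCast hb,
    Gamma_add_natCast (by positivity)]
  field_simp

/-- Euler's integral representation of the hypergeometric function. -/
theorem setLIntegral_euler_hypergeometric {a b d z : ℝ} (ha : 0 < a) (hb : 0 < b) (hd : 0 < d)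
    (hz0 : 0 ≤ z) (hz : z < 1) :
    ∫⁻ u in Ioo (0 : ℝ) 1,
        ENNReal.ofReal (u ^ (b - 1) * (1 - u) ^ (d - 1) * (1 - z * u) ^ (-a)) =
      ENNReal.ofReal (beta b d * ordinaryHypergeometric a b (b + d) z) := by
  -- Expand (1 - zu)^(-a) in powers of zu. All terms are nonnegative, so sum and integral may be
  -- exchanged, and each term is a beta integral.
  have key : ∀ u ∈ Ioo (0 : ℝ) 1,
      ENNReal.ofReal (u ^ (b - 1) * (1 - u) ^ (d - 1) * (1 - z * u) ^ (-a)) =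
      ∑' n : ℕ, ENNReal.ofReal ((ascPochhammer ℝ n).eval a / n.factorial * z ^ n) *
        ENNReal.ofReal (u ^ (b + n - 1) * (1 - u) ^ (d - 1)) := by
    intro u hu
    have hzu : |z * u| < 1 := by
      rw [abs_of_nonneg (mul_nonneg hz0 hu.1.le)]; nlinarith [hu.1, hu.2]
    have hs := (one_sub_rpow_neg_hasSum a hzu).mul_left (u ^ (b - 1) * (1 - u) ^ (d - 1))
    have hn : ∀ n : ℕ, 0 ≤ (ascPochhammer ℝ n).eval a / n.factorial * z ^ n := fun n => by
      have := ascPochhammer_pos n a ha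
      positivity
    have h1u : 0 < 1 - u := by linarith [hu.2]
    have hu0 := hu.1
    rw [← hs.tsum_eq, ENNReal.ofReal_tsum_of_nonneg _ hs.summable]
    · refine tsum_congr fun n => ?_
      rw [← ENNReal.ofReal_mul (hn n), show b + n - 1 = (b - 1) + n by ring, Real.rpow_add hu0,
        Real.rpow_natCast, mul_pow]
      ring_nf
    · intro n
      have := ascPochhammer_pos n a ha
      positivity
  have hF := ordinaryHypergeometric_hasSum ha hb (add_pos hb hd)
    (show |z| < 1 by rwa [abs_of_nonneg hz0])
  rw [setLIntegral_congr_fun measurableSet_Ioo key, lintegral_tsum fun n => by fun_prop,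
    ← hF.tsum_eq, ← tsum_mul_left, ENNReal.ofReal_tsum_of_nonneg _ (hF.summable.mul_left _)]
  · refine tsum_congr fun n => ?_
    have := ascPochhammer_pos n a ha
    rw [lintegral_const_mul _ (by fun_prop),
      setLIntegral_rpow_mul_one_sub_rpow (by positivity) hd, ← ENNReal.ofReal_mul (by positivity),
      beta_natCast_add hb hd, ordinaryHypergeometricCoefficient]
    congr 1
    ring
  · intro n
    have := ordinaryHypergeometricCoefficient_pos ha hb (add_pos hb hd) n
    have := beta_pos hb hd
    positivity

/-! ### Affine substitutions and multiplicative convolution. -/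

theorem lintegral_comp_affine (g : ℝ → ENNReal) {c : ℝ} (hc : c ≠ 0) (d : ℝ) :
    ∫⁻ x, g x = ENNReal.ofReal |c| * ∫⁻ x, g (c * x + d) := by
  have h := lintegral_image_eq_lintegral_abs_deriv_mul (f := fun x => c * x + d) (f' := fun _ => c)
    MeasurableSet.univ (fun x _ => by
      have := (((hasDerivAt_id x).const_mul c).add_const d).hasDerivWithinAt (s := univ)
      rwa [mul_one] at this)
    (fun x _ y _ h => by simpa [hc] using h) g
  have hs : (fun x => c * x + d) '' univ = univ := by
    refine eq_univ_of_forall fun y => ⟨(y - d) / c, mem_univ _, ?_⟩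
    field_simp
    ring
  rw [hs] at h
  simpa [lintegral_const_mul'] using h

theorem setLIntegral_comp_affine (s : Set ℝ) (hs : MeasurableSet s) (g : ℝ → ENNReal) {c : ℝ} (hc : c ≠ 0)
    (d : ℝ) :
    ∫⁻ x in s, g x = ENNReal.ofReal |c| * ∫⁻ x in {x | c * x + d ∈ s}, g (c * x + d) := by
  have hs' : MeasurableSet {x : ℝ | c * x + d ∈ s} := by
    have : Measurable fun x : ℝ => c * x + d := by fun_prop
    exact this hs
  rw [← lintegral_indicator hs, ← lintegral_indicator hs', lintegral_comp_affine _ hc d]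
  rfl

/-- The density of a multiplicative convolution of measures with densities on `(0, ∞)`. -/
theorem withDensity_mconv_withDensity {f g : ℝ → ENNReal} (hf : Measurable f) (hg : Measurable g)
    (hg0 : ∀ y ≤ 0, g y = 0) :
    (volume.withDensity f) ∗ₘ (volume.withDensity g) =
      volume.withDensity fun z => ∫⁻ y in Ioi 0, ENNReal.ofReal y⁻¹ * f (z * y⁻¹) * g y := by
  refine Measure.ext_of_lintegral _ fun h hh => ?_
  have hm : Measurable fun p : ℝ × ℝ => ENNReal.ofReal p.2⁻¹ * f (p.1 * p.2⁻¹) * g p.2 := by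
    fun_prop
  rw [Measure.lintegral_mconv hh,
    lintegral_withDensity_eq_lintegral_mul _ hm.lintegral_prod_right' hh,
    lintegral_withDensity_eq_lintegral_mul _ hf (by fun_prop)]
  have h1 : ∀ x, ∫⁻ y, h (x * y) ∂(volume.withDensity g) = ∫⁻ y in Ioi 0, g y * h (x * y) := by
    intro x
    rw [lintegral_withDensity_eq_lintegral_mul _ hg (by fun_prop),
      ← lintegral_indicator measurableSet_Ioi]
    refine lintegral_congr fun y => ?_
    by_cases hy : 0 < y
    · simp [hy]
    · simp [hy, hg0 y (not_lt.1 hy)]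
  simp_rw [Pi.mul_apply, h1]
  calc ∫⁻ x, f x * ∫⁻ y in Ioi 0, g y * h (x * y)
      = ∫⁻ x, ∫⁻ y in Ioi 0, f x * (g y * h (x * y)) := by
        refine lintegral_congr fun x => (lintegral_const_mul _ (by fun_prop)).symm
    _ = ∫⁻ y in Ioi 0, ∫⁻ x, f x * (g y * h (x * y)) := by
        rw [lintegral_lintegral_swap (by fun_prop)]
    _ = ∫⁻ y in Ioi 0, ∫⁻ z, ENNReal.ofReal y⁻¹ * f (z * y⁻¹) * g y * h z := by
        -- For fixed y the substitution is z = xy, with dx = dz / y.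
        refine setLIntegral_congr_fun measurableSet_Ioi fun y (hy : 0 < y) => ?_
        rw [lintegral_comp_affine _ (inv_ne_zero hy.ne') 0, ← lintegral_const_mul' _ _ (by simp)]
        refine lintegral_congr fun z => ?_
        rw [abs_of_pos (inv_pos.2 hy), add_zero, mul_comm y⁻¹ z, inv_mul_cancel_right₀ hy.ne']
        ring
    _ = ∫⁻ z, ∫⁻ y in Ioi 0, ENNReal.ofReal y⁻¹ * f (z * y⁻¹) * g y * h z := by
        rw [lintegral_lintegral_swap (by fun_prop)]
    _ = _ := by
        refine lintegral_congr fun z => (lintegral_mul_const _ (by fun_prop))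

/-! ### The density of a product of three beta variables. -/

theorem beta_one_right {a : ℝ} (ha : 0 < a) : beta a 1 = a⁻¹ := by
  have := Real.Gamma_pos_of_pos ha
  rw [beta, Real.Gamma_one, Real.Gamma_add_one ha.ne']
  field_simp

theorem measurable_betaPDF (a b : ℝ) : Measurable (betaPDF a b) :=
  (measurable_betaPDFReal a b).ennreal_ofReal

theorem setLIntegral_Ioo_comp_affine {a b : ℝ} (hab : a < b) (g : ℝ → ENNReal) :
    ∫⁻ x in Ioo a b, g x = ENNReal.ofReal (b - a) * ∫⁻ u in Ioo 0 1, g (a + (b - a) * u) := by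
  have h : 0 < b - a := sub_pos.2 hab
  rw [setLIntegral_comp_affine _ measurableSet_Ioo g h.ne' a, abs_of_pos h]
  have hs : {x | (b - a) * x + a ∈ Ioo a b} = Ioo 0 1 := by
    ext x
    simp only [mem_ofPred_eq, mem_Ioo]
    constructor
    · rintro ⟨h1, h2⟩
      exact ⟨by by_contra hx; nlinarith, by by_contra hx; nlinarith⟩
    · rintro ⟨h1, h2⟩
      constructor <;> nlinarith
  simp_rw [hs, add_comm a]

theorem setLIntegral_Ioo_comp_sub {a b : ℝ} (hab : a < b) (g : ℝ → ENNReal) :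
    ∫⁻ x in Ioo a b, g x = ENNReal.ofReal (b - a) * ∫⁻ u in Ioo 0 1, g (b - (b - a) * u) := by
  have h : 0 < b - a := sub_pos.2 hab
  rw [setLIntegral_comp_affine _ measurableSet_Ioo g (neg_ne_zero.2 h.ne') b, abs_neg,
    abs_of_pos h]
  have hs : {x | -(b - a) * x + b ∈ Ioo a b} = Ioo 0 1 := by
    ext x
    simp only [mem_ofPred_eq, mem_Ioo]
    constructor
    · rintro ⟨h1, h2⟩
      exact ⟨by by_contra hx; nlinarith, by by_contra hx; nlinarith⟩
    · rintro ⟨h1, h2⟩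
      constructor <;> nlinarith
  rw [hs]
  simp_rw [neg_mul, neg_add_eq_sub]

/-- The integrand lives on z < y < 1, and there the powers of y involving k cancel, so that k
survives only in z^(k - 1) and in the constant. The substitution y = 1 - (1 - z)u then gives Euler's
integral; the powers of 1 - z cancel because 1/3 + 2/3 = 1. -/
theorem lintegral_betaPDF_mul_betaPDF_third {k z : ℝ} (hk : 0 < k) (hz0 : 0 < z) (hz1 : z < 1) :
    ∫⁻ y in Ioi 0, ENNReal.ofReal y⁻¹ * betaPDF k (2 / 3) (z * y⁻¹) * betaPDF k (1 / 3) y =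
      ENNReal.ofReal (normConst k * z ^ (k - 1) *
        ordinaryHypergeometric (1 / 3 : ℝ) (2 / 3 : ℝ) (1 : ℝ) (1 - z)) := by
  have hC1 := beta_pos hk (show (0 : ℝ) < 1 / 3 by norm_num)
  have hC2 := beta_pos hk (show (0 : ℝ) < 2 / 3 by norm_num)
  set C : ℝ := (beta k (2 / 3))⁻¹ * (beta k (1 / 3))⁻¹ with hC
  have hCpos : 0 < C := by positivity
  have h1 : ∫⁻ y in Ioi 0, ENNReal.ofReal y⁻¹ * betaPDF k (2 / 3) (z * y⁻¹) * betaPDF k (1 / 3) y =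
      ∫⁻ y in Ioo z 1, ENNReal.ofReal (C * z ^ (k - 1)) *
        ENNReal.ofReal (y ^ (-(2 / 3) : ℝ) * (y - z) ^ (-(1 / 3) : ℝ) * (1 - y) ^ (-(2 / 3) : ℝ)) := by
    rw [← lintegral_indicator measurableSet_Ioi, ← lintegral_indicator measurableSet_Ioo]
    refine lintegral_congr fun y => ?_
    by_cases hy : y ∈ Ioo z 1
    · have hy0 : 0 < y := hz0.trans hy.1
      have hyz : 0 < y - z := sub_pos.2 hy.1
      have h1y : 0 < 1 - y := sub_pos.2 hy.2
      have e1 : 1 - z * y⁻¹ = (y - z) * y⁻¹ := by field_simp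
      rw [indicator_of_mem (show y ∈ Ioi 0 from hy0), indicator_of_mem hy,
        betaPDF_of_pos_lt_one (by positivity) (by rw [← div_eq_mul_inv, div_lt_one hy0]; exact hy.1),
        betaPDF_of_pos_lt_one hy0 hy.2, e1, ← ENNReal.ofReal_mul (by positivity),
        ← ENNReal.ofReal_mul (by positivity), ← ENNReal.ofReal_mul (by positivity)]
      congr 1
      rw [Real.mul_rpow hz0.le (by positivity), Real.mul_rpow hyz.le (by positivity),
        Real.inv_rpow hy0.le, Real.inv_rpow hy0.le, ← Real.rpow_neg hy0.le, ← Real.rpow_neg hy0.le,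
        ← Real.rpow_neg_one y, hC]
      have e2 : y ^ (-(2 / 3) : ℝ) = y ^ (-1 : ℝ) * y ^ (-(k - 1)) * y ^ (-(2 / 3 - 1) : ℝ) *
          y ^ (k - 1) := by
        rw [← Real.rpow_add hy0, ← Real.rpow_add hy0, ← Real.rpow_add hy0]; ring_nf
      rw [e2]
      norm_num
      ring
    · rw [indicator_of_notMem hy]
      by_cases hy0 : y ∈ Ioi (0 : ℝ)
      · rw [indicator_of_mem hy0]
        have hy0' : 0 < y := hy0
        by_cases hyz : z < y
        · rw [betaPDF_eq_zero_of_one_le (x := y) (by by_contra h; exact hy ⟨hyz, not_le.1 h⟩),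
            mul_zero]
        · rw [betaPDF_eq_zero_of_one_le (x := z * y⁻¹) (by
            rw [← div_eq_mul_inv, one_le_div hy0']; exact not_lt.1 hyz), mul_zero, zero_mul]
      · rw [indicator_of_notMem hy0]
  have h2 : ∫⁻ y in Ioo z 1,
        ENNReal.ofReal (y ^ (-(2 / 3) : ℝ) * (y - z) ^ (-(1 / 3) : ℝ) * (1 - y) ^ (-(2 / 3) : ℝ)) =
      ENNReal.ofReal (beta (1 / 3) (2 / 3) *
        ordinaryHypergeometric (2 / 3 : ℝ) (1 / 3 : ℝ) (1 / 3 + 2 / 3 : ℝ) (1 - z)) := by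
    rw [← setLIntegral_euler_hypergeometric (by norm_num) (by norm_num) (by norm_num)
      (by linarith) (by linarith), setLIntegral_Ioo_comp_sub hz1, ← lintegral_const_mul _ (by fun_prop)]
    refine setLIntegral_congr_fun measurableSet_Ioo fun u hu => ?_
    have h1z : 0 < 1 - z := sub_pos.2 hz1
    have hu0 := hu.1
    have h1u : 0 < 1 - u := sub_pos.2 hu.2
    rw [← ENNReal.ofReal_mul h1z.le]
    congr 1
    rw [show 1 - (1 - z) * u - z = (1 - z) * (1 - u) by ring, sub_sub_cancel,
      Real.mul_rpow h1z.le h1u.le, Real.mul_rpow h1z.le hu0.le]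
    have e : (1 - z) * ((1 - z) ^ (-(1 / 3) : ℝ) * (1 - z) ^ (-(2 / 3) : ℝ)) = 1 := by
      rw [← Real.rpow_add h1z]
      norm_num
      rw [Real.rpow_neg_one, mul_inv_cancel₀ h1z.ne']
    norm_num
    norm_num at e
    linear_combination ((1 - (1 - z) * u) ^ (-(2 / 3) : ℝ) * (1 - u) ^ (-(1 / 3) : ℝ) * u ^ (-(2 / 3) : ℝ)) * e
  -- Euler's integral produces the upper parameters in the order 2/3, 1/3; the series is symmetric
  -- in them.
  have hsym : ordinaryHypergeometric (2 / 3 : ℝ) (1 / 3 : ℝ) (1 / 3 + 2 / 3 : ℝ) (1 - z) =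
      ordinaryHypergeometric (1 / 3 : ℝ) (2 / 3 : ℝ) (1 : ℝ) (1 - z) := by
    rw [ordinaryHypergeometric, ordinaryHypergeometricSeries_symm, ordinaryHypergeometric]
    norm_num
  rw [h1, lintegral_const_mul _ (by fun_prop), h2, ← ENNReal.ofReal_mul (by positivity), hsym]
  congr 1
  have g1 := Real.Gamma_pos_of_pos hk
  have g2 := Real.Gamma_pos_of_pos (show (0 : ℝ) < 1 / 3 by norm_num)
  have g3 := Real.Gamma_pos_of_pos (show (0 : ℝ) < 2 / 3 by norm_num)
  have g4 := Real.Gamma_pos_of_pos (show 0 < k + 1 / 3 by positivity)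
  have g5 := Real.Gamma_pos_of_pos (show 0 < k + 2 / 3 by positivity)
  rw [hC, normConst, beta, beta, beta, show (1 / 3 + 2 / 3 : ℝ) = 1 by norm_num, Real.Gamma_one]
  field_simp

theorem densityIntegrand_nonneg {t : ℝ} (ht0 : 0 < t) (ht1 : t ≤ 1) : 0 ≤ densityIntegrand t :=
  mul_nonneg (ordinaryHypergeometric_nonneg (by norm_num) (by norm_num) (by norm_num)
    (by linarith) (by linarith)) (Real.rpow_nonneg ht0.le _)

theorem densityIntegrand_continuousOn : ContinuousOn densityIntegrand (Ioc 0 1) := by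
  refine ContinuousOn.mul ?_ ?_
  · refine (ordinaryHypergeometric_continuousOn (by norm_num) (by norm_num) (by norm_num)).comp
      (by fun_prop) fun t ht => ?_
    show |1 - t| < 1
    rw [abs_of_nonneg (by linarith [ht.2])]
    linarith [ht.1]
  · exact fun t ht => (Real.continuousAt_rpow_const _ _ (Or.inl ht.1.ne')).continuousWithinAt

theorem densityIntegrand_intervalIntegrable {x : ℝ} (hx0 : 0 < x) (hx1 : x ≤ 1) :
    IntervalIntegrable densityIntegrand volume x 1 := by
  refine (densityIntegrand_continuousOn.mono ?_).intervalIntegrable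
  rw [uIcc_of_le hx1]
  exact fun t ht => ⟨hx0.trans_le ht.1, ht.2⟩

theorem normConst_pos {k : ℝ} (hk : 0 < k) : 0 < normConst k := by
  have g1 := Real.Gamma_pos_of_pos hk
  have g4 := Real.Gamma_pos_of_pos (show 0 < k + 1 / 3 by positivity)
  have g5 := Real.Gamma_pos_of_pos (show 0 < k + 2 / 3 by positivity)
  unfold normConst
  positivity

theorem jarlskogDensity_nonneg {k x : ℝ} (hk : 1 / 2 < k) (hx0 : 0 < x) (hx1 : x ≤ 1) :
    0 ≤ jarlskogDensity k x := by
  have h1 := normConst_pos (show 0 < k by linarith)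
  have h2 : 0 < k - 1 / 2 := by linarith
  have h3 : 0 ≤ ∫ t in x..1, densityIntegrand t :=
    intervalIntegral.integral_nonneg hx1 fun t ht =>
      densityIntegrand_nonneg (hx0.trans_le ht.1) ht.2
  unfold jarlskogDensity
  positivity

theorem ofReal_jarlskogDensity {k x : ℝ} (hk : 1 / 2 < k) (hx0 : 0 < x) (hx1 : x ≤ 1) :
    ENNReal.ofReal (jarlskogDensity k x) =
      ENNReal.ofReal (normConst k * (k - 1 / 2) * x ^ (k - 3 / 2)) *
        ∫⁻ t in Ioo x 1, ENNReal.ofReal (densityIntegrand t) := by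
  have h1 := normConst_pos (show 0 < k by linarith)
  have h2 : 0 < k - 1 / 2 := by linarith
  have hi := densityIntegrand_intervalIntegrable hx0 hx1
  rw [intervalIntegrable_iff_integrableOn_Ioo_of_le hx1] at hi
  rw [jarlskogDensity, ENNReal.ofReal_mul (by positivity),
    intervalIntegral.integral_of_le hx1, integral_Ioc_eq_integral_Ioo,
    ofReal_integral_eq_lintegral_ofReal hi]
  exact ae_restrict_of_forall_mem measurableSet_Ioo fun t ht =>
    densityIntegrand_nonneg (hx0.trans ht.1) ht.2.le

/-- The law of the product of the three beta variables. -/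
theorem betaMeasure_mconv {k : ℝ} (hk : 1 / 2 < k) :
    betaMeasure (k - 1 / 2) 1 ∗ₘ (betaMeasure k (2 / 3) ∗ₘ betaMeasure k (1 / 3)) =
      lawWithDensity 1 (jarlskogDensity k) := by
  have hk0 : 0 < k := by linarith
  have hk2 : 0 < k - 1 / 2 := by linarith
  have hmeas : Measurable fun z : ℝ => ∫⁻ y in Ioi 0, ENNReal.ofReal y⁻¹ *
      betaPDF k (2 / 3) (z * y⁻¹) * betaPDF k (1 / 3) y := by
    have h1 := measurable_betaPDF k (2 / 3)
    have h2 := measurable_betaPDF k (1 / 3)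
    have : Measurable fun p : ℝ × ℝ => ENNReal.ofReal p.2⁻¹ *
      betaPDF k (2 / 3) (p.1 * p.2⁻¹) * betaPDF k (1 / 3) p.2 := by fun_prop
    exact this.lintegral_prod_right'
  have hzero : ∀ z : ℝ, z ≤ 0 ∨ 1 ≤ z → ∫⁻ y in Ioi 0, ENNReal.ofReal y⁻¹ *
      betaPDF k (2 / 3) (z * y⁻¹) * betaPDF k (1 / 3) y = 0 := by
    intro z hz
    refine (setLIntegral_congr_fun measurableSet_Ioi fun y (hy : 0 < y) => ?_).trans lintegral_zero
    rcases hz with hz | hz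
    · rw [betaPDF_eq_zero_of_nonpos (x := z * y⁻¹)
        (mul_nonpos_of_nonpos_of_nonneg hz (inv_pos.2 hy).le), mul_zero, zero_mul]
    · by_cases hy1 : 1 ≤ y
      · rw [betaPDF_eq_zero_of_one_le hy1, mul_zero]
      · rw [betaPDF_eq_zero_of_one_le (x := z * y⁻¹) (by
          rw [← div_eq_mul_inv, one_le_div hy]; linarith), mul_zero, zero_mul]
  rw [betaMeasure, betaMeasure, betaMeasure,
    withDensity_mconv_withDensity (measurable_betaPDF _ _) (measurable_betaPDF _ _)
      (fun y hy => betaPDF_eq_zero_of_nonpos hy),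
    withDensity_mconv_withDensity (measurable_betaPDF _ _) hmeas (fun y hy => hzero y (Or.inl hy)),
    lawWithDensity]
  refine withDensity_congr_ae ?_
  -- Discarding z = 1 reconciles the half-open interval in `lawWithDensity` with the open support of
  -- the beta densities.
  filter_upwards [Measure.ae_ne volume (1 : ℝ)] with z hz1
  by_cases hz : z ∈ Ioo (0 : ℝ) 1
  · rw [indicator_of_mem (Ioo_subset_Ioc_self hz), ofReal_jarlskogDensity hk hz.1 hz.2.le,
      ← lintegral_const_mul' _ _ ENNReal.ofReal_ne_top, ← lintegral_indicator measurableSet_Ioi,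
      ← lintegral_indicator measurableSet_Ioo]
    refine lintegral_congr fun y => ?_
    by_cases hy : y ∈ Ioo z 1
    · have hz0 := hz.1
      have hy0 : 0 < y := hz0.trans hy.1
      have hF := densityIntegrand_nonneg hy0 hy.2.le
      have hc := normConst_pos hk0
      rw [indicator_of_mem (show y ∈ Ioi 0 from hy0), indicator_of_mem hy,
        lintegral_betaPDF_mul_betaPDF_third hk0 hy0 hy.2,
        betaPDF_of_pos_lt_one (by positivity) (by rw [← div_eq_mul_inv, div_lt_one hy0]; exact hy.1),
        beta_one_right hk2, sub_self, Real.rpow_zero, mul_one,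
        ← ENNReal.ofReal_mul (by positivity),
        ← ENNReal.ofReal_mul (by positivity), ← ENNReal.ofReal_mul (by positivity)]
      congr 1
      rw [densityIntegrand, Real.mul_rpow hz0.le (by positivity), Real.inv_rpow hy0.le,
        ← Real.rpow_neg hy0.le, ← Real.rpow_neg_one y]
      -- The exponent -1/2 collects -1 from the convolution kernel, -(k - 3/2) from the first beta
      -- density at z / y, and k - 1 from the density of the inner product.
      have e : y ^ (-1 / 2 : ℝ) = y ^ (-1 : ℝ) * y ^ (-(k - 1 / 2 - 1)) * y ^ (k - 1) := by
        rw [← Real.rpow_add hy0, ← Real.rpow_add hy0]; ring_nf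
      rw [e, show k - 3 / 2 = k - 1 / 2 - 1 by ring]
      field_simp
    · rw [indicator_of_notMem hy]
      by_cases hy0 : y ∈ Ioi (0 : ℝ)
      · rw [indicator_of_mem hy0]
        have hy0' : 0 < y := hy0
        by_cases hyz : z < y
        · rw [hzero y (Or.inr (by by_contra h; exact hy ⟨hyz, not_le.1 h⟩)), mul_zero]
        · rw [betaPDF_eq_zero_of_one_le (x := z * y⁻¹) (by
            rw [← div_eq_mul_inv, one_le_div hy0']; exact not_lt.1 hyz), mul_zero, zero_mul]
      · rw [indicator_of_notMem hy0]
  · rw [indicator_of_notMem fun h => hz ⟨h.1, lt_of_le_of_ne h.2 hz1⟩]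
    refine (setLIntegral_congr_fun measurableSet_Ioi fun y (hy : 0 < y) => ?_).trans lintegral_zero
    by_cases hz0 : z ≤ 0
    · rw [betaPDF_eq_zero_of_nonpos (x := z * y⁻¹)
        (mul_nonpos_of_nonpos_of_nonneg hz0 (inv_pos.2 hy).le), mul_zero, zero_mul]
    · have hz1 : 1 ≤ z := by by_contra h; exact hz ⟨not_le.1 hz0, not_le.1 h⟩
      by_cases hy1 : 1 ≤ y
      · rw [hzero y (Or.inr hy1), mul_zero]
      · rw [betaPDF_eq_zero_of_one_le (x := z * y⁻¹) (by
          rw [← div_eq_mul_inv, one_le_div hy]; linarith), mul_zero, zero_mul]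

/-! ### Moments: determinacy, and the moments of beta products. -/

/-- Finite measures on `[0, 1]` are determined by their moments. -/
theorem ext_of_forall_moment_eq {μ ν : Measure ℝ} [IsFiniteMeasure μ] [IsFiniteMeasure ν]
    (hμ : ∀ᵐ x ∂μ, x ∈ Icc (0 : ℝ) 1) (hν : ∀ᵐ x ∂ν, x ∈ Icc (0 : ℝ) 1)
    (h : ∀ n : ℕ, ∫⁻ x, ‖x‖ₑ ^ n ∂μ = ∫⁻ x, ‖x‖ₑ ^ n ∂ν) : μ = ν := by
  have hint : ∀ (κ : Measure ℝ) [IsFiniteMeasure κ], (∀ᵐ x ∂κ, x ∈ Icc (0 : ℝ) 1) →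
      ∀ n : ℕ, Integrable (fun x => x ^ n) κ := fun κ _ hκ n =>
    Integrable.of_bound (by fun_prop) 1 <| by
      filter_upwards [hκ] with x hx
      rw [Real.norm_of_nonneg (pow_nonneg hx.1 n)]
      exact pow_le_one₀ hx.1 hx.2
  have hmom : ∀ (κ : Measure ℝ), (∀ᵐ x ∂κ, x ∈ Icc (0 : ℝ) 1) →
      ∀ n : ℕ, ∫ x, x ^ n ∂κ = (∫⁻ x, ‖x‖ₑ ^ n ∂κ).toReal := by
    intro κ hκ n
    rw [integral_eq_lintegral_of_nonneg_ae (by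
      filter_upwards [hκ] with x hx using pow_nonneg hx.1 n) (by fun_prop)]
    congr 1
    refine lintegral_congr_ae ?_
    filter_upwards [hκ] with x hx
    rw [ENNReal.ofReal_pow hx.1, Real.enorm_of_nonneg hx.1]
  have hpolyint : ∀ (κ : Measure ℝ) [IsFiniteMeasure κ], (∀ᵐ x ∂κ, x ∈ Icc (0 : ℝ) 1) →
      ∀ p : Polynomial ℝ, Integrable (fun x => p.eval x) κ := by
    intro κ _ hκ p
    simp_rw [Polynomial.eval_eq_sum_range]
    exact integrable_finsetSum _ fun i _ => (hint κ hκ i).const_mul _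
  have hpoly : ∀ p : Polynomial ℝ, ∫ x, p.eval x ∂μ = ∫ x, p.eval x ∂ν := by
    intro p
    simp_rw [Polynomial.eval_eq_sum_range]
    rw [integral_finsetSum _ fun i _ => (hint μ hμ i).const_mul _,
      integral_finsetSum _ fun i _ => (hint ν hν i).const_mul _]
    simp_rw [integral_const_mul, hmom μ hμ, hmom ν hν, h]
  refine ext_of_forall_integral_eq_of_IsFiniteMeasure fun f => ?_
  have hbound : ∀ (κ : Measure ℝ) [IsFiniteMeasure κ], (∀ᵐ x ∂κ, x ∈ Icc (0 : ℝ) 1) →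
      ∀ (p : Polynomial ℝ) (ε : ℝ), (∀ x ∈ Icc (0 : ℝ) 1, |p.eval x - f x| < ε) →
      |∫ x, p.eval x ∂κ - ∫ x, f x ∂κ| ≤ ε * κ.real univ := by
    intro κ _ hκ p ε hp
    rw [← integral_sub (hpolyint κ hκ p) (f.integrable κ)]
    rw [← Real.norm_eq_abs]
    refine norm_integral_le_of_norm_le_const (μ := κ) ?_
    filter_upwards [hκ] with x hx using (hp x hx).le
  refine eq_of_forall_dist_le fun ε hε => ?_
  have hK : 0 < μ.real univ + ν.real univ + 1 := by positivity
  -- Weierstrass approximation. The tolerance is divided by the two total masses, plus 1 so that the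
  -- denominator is positive, and then the two errors add up to at most ε.
  obtain ⟨p, hp⟩ := exists_polynomial_near_of_continuousOn 0 1 f f.continuous.continuousOn
    (ε / (μ.real univ + ν.real univ + 1)) (by positivity)
  have h1 := hbound μ hμ p _ hp
  have h2 := hbound ν hν p _ hp
  rw [hpoly] at h1
  rw [Real.dist_eq]
  have h3 : ε / (μ.real univ + ν.real univ + 1) * μ.real univ +
      ε / (μ.real univ + ν.real univ + 1) * ν.real univ ≤ ε := by
    rw [← mul_add, div_mul_eq_mul_div, div_le_iff₀ hK]
    nlinarith
  rw [abs_le] at *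
  constructor <;> linarith [h1.1, h1.2, h2.1, h2.2]

/-- Absolute moments in `ENNReal` multiply by Tonelli alone, with no integrability to check; this is
why moments take this form throughout. -/
theorem lintegral_enorm_pow_mconv (μ ν : Measure ℝ) [SFinite ν] (n : ℕ) :
    ∫⁻ x, ‖x‖ₑ ^ n ∂(μ ∗ₘ ν) = (∫⁻ x, ‖x‖ₑ ^ n ∂μ) * ∫⁻ x, ‖x‖ₑ ^ n ∂ν := by
  rw [Measure.lintegral_mconv (by fun_prop)]
  simp_rw [enorm_mul, mul_pow]
  rw [← lintegral_mul_const _ (by fun_prop)]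
  exact lintegral_congr fun x => lintegral_const_mul _ (by fun_prop)

theorem lintegral_enorm_pow_betaMeasure {a b : ℝ} (ha : 0 < a) (hb : 0 < b) (n : ℕ) :
    ∫⁻ x, ‖x‖ₑ ^ n ∂(betaMeasure a b) =
      ENNReal.ofReal ((ascPochhammer ℝ n).eval a / (ascPochhammer ℝ n).eval (a + b)) := by
  have hB := beta_pos ha hb
  rw [betaMeasure, lintegral_withDensity_eq_lintegral_mul _ (measurable_betaPDF a b) (by fun_prop)]
  calc _ = ∫⁻ x in Ioo (0 : ℝ) 1, ENNReal.ofReal (beta a b)⁻¹ *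
        ENNReal.ofReal (x ^ (a + n - 1) * (1 - x) ^ (b - 1)) := by
        rw [← lintegral_indicator measurableSet_Ioo]
        refine lintegral_congr fun x => ?_
        by_cases hx : x ∈ Ioo (0 : ℝ) 1
        · have hx0 := hx.1
          have h1x : 0 < 1 - x := sub_pos.2 hx.2
          rw [indicator_of_mem hx, Pi.mul_apply, betaPDF_of_pos_lt_one hx.1 hx.2,
            Real.enorm_of_nonneg hx.1.le, ← ENNReal.ofReal_pow hx.1.le,
            ← ENNReal.ofReal_mul (by positivity), ← ENNReal.ofReal_mul (by positivity),
            show a + n - 1 = (a - 1) + n by ring, Real.rpow_add hx0, Real.rpow_natCast]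
          congr 1
          field_simp
        · rw [indicator_of_notMem hx, Pi.mul_apply]
          by_cases hx0 : x ≤ 0
          · rw [betaPDF_eq_zero_of_nonpos hx0, zero_mul]
          · rw [betaPDF_eq_zero_of_one_le (by by_contra h; exact hx ⟨not_le.1 hx0, not_le.1 h⟩),
              zero_mul]
    _ = _ := by
        rw [lintegral_const_mul _ (by fun_prop),
          setLIntegral_rpow_mul_one_sub_rpow (by positivity) hb,
          ← ENNReal.ofReal_mul (by positivity), beta_natCast_add ha hb]
        congr 1
        field_simp

theorem lawWithDensity_jarlskogDensity_univ {k : ℝ} (hk : 1 / 2 < k) :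
    lawWithDensity 1 (jarlskogDensity k) univ = 1 := by
  have := isProbabilityMeasureBeta (show 0 < k - 1 / 2 by linarith) one_pos
  have := isProbabilityMeasureBeta (show 0 < k by linarith) (show (0 : ℝ) < 1 / 3 by norm_num)
  have := isProbabilityMeasureBeta (show 0 < k by linarith) (show (0 : ℝ) < 2 / 3 by norm_num)
  rw [← betaMeasure_mconv hk]
  exact measure_univ

theorem ae_mem_Icc_lawWithDensity (r : ℝ) (p : ℝ → ℝ) :
    ∀ᵐ x ∂(lawWithDensity r p), x ∈ Icc 0 r := by
  rw [lawWithDensity, withDensity_indicator measurableSet_Ioc]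
  refine withDensity_absolutelyContinuous _ _ ?_
  exact ae_restrict_of_forall_mem measurableSet_Ioc fun x hx => Ioc_subset_Icc_self hx

/-- The three beta moments are quotients of rising factorials. The pair (1/2)ₙ/(3/2)ₙ telescopes to
1/(2n + 1), and 27ⁿ (1)ₙ(4/3)ₙ(5/3)ₙ = (3n + 2)!/2. The right-hand side is arranged for comparison
with `lintegral_enorm_pow_paramX`. -/
theorem lintegral_enorm_pow_lawWithDensity (n : ℕ) :
    ∫⁻ x, ‖x‖ₑ ^ n ∂(lawWithDensity 1 (jarlskogDensity 1)) =
      ENNReal.ofReal (27 ^ n * (2 * n.factorial ^ 3 / (3 * n + 2).factorial) / (2 * n + 1)) := by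
  have := isProbabilityMeasureBeta (show (0 : ℝ) < 1 by norm_num) (show (0 : ℝ) < 1 / 3 by norm_num)
  have := isProbabilityMeasureBeta (show (0 : ℝ) < 1 by norm_num) (show (0 : ℝ) < 2 / 3 by norm_num)
  rw [← betaMeasure_mconv (by norm_num), lintegral_enorm_pow_mconv, lintegral_enorm_pow_mconv,
    lintegral_enorm_pow_betaMeasure (by norm_num) (by norm_num),
    lintegral_enorm_pow_betaMeasure (by norm_num) (by norm_num),
    lintegral_enorm_pow_betaMeasure (by norm_num) (by norm_num)]
  have hp : ∀ a : ℝ, 0 < a → 0 < (ascPochhammer ℝ n).eval a := fun a => ascPochhammer_pos n a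
  have h1 := hp 1 (by norm_num)
  have h2 := hp (1 + 2 / 3) (by norm_num)
  have h3 := hp (1 + 1 / 3) (by norm_num)
  have h4 := hp (1 - 1 / 2) (by norm_num)
  have h5 := hp (1 - 1 / 2 + 1) (by norm_num)
  rw [← ENNReal.ofReal_mul (by positivity), ← ENNReal.ofReal_mul (by positivity)]
  congr 1
  clear h1 h2 h3 h4 h5 hp
  induction n with
  | zero => simp
  | succ n ih =>
    have hp : ∀ a : ℝ, 0 < a → 0 < (ascPochhammer ℝ n).eval a := fun a => ascPochhammer_pos n a
    have h1 := hp 1 (by norm_num)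
    have h2 := hp (1 + 2 / 3) (by norm_num)
    have h3 := hp (1 + 1 / 3) (by norm_num)
    have h4 := hp (1 - 1 / 2) (by norm_num)
    have h5 := hp (1 - 1 / 2 + 1) (by norm_num)
    simp only [ascPochhammer_succ_eval]
    -- Separates the new factor of each rising factorial from the product covered by the induction
    -- hypothesis.
    have e : ∀ a b c d e f a' b' c' d' e' f' : ℝ, a * a' / (b * b') * (c * c' / (d * d') * (e * e' / (f * f'))) =
      a / b * (c / d * (e / f)) * (a' / b' * (c' / d' * (e' / f'))) := by
      intros; ring
    rw [e, ih, show 3 * (n + 1) + 2 = 3 * n + 2 + 1 + 1 + 1 by ring, Nat.factorial_succ n,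
      Nat.factorial_succ (3 * n + 2 + 1 + 1), Nat.factorial_succ (3 * n + 2 + 1),
      Nat.factorial_succ (3 * n + 2)]
    have hf1 : (0 : ℝ) < n.factorial := by positivity
    have hf2 : (0 : ℝ) < (3 * n + 2).factorial := by positivity
    generalize (3 * n + 2).factorial = N at *
    push_cast
    have e1 : (1 + 2 / 3 + n : ℝ) ≠ 0 := by positivity
    have e2 : (1 + 1 / 3 + n : ℝ) ≠ 0 := by positivity
    have e3 : (1 - 1 / 2 + 1 + n : ℝ) ≠ 0 := by
      have := n.cast_nonneg (α := ℝ); linarith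
    have e4 : (2 * n + 1 : ℝ) ≠ 0 := by positivity
    have e5 : (2 * (n + 1) + 1 : ℝ) ≠ 0 := by positivity
    field_simp
    ring

/-! ### The flat measure on the parameters and the moments of X under it. -/

/-- The open triangle of the first two coordinates of a point of the standard simplex. -/
def openTriangle : Set (ℝ × ℝ) := {p | 0 < p.1 ∧ 0 < p.2 ∧ p.1 + p.2 < 1}

theorem measurableSet_openTriangle : MeasurableSet openTriangle :=
  (measurableSet_lt measurable_const measurable_fst).inter
    ((measurableSet_lt measurable_const measurable_snd).inter
      (measurableSet_lt (measurable_fst.add measurable_snd) measurable_const))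

theorem setLIntegral_openTriangle {g : ℝ × ℝ → ENNReal} (hg : Measurable g) :
    ∫⁻ p in openTriangle, g p =
      ∫⁻ x in Ioo 0 1, ENNReal.ofReal (1 - x) * ∫⁻ t in Ioo 0 1, g (x, (1 - x) * t) := by
  rw [← lintegral_indicator measurableSet_openTriangle, Measure.volume_eq_prod,
    lintegral_prod _ (hg.indicator measurableSet_openTriangle).aemeasurable,
    ← lintegral_indicator measurableSet_Ioo]
  refine lintegral_congr fun x => ?_
  by_cases hx : x ∈ Ioo (0 : ℝ) 1
  · have h := setLIntegral_Ioo_comp_affine (sub_pos.2 hx.2) fun y => g (x, y)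
    simp only [zero_add, sub_zero] at h
    rw [indicator_of_mem hx, ← h, ← lintegral_indicator measurableSet_Ioo]
    refine lintegral_congr fun y => ?_
    have : (x, y) ∈ openTriangle ↔ y ∈ Ioo 0 (1 - x) := by
      simp only [openTriangle, mem_ofPred_eq, mem_Ioo]
      exact ⟨fun h => ⟨h.2.1, by linarith [h.2.2]⟩, fun h => ⟨hx.1, h.1, by linarith [h.2]⟩⟩
    by_cases hy : y ∈ Ioo 0 (1 - x)
    · rw [indicator_of_mem hy, indicator_of_mem (this.2 hy)]
    · rw [indicator_of_notMem hy, indicator_of_notMem fun h => hy (this.1 h)]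
  · rw [indicator_of_notMem hx]
    refine (lintegral_congr fun y => ?_).trans lintegral_zero
    refine indicator_of_notMem (fun h => hx ⟨h.1, ?_⟩) _
    linarith [h.2.1, h.2.2]

theorem beta_natCast_natCast (a b : ℕ) :
    beta (a + 1) (b + 1) = a.factorial * b.factorial / (a + b + 1).factorial := by
  rw [beta, Real.Gamma_nat_eq_factorial, Real.Gamma_nat_eq_factorial,
    show (a + 1 + (b + 1) : ℝ) = ((a + b + 1 : ℕ) : ℝ) + 1 by push_cast; ring,
    Real.Gamma_nat_eq_factorial]

theorem setLIntegral_pow_mul_one_sub_pow (a b : ℕ) :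
    ∫⁻ x in Ioo (0 : ℝ) 1, ENNReal.ofReal (x ^ a * (1 - x) ^ b) =
      ENNReal.ofReal (a.factorial * b.factorial / (a + b + 1).factorial) := by
  rw [← beta_natCast_natCast, ← setLIntegral_rpow_mul_one_sub_rpow (by positivity) (by positivity)]
  simp

/-- A Dirichlet integral. Setting y = (1 - x)t turns xy(1 - x - y) into x(1 - x)² t(1 - t), which
splits it into two beta integrals; the odd exponent 2n + 1 includes one factor 1 - x from dy. -/
theorem setLIntegral_openTriangle_pow (n : ℕ) :
    ∫⁻ p in openTriangle, ENNReal.ofReal ((p.1 * p.2 * (1 - p.1 - p.2)) ^ n) =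
      ENNReal.ofReal (n.factorial ^ 3 / (3 * n + 2).factorial) := by
  rw [setLIntegral_openTriangle (by fun_prop)]
  calc _ = ∫⁻ x in Ioo (0 : ℝ) 1, ENNReal.ofReal (x ^ n * (1 - x) ^ (2 * n + 1)) *
        ENNReal.ofReal (n.factorial * n.factorial / (n + n + 1).factorial) := by
        refine setLIntegral_congr_fun measurableSet_Ioo fun x hx => ?_
        have hx0 := hx.1
        have h1x : 0 < 1 - x := sub_pos.2 hx.2
        rw [← setLIntegral_pow_mul_one_sub_pow, ← lintegral_const_mul _ (by fun_prop),
          ← lintegral_const_mul _ (by fun_prop)]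
        refine lintegral_congr fun t => ?_
        rw [← ENNReal.ofReal_mul h1x.le, ← ENNReal.ofReal_mul (by positivity)]
        congr 1
        simp only
        rw [show x * ((1 - x) * t) * (1 - x - (1 - x) * t) = x * (1 - x) ^ 2 * (t * (1 - t)) by ring,
          mul_pow, mul_pow, mul_pow, ← pow_mul]
        ring
    _ = _ := by
        rw [lintegral_mul_const _ (by fun_prop), setLIntegral_pow_mul_one_sub_pow,
          ← ENNReal.ofReal_mul (by positivity)]
        congr 1
        rw [show n + (2 * n + 1) + 1 = 3 * n + 2 by ring, show n + n + 1 = 2 * n + 1 by ring]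
        field_simp

theorem prod_odd_div_even (n : ℕ) :
    ∏ i ∈ Finset.range n, (2 * (i : ℝ) + 1) / (2 * i + 2) =
      (2 * n).factorial / (4 ^ n * n.factorial ^ 2) := by
  induction n with
  | zero => simp
  | succ n ih =>
    rw [Finset.prod_range_succ, ih, show 2 * (n + 1) = 2 * n + 1 + 1 by ring,
      Nat.factorial_succ n, Nat.factorial_succ (2 * n + 1), Nat.factorial_succ (2 * n)]
    generalize (2 * n).factorial = N
    push_cast
    field_simp
    ring

theorem setLIntegral_sin_pow (n : ℕ) :
    ∫⁻ θ in Ioo 0 Real.pi, ENNReal.ofReal ((Real.sin θ ^ 2) ^ n) =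
      ENNReal.ofReal (Real.pi * ((2 * n).factorial / (4 ^ n * n.factorial ^ 2))) := by
  rw [← prod_odd_div_even, ← integral_sin_pow_even, intervalIntegral.integral_of_le Real.pi_pos.le,
    integral_Ioc_eq_integral_Ioo, ofReal_integral_eq_lintegral_ofReal]
  · simp_rw [pow_mul]
  · have h : Continuous fun x => Real.sin x ^ (2 * n) := by fun_prop
    exact (h.integrableOn_Icc (a := 0) (b := Real.pi)).mono_set Ioo_subset_Icc_self
  · exact Filter.Eventually.of_forall fun x => by
      show 0 ≤ Real.sin x ^ (2 * n)
      rw [pow_mul]; positivity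

/-- Lebesgue measure on the parameters `((p₀, p₁), τ, θ)`. -/
noncomputable def paramMeasure : Measure ((ℝ × ℝ) × ℝ × ℝ) :=
  (volume.restrict openTriangle).prod
    ((volume.restrict (Ioo 0 1)).prod (volume.restrict (Ioo 0 Real.pi)))

instance : SFinite paramMeasure := by unfold paramMeasure; infer_instance

theorem lintegral_paramMeasure {g : (ℝ × ℝ) × ℝ × ℝ → ENNReal} (hg : Measurable g) :
    ∫⁻ q, g q ∂paramMeasure =
      ∫⁻ p in openTriangle, ∫⁻ τ in Ioo 0 1, ∫⁻ θ in Ioo 0 Real.pi, g (p, τ, θ) := by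
  rw [paramMeasure, lintegral_prod _ hg.aemeasurable]
  refine lintegral_congr fun p => ?_
  rw [lintegral_prod _ (by fun_prop)]

theorem ae_paramMeasure : ∀ᵐ q ∂paramMeasure,
    q.1 ∈ openTriangle ∧ q.2.1 ∈ Ioo (0 : ℝ) 1 ∧ q.2.2 ∈ Ioo 0 Real.pi := by
  have h : paramMeasure =
      volume.restrict (openTriangle ×ˢ (Ioo (0 : ℝ) 1 ×ˢ Ioo 0 Real.pi)) := by
    rw [paramMeasure, Measure.prod_restrict, Measure.prod_restrict]
    rfl
  rw [h]
  exact ae_restrict_of_forall_mem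
    (measurableSet_openTriangle.prod (measurableSet_Ioo.prod measurableSet_Ioo)) fun q hq => hq

/-- The variable `X = 27 Q` in terms of the parameters. -/
noncomputable def paramX (q : (ℝ × ℝ) × ℝ × ℝ) : ℝ :=
  27 * (4 * q.1.1 * q.1.2 * (1 - q.1.1 - q.1.2) * (q.2.1 * (1 - q.2.1)) * Real.sin q.2.2 ^ 2)

theorem measurable_paramX : Measurable paramX := by unfold paramX; fun_prop

/-- The inequality of arithmetic and geometric means for the barycentric coordinates x, y, 1 - x -
y. It explains the normalization 27: it gives X ≤ 1. -/
theorem mul_mul_one_sub_sub_le {x y : ℝ} (hx : 0 < x) (hy : 0 < y) (hxy : x + y < 1) :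
    27 * (x * y * (1 - x - y)) ≤ 1 := by
  have hz : 0 < 1 - x - y := by linarith
  nlinarith [mul_nonneg hx.le (sq_nonneg (y - (1 - x - y))), mul_nonneg hy.le (sq_nonneg (x - (1 - x - y))),
    mul_nonneg hz.le (sq_nonneg (x - y)), sq_nonneg (x - y), sq_nonneg (x - 1 / 3), sq_nonneg (y - 1 / 3),
    sq_nonneg (x + y - 2 / 3)]

theorem paramX_mem_Icc {q : (ℝ × ℝ) × ℝ × ℝ} (h1 : q.1 ∈ openTriangle)
    (h2 : q.2.1 ∈ Ioo (0 : ℝ) 1) : paramX q ∈ Icc (0 : ℝ) 1 := by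
  obtain ⟨⟨x, y⟩, t, θ⟩ := q
  obtain ⟨hx, hy, hxy⟩ := h1
  obtain ⟨ht0, ht1⟩ := h2
  simp only at hx hy hxy ht0 ht1
  have hz : 0 < 1 - x - y := by linarith
  have ht : 0 < 1 - t := by linarith
  simp only [paramX]
  refine ⟨by positivity, ?_⟩
  have e1 := mul_mul_one_sub_sub_le hx hy hxy
  have e2 : 4 * (t * (1 - t)) ≤ 1 := by nlinarith [sq_nonneg (2 * t - 1)]
  have e3 : Real.sin θ ^ 2 ≤ 1 := Real.sin_sq_le_one θ
  calc 27 * (4 * x * y * (1 - x - y) * (t * (1 - t)) * Real.sin θ ^ 2)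
      = (27 * (x * y * (1 - x - y))) * (4 * (t * (1 - t))) * Real.sin θ ^ 2 := by ring
    _ ≤ 1 * 1 * 1 := by gcongr
    _ = 1 := by norm_num

/-- X is a product of functions of the separate parameters, so the integral factors. The beta
integral n!²/(2n + 1)! and the Wallis integral combine to π/(4ⁿ(2n + 1)), and 4ⁿ cancels against the
factor 4 in Q. -/
theorem lintegral_enorm_pow_paramX (n : ℕ) :
    ∫⁻ q, ‖paramX q‖ₑ ^ n ∂paramMeasure =
      ENNReal.ofReal (Real.pi / 2 *
        (27 ^ n * (2 * n.factorial ^ 3 / (3 * n + 2).factorial) / (2 * n + 1))) := by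
  have hm := measurable_paramX
  rw [lintegral_paramMeasure (by fun_prop)]
  calc _ = ∫⁻ p in openTriangle, ∫⁻ τ in Ioo 0 1, ∫⁻ θ in Ioo 0 Real.pi,
        ENNReal.ofReal ((27 * 4) ^ n) * ENNReal.ofReal ((p.1 * p.2 * (1 - p.1 - p.2)) ^ n) *
          ENNReal.ofReal (τ ^ n * (1 - τ) ^ n) * ENNReal.ofReal ((Real.sin θ ^ 2) ^ n) := by
        refine setLIntegral_congr_fun measurableSet_openTriangle fun p hp =>
          setLIntegral_congr_fun measurableSet_Ioo fun τ hτ => lintegral_congr fun θ => ?_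
        have h := paramX_mem_Icc (q := (p, τ, θ)) hp hτ
        obtain ⟨hx, hy, hxy⟩ := hp
        have hz : 0 < 1 - p.1 - p.2 := by linarith
        have ht0 := hτ.1
        have ht : 0 < 1 - τ := sub_pos.2 hτ.2
        rw [Real.enorm_of_nonneg h.1, ← ENNReal.ofReal_pow h.1, ← ENNReal.ofReal_mul (by positivity),
          ← ENNReal.ofReal_mul (by positivity), ← ENNReal.ofReal_mul (by positivity)]
        congr 1
        rw [paramX, ← mul_pow, ← mul_pow, ← mul_pow, ← mul_pow]
        congr 1
        simp only
        ring
    _ = _ := by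
        have h1 : ∀ a : ENNReal, a ≠ ⊤ → ∀ τ, ∫⁻ θ in Ioo 0 Real.pi,
            a * ENNReal.ofReal (τ ^ n * (1 - τ) ^ n) * ENNReal.ofReal ((Real.sin θ ^ 2) ^ n) =
            a * ENNReal.ofReal (τ ^ n * (1 - τ) ^ n) *
              ENNReal.ofReal (Real.pi * ((2 * n).factorial / (4 ^ n * n.factorial ^ 2))) := by
          intro a _ τ
          rw [lintegral_const_mul _ (by fun_prop), setLIntegral_sin_pow]
        have h2 : ∀ p : ℝ × ℝ, ENNReal.ofReal ((27 * 4) ^ n) *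
            ENNReal.ofReal ((p.1 * p.2 * (1 - p.1 - p.2)) ^ n) ≠ ⊤ := fun p =>
          ENNReal.mul_ne_top ENNReal.ofReal_ne_top ENNReal.ofReal_ne_top
        simp_rw [h1 _ (h2 _)]
        simp_rw [lintegral_mul_const' _ _ ENNReal.ofReal_ne_top,
          lintegral_const_mul' _ _ (h2 _), setLIntegral_pow_mul_one_sub_pow,
          lintegral_mul_const' _ _ ENNReal.ofReal_ne_top,
          lintegral_const_mul' _ _ ENNReal.ofReal_ne_top, setLIntegral_openTriangle_pow]
        rw [← ENNReal.ofReal_mul (by positivity), ← ENNReal.ofReal_mul (by positivity),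
          ← ENNReal.ofReal_mul (by positivity)]
        congr 1
        rw [show n + n + 1 = 2 * n + 1 by ring, Nat.factorial_succ (2 * n), mul_pow]
        push_cast
        field_simp

theorem map_paramX : paramMeasure.map paramX =
    ENNReal.ofReal (Real.pi / 2) • lawWithDensity 1 (jarlskogDensity 1) := by
  have hm := measurable_paramX
  have hmass : ∀ n : ℕ, ∫⁻ x, ‖x‖ₑ ^ n ∂(paramMeasure.map paramX) =
      ∫⁻ x, ‖x‖ₑ ^ n ∂(ENNReal.ofReal (Real.pi / 2) • lawWithDensity 1 (jarlskogDensity 1)) := by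
    intro n
    rw [lintegral_map (by fun_prop) hm, lintegral_enorm_pow_paramX, lintegral_smul_measure,
      lintegral_enorm_pow_lawWithDensity, smul_eq_mul, ← ENNReal.ofReal_mul (by positivity)]
  have hfin : IsFiniteMeasure
      (ENNReal.ofReal (Real.pi / 2) • lawWithDensity 1 (jarlskogDensity 1)) := ⟨by
    rw [Measure.smul_apply, lawWithDensity_jarlskogDensity_univ (by norm_num)]
    simp⟩
  -- Finiteness of the parameter measure is read off from the moment n = 0, which is the total mass.
  have hfin' : IsFiniteMeasure (paramMeasure.map paramX) := ⟨by
    have := hmass 0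
    simp only [pow_zero, lintegral_one] at this
    rw [this]
    exact measure_lt_top _ _⟩
  refine ext_of_forall_moment_eq ?_ ?_ hmass
  · refine (ae_map_iff hm.aemeasurable measurableSet_Icc).2 ?_
    filter_upwards [ae_paramMeasure] with q hq using paramX_mem_Icc hq.1 hq.2.1
  · exact Measure.ae_smul_measure (ae_mem_Icc_lawWithDensity _ _) _

/-! ### Unitary matrices and the identity Q = 4 J². -/

theorem unitaryGroup_row_inner {U : Matrix (Fin 3) (Fin 3) ℂ} (hU : U ∈ Matrix.unitaryGroup (Fin 3) ℂ)
    (i j : Fin 3) : U i 0 * star (U j 0) + U i 1 * star (U j 1) + U i 2 * star (U j 2) =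
      if i = j then 1 else 0 := by
  have h := congrFun (congrFun (Matrix.mem_unitaryGroup_iff.1 hU) i) j
  rw [Matrix.mul_apply, Matrix.one_apply, Fin.sum_univ_three] at h
  simpa using h

theorem unitaryGroup_row_sum {U : Matrix (Fin 3) (Fin 3) ℂ} (hU : U ∈ Matrix.unitaryGroup (Fin 3) ℂ)
    (i : Fin 3) : ‖U i 0‖ ^ 2 + ‖U i 1‖ ^ 2 + ‖U i 2‖ ^ 2 = 1 := by
  have h := unitaryGroup_row_inner hU i i
  simp only [Complex.star_def, Complex.mul_conj', if_true] at h
  exact_mod_cast h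

theorem unitaryGroup_col_sum {U : Matrix (Fin 3) (Fin 3) ℂ} (hU : U ∈ Matrix.unitaryGroup (Fin 3) ℂ)
    (j : Fin 3) : ‖U 0 j‖ ^ 2 + ‖U 1 j‖ ^ 2 + ‖U 2 j‖ ^ 2 = 1 := by
  have h := unitaryGroup_row_sum (Unitary.star_mem hU) j
  simpa [Matrix.star_apply] using h

/-- The upper left block of squared moduli. -/
noncomputable def blockModuli (U : Matrix (Fin 3) (Fin 3) ℂ) : Fin 4 → ℝ :=
  ![‖U 0 0‖ ^ 2, ‖U 0 1‖ ^ 2, ‖U 1 0‖ ^ 2, ‖U 1 1‖ ^ 2]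

theorem sqModuli_eq_birkhoffParam {U : Matrix (Fin 3) (Fin 3) ℂ}
    (hU : U ∈ Matrix.unitaryGroup (Fin 3) ℂ) : sqModuli U = birkhoffParam (blockModuli U) := by
  have r0 := unitaryGroup_row_sum hU 0
  have r1 := unitaryGroup_row_sum hU 1
  have c0 := unitaryGroup_col_sum hU 0
  have c1 := unitaryGroup_col_sum hU 1
  have c2 := unitaryGroup_col_sum hU 2
  ext i j
  fin_cases i <;> fin_cases j <;> simp [sqModuli, birkhoffParam, blockModuli] <;> linarith

theorem areaQ_sqModuli {U : Matrix (Fin 3) (Fin 3) ℂ} (hU : U ∈ Matrix.unitaryGroup (Fin 3) ℂ) :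
    areaQ (sqModuli U) = 4 * jarlskog U ^ 2 := by
  have r0 := unitaryGroup_row_sum hU 0
  have r1 := unitaryGroup_row_sum hU 1
  have h := unitaryGroup_row_inner hU 0 1
  simp only [Fin.isValue, zero_ne_one, if_false] at h
  set w : ℂ := U 0 0 * U 1 1 * star (U 0 1) * star (U 1 0) with hw
  have hns : ‖w‖ ^ 2 = ‖U 0 0‖ ^ 2 * ‖U 0 1‖ ^ 2 * ‖U 1 0‖ ^ 2 * ‖U 1 1‖ ^ 2 := by
    rw [hw]; simp only [norm_mul, norm_star]; ring
  have hns2 : ‖w‖ ^ 2 = w.re ^ 2 + w.im ^ 2 := by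
    rw [Complex.sq_norm, Complex.normSq_apply]; ring
  -- Orthogonality of rows 0 and 1 writes the third term as minus the sum of the first two; taking
  -- squared moduli, the cross term of that sum is 2 Re w.
  have h2 : ‖U 0 2‖ ^ 2 * ‖U 1 2‖ ^ 2 =
      ‖U 0 0‖ ^ 2 * ‖U 1 0‖ ^ 2 + ‖U 0 1‖ ^ 2 * ‖U 1 1‖ ^ 2 + 2 * w.re := by
    have e : U 0 2 * star (U 1 2) = -(U 0 0 * star (U 1 0) + U 0 1 * star (U 1 1)) := by
      linear_combination h
    have e2 := congrArg (fun x : ℂ => ‖x‖ ^ 2) e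
    simp only [norm_mul, norm_neg, norm_star, mul_pow] at e2
    rw [e2]
    simp only [Complex.sq_norm, Complex.normSq_apply, hw, Complex.star_def, Complex.add_re,
      Complex.add_im, Complex.mul_re, Complex.mul_im, Complex.conj_re, Complex.conj_im]
    ring
  have hre : 2 * w.re = 1 - ‖U 0 0‖ ^ 2 - ‖U 0 1‖ ^ 2 - ‖U 1 0‖ ^ 2 - ‖U 1 1‖ ^ 2 +
      ‖U 0 0‖ ^ 2 * ‖U 1 1‖ ^ 2 + ‖U 0 1‖ ^ 2 * ‖U 1 0‖ ^ 2 := by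
    have e1 : ‖U 0 2‖ ^ 2 = 1 - ‖U 0 0‖ ^ 2 - ‖U 0 1‖ ^ 2 := by linarith
    have e2 : ‖U 1 2‖ ^ 2 = 1 - ‖U 1 0‖ ^ 2 - ‖U 1 1‖ ^ 2 := by linarith
    rw [e1, e2] at h2
    linear_combination -h2
  have hj : jarlskog U = w.im := rfl
  simp only [areaQ, sqModuli, Matrix.of_apply]
  rw [hj]
  linear_combination (-4) * hns + 4 * hns2 + (2 * w.re - (‖U 0 0‖ ^ 2 + ‖U 0 1‖ ^ 2 + ‖U 1 0‖ ^ 2 +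
    ‖U 1 1‖ ^ 2 - 1 - ‖U 0 0‖ ^ 2 * ‖U 1 1‖ ^ 2 - ‖U 0 1‖ ^ 2 * ‖U 1 0‖ ^ 2)) * hre

theorem jarlskogX_sqModuli {U : Matrix (Fin 3) (Fin 3) ℂ} (hU : U ∈ Matrix.unitaryGroup (Fin 3) ℂ) :
    jarlskogX (sqModuli U) = 108 * jarlskog U ^ 2 := by
  rw [jarlskogX, areaQ_sqModuli hU]; ring

/-! ### Parametrizing unistochastic matrices. -/

/-- A unitary matrix with prescribed first row `u` and `s² = |u₁|² + |u₂|²`. -/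
noncomputable def frameMatrix (u : Fin 3 → ℂ) (s : ℝ) : Matrix (Fin 3) (Fin 3) ℂ :=
  !![u 0, u 1, u 2;
     s, -(star (u 0) * u 1) / s, -(star (u 0) * u 2) / s;
     0, star (u 2) / s, -star (u 1) / s]

/-- Row 1 is the normalized component of the first basis vector orthogonal to u, namely (e₀ -
conj(u₀) u)/s, and row 2 is orthogonal to both u and e₀. The zero entry at the start of row 2 is
what keeps the entry (1 - x)t free of θ. -/
theorem frameMatrix_mem_unitaryGroup {u : Fin 3 → ℂ} {s : ℝ} (hs : 0 < s)
    (hu : ‖u 0‖ ^ 2 + ‖u 1‖ ^ 2 + ‖u 2‖ ^ 2 = 1) (hsu : s ^ 2 = 1 - ‖u 0‖ ^ 2) :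
    frameMatrix u s ∈ Matrix.unitaryGroup (Fin 3) ℂ := by
  have hs0 : (s : ℂ) ≠ 0 := by exact_mod_cast hs.ne'
  have h1 : u 0 * star (u 0) + u 1 * star (u 1) + u 2 * star (u 2) = 1 := by
    simp only [Complex.star_def, Complex.mul_conj']; exact_mod_cast hu
  have h2 : (s : ℂ) ^ 2 = 1 - u 0 * star (u 0) := by
    simp only [Complex.star_def, Complex.mul_conj']; exact_mod_cast hsu
  simp only [Complex.star_def] at h1 h2
  rw [Matrix.mem_unitaryGroup_iff]
  ext i j
  fin_cases i <;> fin_cases j <;>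
    simp [frameMatrix, Matrix.mul_apply, Fin.sum_univ_three, Matrix.star_apply] <;> field_simp
  · linear_combination h1
  · linear_combination u 0 * (h2 - h1)
  · ring
  · linear_combination (starRingEnd ℂ) (u 0) * (h2 - h1)
  · linear_combination ((starRingEnd ℂ) (u 0) * u 0) * h1 +
      (s ^ 2 - (starRingEnd ℂ) (u 0) * u 0) * h2
  · ring
  · ring
  · ring
  · linear_combination h1 - h2

/-- The coordinates `b` of the parameters `((p₀, p₁), τ, θ)`. -/
noncomputable def paramPoint (q : (ℝ × ℝ) × ℝ × ℝ) : Fin 4 → ℝ :=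
  ![q.1.1, q.1.2, (1 - q.1.1) * q.2.1,
    (q.2.1 * (q.1.1 * q.1.2) + (1 - q.2.1) * (1 - q.1.1 - q.1.2) -
      2 * √(q.2.1 * (1 - q.2.1) * (q.1.1 * q.1.2 * (1 - q.1.1 - q.1.2))) * Real.cos q.2.2) /
        (1 - q.1.1)]

theorem measurable_paramPoint : Measurable paramPoint := by
  refine measurable_pi_lambda _ fun i => ?_
  fin_cases i <;> simp [paramPoint] <;> fun_prop

theorem areaQ_birkhoffParam (b : Fin 4 → ℝ) : areaQ (birkhoffParam b) =
    4 * b 0 * b 1 * b 2 * b 3 - (b 0 + b 1 + b 2 + b 3 - 1 - b 0 * b 3 - b 1 * b 2) ^ 2 := by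
  simp [areaQ, birkhoffParam]

theorem continuous_areaQ_birkhoffParam : Continuous fun b => areaQ (birkhoffParam b) := by
  simp_rw [areaQ_birkhoffParam]; fun_prop

/-- Completing the square in v: for fixed x, y, t the set Q > 0 is an interval centred at m/(1 - x),
when x ≠ 1 and the leading term is positive. The last coordinate of `paramPoint` traverses this
interval by a cosine. -/
theorem areaQ_birkhoffParam_vec (x y t v : ℝ) :
    areaQ (birkhoffParam ![x, y, (1 - x) * t, v]) =
      4 * x * y * (1 - x - y) * (t * (1 - t)) -
        ((1 - x) * v - (t * (x * y) + (1 - t) * (1 - x - y))) ^ 2 := by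
  rw [areaQ_birkhoffParam]
  simp
  ring

theorem areaQ_paramPoint {q : (ℝ × ℝ) × ℝ × ℝ} (h1 : q.1 ∈ openTriangle)
    (h2 : q.2.1 ∈ Ioo (0 : ℝ) 1) : areaQ (birkhoffParam (paramPoint q)) =
      4 * q.1.1 * q.1.2 * (1 - q.1.1 - q.1.2) * (q.2.1 * (1 - q.2.1)) * Real.sin q.2.2 ^ 2 := by
  obtain ⟨⟨x, y⟩, t, θ⟩ := q
  obtain ⟨hx, hy, hxy⟩ := h1
  obtain ⟨ht0, ht1⟩ := h2
  simp only at hx hy hxy ht0 ht1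
  have hz : 0 < 1 - x - y := by linarith
  have ht : 0 < 1 - t := by linarith
  have hc : 1 - x ≠ 0 := by linarith
  simp only [paramPoint]
  rw [areaQ_birkhoffParam_vec, mul_div_cancel₀ _ hc]
  have hs : √(t * (1 - t) * (x * y * (1 - x - y))) ^ 2 = t * (1 - t) * (x * y * (1 - x - y)) :=
    Real.sq_sqrt (by positivity)
  linear_combination (-4 * Real.cos θ ^ 2) * hs -
    (4 * t * (1 - t) * (x * y * (1 - x - y))) * Real.sin_sq_add_cos_sq θ

theorem jarlskogX_paramPoint {q : (ℝ × ℝ) × ℝ × ℝ} (h1 : q.1 ∈ openTriangle)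
    (h2 : q.2.1 ∈ Ioo (0 : ℝ) 1) : jarlskogX (birkhoffParam (paramPoint q)) = paramX q := by
  rw [jarlskogX, areaQ_paramPoint h1 h2, paramX]

/-- The unitary matrix rotating the last two rows. -/
noncomputable def rowRotation (t θ : ℝ) : Matrix (Fin 3) (Fin 3) ℂ :=
  !![1, 0, 0;
     0, (√t : ℂ), (√(1 - t) : ℂ) * (Real.cos θ + Real.sin θ * Complex.I);
     0, (√(1 - t) : ℂ), -(√t : ℂ) * (Real.cos θ + Real.sin θ * Complex.I)]

theorem rowRotation_mem_unitaryGroup {t : ℝ} (ht : t ∈ Icc (0 : ℝ) 1) (θ : ℝ) :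
    rowRotation t θ ∈ Matrix.unitaryGroup (Fin 3) ℂ := by
  have h1 : (√t : ℂ) ^ 2 = t := by exact_mod_cast Real.sq_sqrt ht.1
  have h2 : (√(1 - t) : ℂ) ^ 2 = 1 - t := by exact_mod_cast Real.sq_sqrt (sub_nonneg.2 ht.2)
  have h3 : (Real.sin θ : ℂ) ^ 2 + (Real.cos θ : ℂ) ^ 2 = 1 := by
    exact_mod_cast Real.sin_sq_add_cos_sq θ
  have h4 := Complex.I_sq
  rw [Matrix.mem_unitaryGroup_iff]
  ext i j
  fin_cases i <;> fin_cases j <;>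
    simp [rowRotation, Matrix.mul_apply, Fin.sum_univ_three, Matrix.star_apply,
      -Complex.ofReal_cos, -Complex.ofReal_sin]
  · linear_combination h1 + (√(1 - t) : ℂ) ^ 2 * h3 + h2 -
      ((√(1 - t) : ℂ) ^ 2 * (Real.sin θ : ℂ) ^ 2) * h4
  · linear_combination (-(√t : ℂ) * √(1 - t)) * h3 +
      ((√t : ℂ) * √(1 - t) * (Real.sin θ : ℂ) ^ 2) * h4
  · linear_combination (-(√t : ℂ) * √(1 - t)) * h3 +
      ((√t : ℂ) * √(1 - t) * (Real.sin θ : ℂ) ^ 2) * h4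
  · linear_combination h2 + (√t : ℂ) ^ 2 * h3 + h1 -
      ((√t : ℂ) ^ 2 * (Real.sin θ : ℂ) ^ 2) * h4

theorem birkhoffParam_paramPoint_mem {q : (ℝ × ℝ) × ℝ × ℝ} (h1 : q.1 ∈ openTriangle)
    (h2 : q.2.1 ∈ Ioo (0 : ℝ) 1) : birkhoffParam (paramPoint q) ∈ unistochastic 3 := by
  obtain ⟨⟨x, y⟩, t, θ⟩ := q
  obtain ⟨hx, hy, hxy⟩ := h1
  obtain ⟨ht0, ht1⟩ := h2
  simp only at hx hy hxy ht0 ht1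
  have hz : 0 < 1 - x - y := by linarith
  have ht : 0 < 1 - t := by linarith
  have hc : 0 < 1 - x := by linarith
  -- The witness takes a real first row and mixes the two other rows of its frame; t sets the mixing
  -- ratio and θ the relative phase.
  have hM : frameMatrix ![(√x : ℂ), (√y : ℂ), (√(1 - x - y) : ℂ)] √(1 - x) ∈
      Matrix.unitaryGroup (Fin 3) ℂ := by
    refine frameMatrix_mem_unitaryGroup (Real.sqrt_pos.2 hc) ?_ ?_
    · simp [Real.sq_sqrt, hx.le, hy.le, hz.le]
    · simp [Real.sq_sqrt, hx.le, hc.le]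
  have hU := mul_mem (rowRotation_mem_unitaryGroup ⟨ht0.le, ht1.le⟩ θ) hM
  refine ⟨_, hU, ?_⟩
  rw [sqModuli_eq_birkhoffParam hU]
  congr 1
  have ex := Real.sq_sqrt hx.le
  have ey := Real.sq_sqrt hy.le
  have ez := Real.sq_sqrt hz.le
  have et := Real.sq_sqrt ht0.le
  have et' := Real.sq_sqrt ht.le
  have ec := Real.sq_sqrt hc.le
  have hc0 : √(1 - x) ≠ 0 := (Real.sqrt_pos.2 hc).ne'
  ext i
  fin_cases i
  · simp [paramPoint, blockModuli, rowRotation, frameMatrix, Matrix.mul_apply, Fin.sum_univ_three, ex]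
  · simp [paramPoint, blockModuli, rowRotation, frameMatrix, Matrix.mul_apply, Fin.sum_univ_three, ey]
  · simp [paramPoint, blockModuli, rowRotation, frameMatrix, Matrix.mul_apply, Fin.sum_univ_three,
      mul_pow, et, ec]
    ring
  -- This entry is (-√t√x√y + √(1 - t)√z e^(iθ))/√(1 - x) with z = 1 - x - y. The cross term of its
  -- squared modulus is the cosine term of `paramPoint`.
  · have e : (rowRotation t θ * frameMatrix ![(√x : ℂ), (√y : ℂ), (√(1 - x - y) : ℂ)] √(1 - x)) 1 1 =
        ⟨(-(√t * (√x * √y)) + √(1 - t) * √(1 - x - y) * Real.cos θ) / √(1 - x),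
          √(1 - t) * √(1 - x - y) * Real.sin θ / √(1 - x)⟩ := by
      rw [Complex.mk_eq_add_mul_I]
      simp [rowRotation, frameMatrix, Matrix.mul_apply, Fin.sum_univ_three]
      ring
    show _ = ‖_‖ ^ 2
    rw [e, Complex.sq_norm, Complex.normSq_mk]
    simp only [paramPoint]
    rw [Real.sqrt_mul (by positivity), Real.sqrt_mul (by positivity), Real.sqrt_mul (by positivity),
      Real.sqrt_mul (by positivity)]
    have e1 : t * (x * y) = √t ^ 2 * (√x ^ 2 * √y ^ 2) := by rw [et, ex, ey]
    have e2 : (1 - t) * (1 - x - y) = √(1 - t) ^ 2 * √(1 - x - y) ^ 2 := by rw [et', ez]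
    show _ / (1 - x) = _
    rw [div_mul_div_comm, div_mul_div_comm, ← add_div, Real.mul_self_sqrt hc.le]
    congr 1
    linear_combination e1 + e2 - (√(1 - t) ^ 2 * √(1 - x - y) ^ 2) * Real.sin_sq_add_cos_sq θ

/-! ### Lebesgue measure on the region Q > 0 in the new coordinates. -/

theorem lintegral_fin_succ {α : Type*} [MeasureSpace α] [SigmaFinite (volume : Measure α)] {n : ℕ}
    {g : (Fin (n + 1) → α) → ENNReal} (hg : Measurable g) :
    ∫⁻ b, g b = ∫⁻ x, ∫⁻ y : Fin n → α, g (Matrix.vecCons x y) := by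
  have h := (volume_preserving_piFinSuccAbove (fun _ : Fin (n + 1) => α) 0).symm
  rw [← h.lintegral_comp hg, Measure.volume_eq_prod,
    lintegral_prod (fun z => g ((MeasurableEquiv.piFinSuccAbove (fun _ => α) 0).symm z))
      (hg.comp (MeasurableEquiv.measurable _)).aemeasurable]
  refine lintegral_congr fun x => lintegral_congr fun y => ?_
  show g (Fin.insertNth 0 x y) = g (Fin.cons x y)
  rw [Fin.insertNth_zero']

theorem measurable_vecCons {α : Type*} [MeasurableSpace α] {n : ℕ} :
    Measurable fun p : α × (Fin n → α) => (Matrix.vecCons p.1 p.2 : Fin (n + 1) → α) := by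
  refine measurable_pi_lambda _ fun i => ?_
  refine Fin.cases ?_ (fun j => ?_) i
  · exact measurable_fst
  · exact (measurable_pi_apply j).comp measurable_snd

theorem lintegral_fin_zero {α : Type*} [MeasureSpace α] [SigmaFinite (volume : Measure α)]
    (g : (Fin 0 → α) → ENNReal) : ∫⁻ b, g b = g ![] := by
  have h : (volume : Measure (Fin 0 → α)) = Measure.dirac ![] := by
    rw [volume_pi]
    exact Measure.pi_of_empty _ _
  rw [h, lintegral_dirac]

theorem lintegral_fin_four {g : (Fin 4 → ℝ) → ENNReal} (hg : Measurable g) :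
    ∫⁻ b, g b = ∫⁻ x, ∫⁻ y, ∫⁻ u, ∫⁻ v, g ![x, y, u, v] := by
  rw [lintegral_fin_succ hg]
  refine lintegral_congr fun x => ?_
  have h1 : Measurable fun y : Fin 3 → ℝ => g (Matrix.vecCons x y) :=
    hg.comp (measurable_vecCons.comp measurable_prodMk_left)
  rw [lintegral_fin_succ h1]
  refine lintegral_congr fun y => ?_
  have h2 : Measurable fun z : Fin 2 → ℝ => g (Matrix.vecCons x (Matrix.vecCons y z)) :=
    h1.comp (measurable_vecCons.comp measurable_prodMk_left)
  rw [lintegral_fin_succ h2]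
  refine lintegral_congr fun u => ?_
  have h3 : Measurable fun z : Fin 1 → ℝ =>
      g (Matrix.vecCons x (Matrix.vecCons y (Matrix.vecCons u z))) :=
    h2.comp (measurable_vecCons.comp measurable_prodMk_left)
  rw [lintegral_fin_succ h3]
  refine lintegral_congr fun v => lintegral_fin_zero _

/-- The points `b` with `(b₀, b₁)` in the open triangle and `Q > 0`. -/
def positiveRegion : Set (Fin 4 → ℝ) :=
  {b | (b 0, b 1) ∈ openTriangle ∧ 0 < areaQ (birkhoffParam b)}

theorem measurableSet_positiveRegion : MeasurableSet positiveRegion := by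
  have h : Measurable fun b : Fin 4 → ℝ => (b 0, b 1) := by fun_prop
  exact (h measurableSet_openTriangle).inter
    (measurableSet_lt measurable_const continuous_areaQ_birkhoffParam.measurable)

theorem image_Ioo_cos {A c m : ℝ} (hA : 0 < A) (hc : 0 < c) :
    (fun θ => (m - 2 * √A * Real.cos θ) / c) '' Ioo 0 Real.pi =
      {v | 0 < 4 * A - (c * v - m) ^ 2} := by
  have hs := Real.sq_sqrt hA.le
  have hs0 := Real.sqrt_pos.2 hA
  ext v
  simp only [mem_image, mem_ofPred_eq]
  constructor
  · rintro ⟨θ, hθ, rfl⟩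
    have := Real.sin_pos_of_mem_Ioo hθ
    rw [mul_div_cancel₀ _ hc.ne']
    have e : 4 * A - (m - 2 * √A * Real.cos θ - m) ^ 2 = 4 * A * Real.sin θ ^ 2 := by
      linear_combination (-4 * Real.cos θ ^ 2) * hs - 4 * A * Real.sin_sq_add_cos_sq θ
    rw [e]
    positivity
  · intro hv
    -- The angle is the arccosine of (m - cv)/(2√A). Strictness of Q > 0 keeps it away from the
    -- endpoints 0 and π.
    have habs : |(m - c * v) / (2 * √A)| < 1 := by
      rw [abs_div, abs_of_pos (show 0 < 2 * √A by positivity), div_lt_one (by positivity)]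
      refine abs_lt_of_sq_lt_sq ?_ (by positivity)
      nlinarith
    rw [abs_lt] at habs
    refine ⟨Real.arccos ((m - c * v) / (2 * √A)), ⟨Real.arccos_pos.2 habs.2, ?_⟩, ?_⟩
    · refine lt_of_le_of_ne (Real.arccos_le_pi _) fun h => ?_
      rw [Real.arccos_eq_pi] at h
      linarith [habs.1]
    · rw [Real.cos_arccos habs.1.le habs.2.le]
      field_simp
      ring

theorem injOn_affine_cos {a c m : ℝ} (ha : 0 < a) (hc : 0 < c) :
    InjOn (fun θ => (m - a * Real.cos θ) / c) (Ioo 0 Real.pi) := by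
  intro θ hθ θ' hθ' h
  refine Real.injOn_cos (Ioo_subset_Icc_self hθ) (Ioo_subset_Icc_self hθ') ?_
  have h' : a * Real.cos θ = a * Real.cos θ' := by
    field_simp at h
    linarith
  exact mul_left_cancel₀ ha.ne' h'

theorem lintegral_indicator_areaQ {A c m : ℝ} (hA : 0 < A) (hc : 0 < c) (g : ℝ → ENNReal) :
    ∫⁻ v in {v | 0 < 4 * A - (c * v - m) ^ 2}, g v =
      ∫⁻ θ in Ioo 0 Real.pi, ENNReal.ofReal (2 * √A * Real.sin θ / c) *
        g ((m - 2 * √A * Real.cos θ) / c) := by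
  have hs0 := Real.sqrt_pos.2 hA
  rw [← image_Ioo_cos hA hc, lintegral_image_eq_lintegral_abs_deriv_mul measurableSet_Ioo
    (f' := fun θ => 2 * √A * Real.sin θ / c) (fun θ _ => ?_)
    (injOn_affine_cos (by positivity) hc)]
  · refine setLIntegral_congr_fun measurableSet_Ioo fun θ hθ => ?_
    have := Real.sin_pos_of_mem_Ioo hθ
    rw [abs_of_nonneg (by positivity)]
  · have h := (((Real.hasDerivAt_cos θ).const_mul (2 * √A)).const_sub m).div_const c
    exact (h.congr_deriv (by ring)).hasDerivWithinAt

/-- The substitution u = (1 - x)t contributes the factor 1 - x, and v ↦ θ contributes 2√A sin θ/(1 -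
x), where A = t(1 - t)xy(1 - x - y). Their product 2√A sin θ is exactly √Q. -/
theorem lintegral_slice {x y : ℝ} (hp : (x, y) ∈ openTriangle) (g : (Fin 4 → ℝ) → ENNReal) :
    ∫⁻ u, ∫⁻ v, positiveRegion.indicator g ![x, y, u, v] =
      ∫⁻ t in Ioo 0 1, ∫⁻ θ in Ioo 0 Real.pi,
        ENNReal.ofReal √(areaQ (birkhoffParam (paramPoint ((x, y), t, θ)))) *
          g (paramPoint ((x, y), t, θ)) := by
  obtain ⟨hx, hy, hxy⟩ := id hp
  simp only at hx hy hxy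
  have hz : 0 < 1 - x - y := by linarith
  have hc : 0 < 1 - x := by linarith
  rw [lintegral_comp_affine _ hc.ne' 0, ← lintegral_const_mul' _ _ ENNReal.ofReal_ne_top,
    ← lintegral_indicator measurableSet_Ioo]
  refine lintegral_congr fun t => ?_
  rw [add_zero]
  have hmem : ∀ v, ![x, y, (1 - x) * t, v] ∈ positiveRegion ↔
      0 < 4 * (t * (1 - t) * (x * y * (1 - x - y))) -
        ((1 - x) * v - (t * (x * y) + (1 - t) * (1 - x - y))) ^ 2 := by
    intro v
    rw [positiveRegion, mem_ofPred_eq, areaQ_birkhoffParam_vec,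
      show 4 * x * y * (1 - x - y) * (t * (1 - t)) = 4 * (t * (1 - t) * (x * y * (1 - x - y))) by ring]
    simp only [Matrix.cons_val_zero, Matrix.cons_val_one]
    exact and_iff_right hp
  by_cases ht : t ∈ Ioo (0 : ℝ) 1
  · have ht0 := ht.1
    have ht1 : 0 < 1 - t := sub_pos.2 ht.2
    have hA : 0 < t * (1 - t) * (x * y * (1 - x - y)) := by positivity
    rw [indicator_of_mem ht]
    have e : ∀ v, positiveRegion.indicator g ![x, y, (1 - x) * t, v] =
        {v | 0 < 4 * (t * (1 - t) * (x * y * (1 - x - y))) -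
          ((1 - x) * v - (t * (x * y) + (1 - t) * (1 - x - y))) ^ 2}.indicator
            (fun v => g ![x, y, (1 - x) * t, v]) v := by
      intro v
      classical
      simp only [indicator_apply, mem_ofPred_eq, hmem]
    simp_rw [e]
    rw [lintegral_indicator (measurableSet_lt measurable_const (by fun_prop)),
      lintegral_indicator_areaQ hA hc, ← lintegral_const_mul' _ _ ENNReal.ofReal_ne_top]
    refine setLIntegral_congr_fun measurableSet_Ioo fun θ hθ => ?_
    have hsin := Real.sin_pos_of_mem_Ioo hθ
    rw [← mul_assoc, ← ENNReal.ofReal_mul (abs_nonneg _), areaQ_paramPoint hp ht]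
    congr 2
    rw [abs_of_pos hc, mul_div_cancel₀ _ hc.ne']
    symm
    rw [Real.sqrt_eq_iff_mul_self_eq_of_pos (by positivity)]
    linear_combination (4 * Real.sin θ ^ 2) * Real.sq_sqrt hA.le
  · rw [indicator_of_notMem ht, mul_eq_zero]
    refine Or.inr ((lintegral_congr fun v => indicator_of_notMem (fun h => ht ?_) _).trans
      lintegral_zero)
    have h1 := (hmem v).1 h
    -- For t outside (0, 1) the slice is empty, since Q > 0 forces t(1 - t) > 0.
    have h2 : 0 < t * (1 - t) * (x * y * (1 - x - y)) := by
      nlinarith [sq_nonneg ((1 - x) * v - (t * (x * y) + (1 - t) * (1 - x - y)))]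
    have h3 : 0 < t * (1 - t) := by
      by_contra h
      have : 0 < x * y * (1 - x - y) := by positivity
      nlinarith
    exact ⟨by nlinarith, by nlinarith⟩

theorem setLIntegral_positiveRegion {g : (Fin 4 → ℝ) → ENNReal} (hg : Measurable g) :
    ∫⁻ b in positiveRegion, g b =
      ∫⁻ q, ENNReal.ofReal √(areaQ (birkhoffParam (paramPoint q))) * g (paramPoint q) ∂paramMeasure := by
  have hm := measurable_paramPoint
  have hQ := continuous_areaQ_birkhoffParam.measurable
  have hQ' : Measurable fun q => ENNReal.ofReal √(areaQ (birkhoffParam (paramPoint q))) :=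
    (Real.continuous_sqrt.measurable.comp (hQ.comp hm)).ennreal_ofReal
  have hg' : Measurable fun q => g (paramPoint q) := hg.comp hm
  have hF : Measurable fun q => ENNReal.ofReal √(areaQ (birkhoffParam (paramPoint q))) *
      g (paramPoint q) := hQ'.mul hg'
  rw [lintegral_paramMeasure hF, ← lintegral_indicator measurableSet_positiveRegion,
    lintegral_fin_four (hg.indicator measurableSet_positiveRegion),
    ← lintegral_indicator measurableSet_openTriangle, Measure.volume_eq_prod, lintegral_prod]
  · refine lintegral_congr fun x => lintegral_congr fun y => ?_
    by_cases hp : (x, y) ∈ openTriangle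
    · rw [indicator_of_mem hp, lintegral_slice hp]
    · rw [indicator_of_notMem hp]
      refine (lintegral_congr fun u => (lintegral_congr fun v => ?_).trans lintegral_zero).trans
        lintegral_zero
      exact indicator_of_notMem (fun h => hp h.1) _
  · refine (Measurable.indicator ?_ measurableSet_openTriangle).aemeasurable
    have h := hF.lintegral_prod_right' (ν := (volume.restrict (Ioo (0 : ℝ) 1)).prod
      (volume.restrict (Ioo 0 Real.pi)))
    convert h using 2 with p
    exact (lintegral_prod _ (hF.comp measurable_prodMk_left).aemeasurable).symm

/-! ### The unistochastic set and the law of X for all k > 1/2. -/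

theorem areaQ_nonneg_of_mem {b : Fin 4 → ℝ} (hb : birkhoffParam b ∈ unistochastic 3) :
    0 ≤ areaQ (birkhoffParam b) := by
  obtain ⟨U, hU, h⟩ := hb
  rw [h, areaQ_sqModuli hU]
  positivity

theorem nonneg_of_mem_unistochastic {n : ℕ} {B : Matrix (Fin n) (Fin n) ℝ} (hB : B ∈ unistochastic n)
    (i j : Fin n) : 0 ≤ B i j := by
  obtain ⟨U, -, rfl⟩ := hB
  exact sq_nonneg _

theorem exists_paramPoint_eq {b : Fin 4 → ℝ} (hb : b ∈ positiveRegion) :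
    ∃ q : (ℝ × ℝ) × ℝ × ℝ, q.1 ∈ openTriangle ∧ q.2.1 ∈ Ioo (0 : ℝ) 1 ∧ paramPoint q = b := by
  obtain ⟨hp, hQ⟩ := hb
  obtain ⟨hx, hy, hxy⟩ := id hp
  simp only at hx hy hxy
  have hz : 0 < 1 - b 0 - b 1 := by linarith
  have hc : 0 < 1 - b 0 := by linarith
  set t := b 2 / (1 - b 0) with ht
  have hb2 : b 2 = (1 - b 0) * t := by rw [ht, mul_div_cancel₀ _ hc.ne']
  have hbv : b = ![b 0, b 1, (1 - b 0) * t, b 3] := by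
    ext i
    fin_cases i <;> simp [hb2]
  rw [hbv, areaQ_birkhoffParam_vec] at hQ
  have hxyz : 0 < b 0 * b 1 * (1 - b 0 - b 1) := by positivity
  have h3 : 0 < t * (1 - t) := by
    by_contra h
    nlinarith [sq_nonneg ((1 - b 0) * b 3 - (t * (b 0 * b 1) + (1 - t) * (1 - b 0 - b 1)))]
  have ht0 : 0 < t := by nlinarith
  have ht1 : 0 < 1 - t := by nlinarith
  have hA : 0 < t * (1 - t) * (b 0 * b 1 * (1 - b 0 - b 1)) := by positivity
  have hmem : b 3 ∈ {v | 0 < 4 * (t * (1 - t) * (b 0 * b 1 * (1 - b 0 - b 1))) -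
      ((1 - b 0) * v - (t * (b 0 * b 1) + (1 - t) * (1 - b 0 - b 1))) ^ 2} := by
    rw [mem_ofPred_eq]
    convert hQ using 2
    ring
  rw [← image_Ioo_cos hA hc] at hmem
  obtain ⟨θ, -, hθ⟩ := hmem
  refine ⟨((b 0, b 1), t, θ), hp, ⟨ht0, by linarith⟩, ?_⟩
  conv_rhs => rw [hbv, ← hθ]
  rfl

theorem ae_generic : ∀ᵐ b : Fin 4 → ℝ, b 0 ≠ 0 ∧ b 1 ≠ 0 ∧ b 0 + b 1 ≠ 1 ∧
    areaQ (birkhoffParam b) ≠ 0 := by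
  have hQ := continuous_areaQ_birkhoffParam.measurable
  set N : Set (Fin 4 → ℝ) :=
    {b | ¬ (b 0 ≠ 0 ∧ b 1 ≠ 0 ∧ b 0 + b 1 ≠ 1 ∧ areaQ (birkhoffParam b) ≠ 0)} with hN
  have hNm : MeasurableSet N := by
    refine MeasurableSet.compl ?_
    exact ((measurableSet_eq_fun (by fun_prop) measurable_const).compl).inter
      (((measurableSet_eq_fun (by fun_prop) measurable_const).compl).inter
        (((measurableSet_eq_fun (by fun_prop) measurable_const).compl).inter
          ((measurableSet_eq_fun hQ measurable_const).compl)))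
  show volume N = 0
  rw [← lintegral_indicator_one hNm, lintegral_fin_four (measurable_one.indicator hNm)]
  refine lintegral_eq_zero_of_ae_eq_zero ?_
  filter_upwards [Measure.ae_ne volume (0 : ℝ), Measure.ae_ne volume (1 : ℝ)] with x hx0 hx1
  refine lintegral_eq_zero_of_ae_eq_zero ?_
  filter_upwards [Measure.ae_ne volume (0 : ℝ), Measure.ae_ne volume (1 - x)] with y hy0 hy1
  refine (lintegral_congr fun u => ?_).trans lintegral_zero
  refine lintegral_eq_zero_of_ae_eq_zero ?_
  have hc : 1 - x ≠ 0 := sub_ne_zero.2 (Ne.symm hx1)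
  set t := u / (1 - x) with ht
  have hu : u = (1 - x) * t := by rw [ht, mul_div_cancel₀ _ hc]
  set A := 4 * x * y * (1 - x - y) * (t * (1 - t)) with hA
  set m := t * (x * y) + (1 - t) * (1 - x - y) with hm
  -- With x, y, u fixed and x ≠ 1, the equation Q = 0 is quadratic in v and has at most these two
  -- roots.
  filter_upwards [Measure.ae_ne volume ((m + √A) / (1 - x)),
    Measure.ae_ne volume ((m - √A) / (1 - x))] with v hv1 hv2
  refine indicator_of_notMem ?_ _
  rw [hN, mem_ofPred_eq, not_not]
  refine ⟨hx0, hy0, fun h' => hy1 ?_, ?_⟩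
  · simp at h'
    linarith
  · rw [hu, areaQ_birkhoffParam_vec, ← hA, ← hm]
    intro h0
    have hA0 : 0 ≤ A := by nlinarith [sq_nonneg ((1 - x) * v - m)]
    have h1 : ((1 - x) * v - m - √A) * ((1 - x) * v - m + √A) = 0 := by
      linear_combination -h0 - Real.sq_sqrt hA0
    rcases mul_eq_zero.1 h1 with h2 | h2
    · exact hv1 (by rw [eq_div_iff hc]; linarith)
    · exact hv2 (by rw [eq_div_iff hc]; linarith)

/-- A unistochastic matrix has nonnegative entries and Q = 4J² ≥ 0, and these become strict off the
null set of `ae_generic`. Conversely, a point with Q > 0 over the open triangle lies in the image of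
the parametrization, which consists of unistochastic matrices. No measurability of the unistochastic
set is required. -/
theorem preimage_unistochastic_ae_eq :
    {b : Fin 4 → ℝ | birkhoffParam b ∈ unistochastic 3} =ᵐ[volume] positiveRegion := by
  filter_upwards [ae_generic] with b hb
  refine propext ⟨fun h => ?_, fun h => ?_⟩
  · have hB := nonneg_of_mem_unistochastic (show birkhoffParam b ∈ unistochastic 3 from h)
    have h0 : 0 ≤ b 0 := hB 0 0
    have h1 : 0 ≤ b 1 := hB 0 1
    have h2 : 0 ≤ 1 - b 0 - b 1 := hB 0 2
    refine ⟨⟨lt_of_le_of_ne h0 (Ne.symm hb.1), lt_of_le_of_ne h1 (Ne.symm hb.2.1),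
      lt_of_le_of_ne (by simp only; linarith) hb.2.2.1⟩,
      lt_of_le_of_ne (areaQ_nonneg_of_mem h) (Ne.symm hb.2.2.2)⟩
  · obtain ⟨q, h1, h2, rfl⟩ := exists_paramPoint_eq (show b ∈ positiveRegion from h)
    exact birkhoffParam_paramPoint_mem h1 h2

theorem continuous_birkhoffParam : Continuous birkhoffParam := by
  refine continuous_matrix fun i j => ?_
  fin_cases i <;> fin_cases j <;> simp [birkhoffParam] <;> fun_prop

theorem continuous_areaQ : Continuous areaQ := by
  unfold areaQ; fun_prop

theorem ae_areaQ_paramPoint_pos :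
    ∀ᵐ q ∂paramMeasure, 0 < areaQ (birkhoffParam (paramPoint q)) := by
  filter_upwards [ae_paramMeasure] with q hq
  rw [areaQ_paramPoint hq.1 hq.2.1]
  obtain ⟨⟨h1, h2, h3⟩, ⟨h4, h5⟩, h6⟩ := hq
  have := Real.sin_pos_of_mem_Ioo h6
  have : 0 < 1 - q.1.1 - q.1.2 := by linarith
  have : 0 < 1 - q.2.1 := by linarith
  positivity

/-- The Jacobian √Q raises the exponent k - 3/2 to k - 1, so at k = 1 the measure is flat in the
parameters. -/
theorem unistochasticMeasure_eq (k : ℝ) : unistochasticMeasure k =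
    (paramMeasure.withDensity fun q =>
      ENNReal.ofReal (areaQ (birkhoffParam (paramPoint q)) ^ (k - 1))).map
        (birkhoffParam ∘ paramPoint) := by
  have hQ := continuous_areaQ_birkhoffParam.measurable
  have hm := measurable_paramPoint
  have hB := continuous_birkhoffParam.measurable
  have hQm : Measurable fun q => areaQ (birkhoffParam (paramPoint q)) := hQ.comp hm
  rw [unistochasticMeasure, Measure.restrict_congr_set preimage_unistochastic_ae_eq]
  refine Measure.ext_of_lintegral _ fun g hg => ?_
  rw [lintegral_map hg hB, lintegral_map hg (hB.comp hm),
    lintegral_withDensity_eq_lintegral_mul _ (by fun_prop) (by fun_prop),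
    setLIntegral_positiveRegion (by fun_prop),
    lintegral_withDensity_eq_lintegral_mul _ (by fun_prop) (by fun_prop)]
  refine lintegral_congr_ae ?_
  filter_upwards [ae_areaQ_paramPoint_pos] with q hq
  simp only [Pi.mul_apply, Function.comp_apply]
  rw [← mul_assoc, ← ENNReal.ofReal_mul (Real.sqrt_nonneg _), Real.sqrt_eq_rpow,
    ← Real.rpow_add hq]
  ring_nf

theorem measurable_jarlskogX : Measurable jarlskogX := by
  have := continuous_areaQ.measurable
  unfold jarlskogX; fun_prop

theorem aemeasurable_jarlskogDensity (k : ℝ) :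
    AEMeasurable (jarlskogDensity k) (volume.restrict (Ioc 0 1)) := by
  have h : AEMeasurable (fun x => ∫ t in x..1, densityIntegrand t) (volume.restrict (Ioc 0 1)) := by
    -- The integrand is nonnegative, so the integral from x to 1 is antitone in x, which suffices
    -- for measurability.
    refine aemeasurable_restrict_of_antitoneOn measurableSet_Ioc fun x hx y hy hxy => ?_
    refine intervalIntegral.integral_mono_interval hxy hy.2 le_rfl ?_
      (densityIntegrand_intervalIntegrable hx.1 hx.2)
    exact ae_restrict_of_forall_mem measurableSet_Ioc fun t ht =>
      densityIntegrand_nonneg (hx.1.trans ht.1) ht.2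
  unfold jarlskogDensity
  fun_prop

theorem lintegral_lawWithDensity' {r : ℝ} {p : ℝ → ℝ}
    (hp : AEMeasurable p (volume.restrict (Ioc 0 r))) {f : ℝ → ENNReal} (hf : Measurable f) :
    ∫⁻ x, f x ∂(lawWithDensity r p) = ∫⁻ x in Ioc 0 r, ENNReal.ofReal (p x) * f x := by
  rw [lawWithDensity, withDensity_indicator measurableSet_Ioc,
    lintegral_withDensity_eq_lintegral_mul₀ hp.ennreal_ofReal hf.aemeasurable]
  rfl

theorem lintegral_lawWithDensity (k : ℝ) {f : ℝ → ENNReal} (hf : Measurable f) :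
    ∫⁻ x, f x ∂(lawWithDensity 1 (jarlskogDensity k)) =
      ∫⁻ x in Ioc 0 1, ENNReal.ofReal (jarlskogDensity k x) * f x :=
  lintegral_lawWithDensity' (aemeasurable_jarlskogDensity k) hf

/-- Relative to the flat measure the weight is (X/27)^(k - 1), a function of X alone. So the law of
X is that weight times the law at k = 1, and P_k is proportional to x^(k - 1) P₁(x). -/
theorem map_jarlskogX_unistochasticMeasure {k : ℝ} (hk : 1 / 2 < k) :
    ∃ C : ENNReal, C ≠ 0 ∧ C ≠ ⊤ ∧
      (unistochasticMeasure k).map jarlskogX = C • lawWithDensity 1 (jarlskogDensity k) := by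
  have hQ := continuous_areaQ_birkhoffParam.measurable
  have hm := measurable_paramPoint
  have hB := continuous_birkhoffParam.measurable
  have hQm : Measurable fun q => areaQ (birkhoffParam (paramPoint q)) := hQ.comp hm
  have hX := measurable_jarlskogX
  have hpX := measurable_paramX
  have hc1 := normConst_pos one_pos
  have hck := normConst_pos (show 0 < k by linarith)
  have hk3 : 2 * k - 1 ≠ 0 := by linarith
  have hk2 : 0 < k - 1 / 2 := by linarith
  -- π/2 is the mass of the parameter measure, 27^(1 - k) comes from Q = X/27, and the last quotient
  -- compares the constants of P₁ and P_k.
  set c : ℝ := Real.pi / 2 * ((27 : ℝ) ^ (k - 1))⁻¹ *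
    (normConst 1 * (1 - 1 / 2) / (normConst k * (k - 1 / 2))) with hc
  have hcpos : 0 < c := by positivity
  refine ⟨ENNReal.ofReal c, by simpa using hcpos, ENNReal.ofReal_ne_top, ?_⟩
  refine Measure.ext_of_lintegral _ fun g hg => ?_
  calc ∫⁻ x, g x ∂((unistochasticMeasure k).map jarlskogX)
      = ∫⁻ q, ENNReal.ofReal ((paramX q / 27) ^ (k - 1)) * g (paramX q) ∂paramMeasure := by
        rw [lintegral_map hg hX, unistochasticMeasure_eq, lintegral_map (by fun_prop) (hB.comp hm),
          lintegral_withDensity_eq_lintegral_mul _ (by fun_prop) (by fun_prop)]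
        refine lintegral_congr_ae ?_
        filter_upwards [ae_paramMeasure] with q hq
        rw [Pi.mul_apply, Function.comp_apply, jarlskogX_paramPoint hq.1 hq.2.1,
          ← jarlskogX_paramPoint hq.1 hq.2.1, jarlskogX, mul_div_cancel_left₀ _ (by norm_num)]
    _ = ∫⁻ x, ENNReal.ofReal ((x / 27) ^ (k - 1)) * g x ∂(paramMeasure.map paramX) := by
        rw [lintegral_map (by fun_prop) hpX]
    _ = _ := by
        rw [map_paramX, lintegral_smul_measure, lintegral_smul_measure, lintegral_lawWithDensity 1 (by fun_prop),
          lintegral_lawWithDensity k hg, smul_eq_mul, smul_eq_mul, ← lintegral_const_mul' _ _ ENNReal.ofReal_ne_top,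
          ← lintegral_const_mul' _ _ ENNReal.ofReal_ne_top]
        refine setLIntegral_congr_fun measurableSet_Ioc fun x hx => ?_
        have hx0 := hx.1
        have hd1 := jarlskogDensity_nonneg (k := 1) (by norm_num) hx.1 hx.2
        have hdk := jarlskogDensity_nonneg hk hx.1 hx.2
        rw [← mul_assoc, ← mul_assoc, ← mul_assoc, ← ENNReal.ofReal_mul (by positivity),
          ← ENNReal.ofReal_mul (by positivity), ← ENNReal.ofReal_mul (by positivity)]
        congr 2
        rw [jarlskogDensity, jarlskogDensity, Real.div_rpow hx0.le (by norm_num),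
          show k - 3 / 2 = (1 - 3 / 2) + (k - 1) by ring, Real.rpow_add hx0, hc]
        field_simp

/-! ### Polar coordinates and ratios of exponential variables. -/

theorem setLIntegral_Ioo_neg_pi_cos (F : ℝ → ENNReal) :
    ∫⁻ θ in Ioo (-Real.pi) Real.pi, F (Real.cos θ) = 2 * ∫⁻ θ in Ioo 0 Real.pi, F (Real.cos θ) := by
  have hpi := Real.pi_pos
  have h0 : Ioo (-Real.pi) Real.pi =ᵐ[volume] (Ioo (-Real.pi) 0 ∪ Ioo 0 Real.pi : Set ℝ) := by
    filter_upwards [Measure.ae_ne volume (0 : ℝ)] with θ hθ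
    refine propext ⟨fun h => ?_, fun h => ?_⟩
    · rcases lt_or_gt_of_ne hθ with h' | h'
      · exact Or.inl ⟨h.1, h'⟩
      · exact Or.inr ⟨h', h.2⟩
    · rcases h with h | h
      · exact ⟨h.1, h.2.trans hpi⟩
      · exact ⟨by linarith [h.1], h.2⟩
  have h1 : ∫⁻ θ in Ioo (-Real.pi) 0, F (Real.cos θ) = ∫⁻ θ in Ioo 0 Real.pi, F (Real.cos θ) := by
    rw [setLIntegral_comp_affine _ measurableSet_Ioo _ (show (-1 : ℝ) ≠ 0 by norm_num) 0]
    have hs : {x : ℝ | -1 * x + 0 ∈ Ioo (-Real.pi) 0} = Ioo 0 Real.pi := by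
      ext x
      simp only [mem_ofPred_eq, mem_Ioo]
      constructor <;> rintro ⟨h1, h2⟩ <;> constructor <;> linarith
    rw [hs]
    simp
  rw [setLIntegral_congr h0, lintegral_union measurableSet_Ioo, h1, two_mul]
  exact disjoint_left.2 fun x hx hx' => lt_asymm hx.2 hx'.1

theorem setLIntegral_Ioi_comp_sq (G : ℝ → ENNReal) :
    ∫⁻ t in Ioi (0 : ℝ), G t = ∫⁻ r in Ioi (0 : ℝ), ENNReal.ofReal (2 * r) * G (r ^ 2) := by
  have hs : (fun r : ℝ => r ^ 2) '' Ioi 0 = Ioi 0 := by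
    ext t
    constructor
    · rintro ⟨r, hr, rfl⟩
      have : 0 < r := hr
      show 0 < r ^ 2
      positivity
    · intro ht
      exact ⟨√t, Real.sqrt_pos.2 ht, Real.sq_sqrt (le_of_lt ht)⟩
  conv_lhs => rw [← hs]
  rw [lintegral_image_eq_lintegral_abs_deriv_mul measurableSet_Ioi (f' := fun r => 2 * r)
    (fun r _ => by simpa using (hasDerivAt_pow 2 r).hasDerivWithinAt)
    (fun a (ha : 0 < a) b (hb : 0 < b) h => by
      exact (sq_eq_sq₀ ha.le hb.le).1 h)]
  refine setLIntegral_congr_fun measurableSet_Ioi fun r (hr : 0 < r) => ?_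
  rw [abs_of_pos (by positivity)]

/-- Integration over `ℂ` of a function of `|w|²` and `Re w` in polar coordinates. -/
theorem lintegral_complex_polar {H : ℝ × ℝ → ENNReal} (hH : Measurable H) :
    ∫⁻ w : ℂ, H (‖w‖ ^ 2, w.re) =
      ∫⁻ t in Ioi (0 : ℝ), ∫⁻ θ in Ioo 0 Real.pi, H (t, √t * Real.cos θ) := by
  rw [← Complex.lintegral_comp_polarCoord_symm, setLIntegral_Ioi_comp_sq]
  have ht : polarCoord.target = Ioi (0 : ℝ) ×ˢ Ioo (-Real.pi) Real.pi := rfl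
  have hm : Measurable fun p : ℝ × ℝ => ENNReal.ofReal p.1 * H (p.1 ^ 2, p.1 * Real.cos p.2) := by
    fun_prop
  calc _ = ∫⁻ p in Ioi (0 : ℝ) ×ˢ Ioo (-Real.pi) Real.pi,
        ENNReal.ofReal p.1 * H (p.1 ^ 2, p.1 * Real.cos p.2) := by
        rw [ht]
        refine setLIntegral_congr_fun (measurableSet_Ioi.prod measurableSet_Ioo) fun p hp => ?_
        rw [Complex.norm_polarCoord_symm, sq_abs, Complex.polarCoord_symm_apply, smul_eq_mul]
        congr 2
        simp [Complex.cos_ofReal_re]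
    _ = ∫⁻ r in Ioi (0 : ℝ), ∫⁻ θ in Ioo (-Real.pi) Real.pi,
        ENNReal.ofReal r * H (r ^ 2, r * Real.cos θ) := by
        rw [Measure.volume_eq_prod, ← Measure.prod_restrict, lintegral_prod _ hm.aemeasurable]
    _ = _ := by
        -- The 2 from folding θ to (0, π) and the r of polar coordinates make up the factor 2r of
        -- the substitution t = r².
        refine setLIntegral_congr_fun measurableSet_Ioi fun r (hr : 0 < r) => ?_
        rw [setLIntegral_Ioo_neg_pi_cos fun x => ENNReal.ofReal r * H (r ^ 2, r * x),
          lintegral_const_mul _ (by fun_prop), Real.sqrt_sq hr.le,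
          ENNReal.ofReal_mul (by norm_num), ENNReal.ofReal_ofNat, mul_assoc]

theorem lintegral_complex_radial {h : ℝ → ENNReal} (hh : Measurable h) :
    ∫⁻ w : ℂ, h (‖w‖ ^ 2) = ENNReal.ofReal Real.pi * ∫⁻ t in Ioi (0 : ℝ), h t := by
  rw [lintegral_complex_polar (H := fun p => h p.1) (by fun_prop), ← lintegral_const_mul _ hh]
  refine lintegral_congr fun t => ?_
  simp [mul_comm]

theorem lintegral_complex_mul_unit {ω : ℂ} (hω : ‖ω‖ = 1) (F : ℂ → ENNReal) :
    ∫⁻ w, F w = ∫⁻ w, F (ω * w) := by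
  have h := (rotation ⟨ω, by simpa [Submonoid.unitSphere] using hω⟩).measurePreserving
  exact (h.lintegral_comp_emb (rotation _).toHomeomorph.measurableEmbedding F).symm

theorem setLIntegral_exp_neg_mul_pow (n : ℕ) :
    ∫⁻ r in Ioi (0 : ℝ), ENNReal.ofReal (Real.exp (-r)) * ENNReal.ofReal r ^ n =
      ENNReal.ofReal n.factorial := by
  have h := Real.GammaIntegral_convergent (s := n + 1) (by positivity)
  rw [← Real.Gamma_nat_eq_factorial, Real.Gamma_eq_integral (by positivity),
    ofReal_integral_eq_lintegral_ofReal h]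
  · refine setLIntegral_congr_fun measurableSet_Ioi fun r (hr : 0 < r) => ?_
    rw [← ENNReal.ofReal_pow hr.le, ← ENNReal.ofReal_mul (Real.exp_pos _).le]
    simp
  · refine ae_restrict_of_forall_mem measurableSet_Ioi fun r (hr : 0 < r) => ?_
    show 0 ≤ Real.exp (-r) * r ^ ((n : ℝ) + 1 - 1)
    positivity

theorem setLIntegral_Ioi_shift (a : ℝ) (F : ℝ → ENNReal) :
    ∫⁻ t in Ioi (0 : ℝ), F t = ∫⁻ r in Ioi a, F (r - a) := by
  rw [setLIntegral_comp_affine _ measurableSet_Ioi F one_ne_zero (-a)]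
  have hs : {x : ℝ | 1 * x + -a ∈ Ioi 0} = Ioi a := by
    ext x
    simp
  rw [hs]
  simp [sub_eq_add_neg]

/-- The ratio of two exponential variables to their sum is uniform. -/
theorem lintegral_exp_ratio {Ψ : ℝ → ENNReal} (hΨ : Measurable Ψ) :
    ∫⁻ s in Ioi (0 : ℝ), ∫⁻ t in Ioi (0 : ℝ),
        ENNReal.ofReal (Real.exp (-s)) * ENNReal.ofReal (Real.exp (-t)) * Ψ (s / (s + t)) =
      ∫⁻ τ in Ioo 0 1, Ψ τ := by
  -- Substitute r = s + t, exchange the integrals, then scale s = rτ. The remaining radial integral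
  -- of r e^(-r) is 1.
  set S : Set (ℝ × ℝ) := {p | 0 < p.1 ∧ p.1 < p.2} with hS
  have hSm : MeasurableSet S := (measurableSet_lt measurable_const measurable_fst).inter
    (measurableSet_lt measurable_fst measurable_snd)
  set F : ℝ × ℝ → ENNReal := S.indicator
    fun p => ENNReal.ofReal (Real.exp (-p.2)) * Ψ (p.1 / p.2) with hF
  have hFm : Measurable F := Measurable.indicator (by fun_prop) hSm
  calc _ = ∫⁻ s, ∫⁻ r, F (s, r) := by
        rw [← lintegral_indicator measurableSet_Ioi]
        refine lintegral_congr fun s => ?_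
        by_cases hs : s ∈ Ioi (0 : ℝ)
        · rw [indicator_of_mem hs, setLIntegral_Ioi_shift s, ← lintegral_indicator measurableSet_Ioi]
          refine lintegral_congr fun r => ?_
          by_cases hr : r ∈ Ioi s
          · rw [indicator_of_mem hr, hF, indicator_of_mem (show (s, r) ∈ S from ⟨hs, hr⟩),
              ← ENNReal.ofReal_mul (Real.exp_pos _).le, ← Real.exp_add]
            ring_nf
          · rw [indicator_of_notMem hr, hF, indicator_of_notMem fun h => hr h.2]
        · rw [indicator_of_notMem hs]
          exact ((lintegral_congr fun r => indicator_of_notMem (fun h => hs h.1) _).trans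
            lintegral_zero).symm
    _ = ∫⁻ r, ∫⁻ s, F (s, r) := lintegral_lintegral_swap hFm.aemeasurable
    _ = ∫⁻ r in Ioi (0 : ℝ), ENNReal.ofReal (Real.exp (-r)) * ENNReal.ofReal r ^ 1 *
        ∫⁻ τ in Ioo 0 1, Ψ τ := by
        rw [← lintegral_indicator measurableSet_Ioi]
        refine lintegral_congr fun r => ?_
        by_cases hr : r ∈ Ioi (0 : ℝ)
        · have hr0 : 0 < r := hr
          rw [indicator_of_mem hr, lintegral_comp_affine _ hr0.ne' 0, abs_of_pos hr0, pow_one,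
            mul_assoc, mul_left_comm, ← lintegral_const_mul _ hΨ, ← lintegral_indicator measurableSet_Ioo]
          congr 1
          refine lintegral_congr fun τ => ?_
          have hmem : (r * τ + 0, r) ∈ S ↔ τ ∈ Ioo (0 : ℝ) 1 := by
            rw [hS, mem_ofPred_eq, mem_Ioo, add_zero]
            exact and_congr (by rw [mul_pos_iff_of_pos_left hr0])
              ⟨fun h => by by_contra h'; nlinarith, fun h => by nlinarith⟩
          by_cases hτ : τ ∈ Ioo (0 : ℝ) 1
          · rw [indicator_of_mem hτ, hF, indicator_of_mem (hmem.2 hτ)]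
            simp only
            rw [add_zero, mul_div_cancel_left₀ _ hr0.ne']
          · rw [indicator_of_notMem hτ, hF, indicator_of_notMem fun h => hτ (hmem.1 h)]
        · rw [indicator_of_notMem hr]
          refine (lintegral_congr fun s => indicator_of_notMem (fun h => hr ?_) _).trans lintegral_zero
          exact h.1.trans h.2
    _ = _ := by
        rw [lintegral_mul_const _ (by fun_prop), setLIntegral_exp_neg_mul_pow]
        simp

/-- Three exponential variables divided by their sum are uniform on the simplex. -/
theorem lintegral_exp_simplex {Ψ : ℝ × ℝ → ENNReal} (hΨ : Measurable Ψ) :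
    ∫⁻ s in Ioi (0 : ℝ), ∫⁻ t in Ioi (0 : ℝ), ∫⁻ v in Ioi (0 : ℝ),
        ENNReal.ofReal (Real.exp (-(s + t + v))) * Ψ (s / (s + t + v), t / (s + t + v)) =
      2 * ∫⁻ p in openTriangle, Ψ p := by
  -- The third variable is replaced by the sum r, which is then moved outermost so that s and t can
  -- both be scaled by r. The radial integral of r² e^(-r) gives the factor 2.
  set S : Set (ℝ × ℝ × ℝ) := {p | 0 < p.1 ∧ 0 < p.2.1 ∧ p.1 + p.2.1 < p.2.2} with hS
  have hSm : MeasurableSet S := (measurableSet_lt measurable_const measurable_fst).inter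
    ((measurableSet_lt measurable_const measurable_snd.fst).inter
      (measurableSet_lt (measurable_fst.add measurable_snd.fst) measurable_snd.snd))
  set F : ℝ × ℝ × ℝ → ENNReal := S.indicator
    fun p => ENNReal.ofReal (Real.exp (-p.2.2)) * Ψ (p.1 / p.2.2, p.2.1 / p.2.2) with hF
  have hFm : Measurable F := Measurable.indicator (by fun_prop) hSm
  calc _ = ∫⁻ s, ∫⁻ t, ∫⁻ r, F (s, t, r) := by
        rw [← lintegral_indicator measurableSet_Ioi]
        refine lintegral_congr fun s => ?_
        by_cases hs : s ∈ Ioi (0 : ℝ)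
        · rw [indicator_of_mem hs, ← lintegral_indicator measurableSet_Ioi]
          refine lintegral_congr fun t => ?_
          by_cases ht : t ∈ Ioi (0 : ℝ)
          · rw [indicator_of_mem ht, setLIntegral_Ioi_shift (s + t),
              ← lintegral_indicator measurableSet_Ioi]
            refine lintegral_congr fun r => ?_
            by_cases hr : r ∈ Ioi (s + t)
            · rw [indicator_of_mem hr, hF, indicator_of_mem (show (s, t, r) ∈ S from ⟨hs, ht, hr⟩)]
              simp only [add_sub_cancel]
            · rw [indicator_of_notMem hr, hF, indicator_of_notMem fun h => hr h.2.2]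
          · rw [indicator_of_notMem ht]
            exact ((lintegral_congr fun r => indicator_of_notMem (fun h => ht h.2.1) _).trans
              lintegral_zero).symm
        · rw [indicator_of_notMem hs]
          exact ((lintegral_congr fun t => (lintegral_congr fun r =>
            indicator_of_notMem (fun h => hs h.1) _).trans lintegral_zero).trans
            lintegral_zero).symm
    _ = ∫⁻ s, ∫⁻ r, ∫⁻ t, F (s, t, r) := lintegral_congr fun s =>
        lintegral_lintegral_swap (hFm.comp measurable_prodMk_left).aemeasurable
    _ = ∫⁻ r, ∫⁻ s, ∫⁻ t, F (s, t, r) := by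
        refine lintegral_lintegral_swap (f := fun s r => ∫⁻ t, F (s, t, r)) (Measurable.aemeasurable ?_)
        have : Measurable fun q : (ℝ × ℝ) × ℝ => F (q.1.1, q.2, q.1.2) := hFm.comp (by fun_prop)
        exact this.lintegral_prod_right'
    _ = ∫⁻ r in Ioi (0 : ℝ), ENNReal.ofReal (Real.exp (-r)) * ENNReal.ofReal r ^ 2 *
        ∫⁻ p in openTriangle, Ψ p := by
        rw [← lintegral_indicator measurableSet_Ioi]
        refine lintegral_congr fun r => ?_
        by_cases hr : r ∈ Ioi (0 : ℝ)
        · have hr0 : 0 < r := hr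
          rw [indicator_of_mem hr, lintegral_comp_affine _ hr0.ne' 0, abs_of_pos hr0]
          have e : ∀ s, ∫⁻ t, F (r * s + 0, t, r) = ENNReal.ofReal r *
              ∫⁻ t, F (r * s + 0, r * t + 0, r) := fun s => by
            rw [lintegral_comp_affine _ hr0.ne' 0, abs_of_pos hr0]
          simp_rw [e]
          rw [lintegral_const_mul' _ _ ENNReal.ofReal_ne_top, ← mul_assoc, ← sq,
            mul_comm (ENNReal.ofReal (Real.exp (-r))), mul_assoc,
            ← lintegral_const_mul _ hΨ, ← lintegral_indicator measurableSet_openTriangle,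
            Measure.volume_eq_prod, lintegral_prod _ (Measurable.indicator (by fun_prop)
              measurableSet_openTriangle).aemeasurable]
          congr 1
          refine lintegral_congr fun x => lintegral_congr fun y => ?_
          have hmem : (r * x + 0, r * y + 0, r) ∈ S ↔ (x, y) ∈ openTriangle := by
            rw [hS, openTriangle, mem_ofPred_eq, mem_ofPred_eq, add_zero, add_zero]
            exact and_congr (by rw [mul_pos_iff_of_pos_left hr0])
              (and_congr (by rw [mul_pos_iff_of_pos_left hr0])
              ⟨fun h => by by_contra h'; nlinarith, fun h => by nlinarith⟩)
          by_cases hp : (x, y) ∈ openTriangle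
          · rw [indicator_of_mem hp, hF, indicator_of_mem (hmem.2 hp)]
            simp only
            rw [add_zero, add_zero, mul_div_cancel_left₀ _ hr0.ne', mul_div_cancel_left₀ _ hr0.ne']
          · rw [indicator_of_notMem hp, hF, indicator_of_notMem fun h => hp (hmem.1 h)]
        · rw [indicator_of_notMem hr]
          refine (lintegral_congr fun s => (lintegral_congr fun t =>
            indicator_of_notMem (fun h => hr ?_) _).trans lintegral_zero).trans lintegral_zero
          obtain ⟨h1, h2, h3⟩ := h
          simp only at h1 h2 h3
          show 0 < r
          linarith
    _ = _ := by
        rw [lintegral_mul_const _ (by fun_prop), setLIntegral_exp_neg_mul_pow]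
        simp

/-! ### Gaussian vectors, Gram-Schmidt and Haar measure. -/

/-- The Gaussian weight `exp (-|z|²)` on `ℂ³`. -/
noncomputable def gaussianWeight (z : Fin 3 → ℂ) : ENNReal :=
  ENNReal.ofReal (Real.exp (-(‖z 0‖ ^ 2 + ‖z 1‖ ^ 2 + ‖z 2‖ ^ 2)))

theorem measurable_gaussianWeight : Measurable gaussianWeight := by
  unfold gaussianWeight; fun_prop

theorem dotProduct_star_self_eq (z : Fin 3 → ℂ) :
    z ⬝ᵥ star z = ((‖z 0‖ ^ 2 + ‖z 1‖ ^ 2 + ‖z 2‖ ^ 2 : ℝ) : ℂ) := by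
  simp [dotProduct, Fin.sum_univ_three, Complex.mul_conj']

theorem vecMul_dotProduct_star_vecMul {U : Matrix (Fin 3) (Fin 3) ℂ}
    (hU : U ∈ Matrix.unitaryGroup (Fin 3) ℂ) (z w : Fin 3 → ℂ) :
    (Matrix.vecMul z U) ⬝ᵥ star (Matrix.vecMul w U) = z ⬝ᵥ star w := by
  rw [Matrix.star_vecMul, Matrix.dotProduct_mulVec, Matrix.vecMul_vecMul,
    ← Matrix.star_eq_conjTranspose, Matrix.mem_unitaryGroup_iff.1 hU, Matrix.vecMul_one]

theorem norm_sq_vecMul {U : Matrix (Fin 3) (Fin 3) ℂ}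
    (hU : U ∈ Matrix.unitaryGroup (Fin 3) ℂ) (z : Fin 3 → ℂ) :
    ‖Matrix.vecMul z U 0‖ ^ 2 + ‖Matrix.vecMul z U 1‖ ^ 2 + ‖Matrix.vecMul z U 2‖ ^ 2 =
      ‖z 0‖ ^ 2 + ‖z 1‖ ^ 2 + ‖z 2‖ ^ 2 := by
  have h := vecMul_dotProduct_star_vecMul hU z z
  rw [dotProduct_star_self_eq, dotProduct_star_self_eq] at h
  exact_mod_cast h

theorem gaussianWeight_vecMul {U : Matrix (Fin 3) (Fin 3) ℂ}
    (hU : U ∈ Matrix.unitaryGroup (Fin 3) ℂ) (z : Fin 3 → ℂ) :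
    gaussianWeight (Matrix.vecMul z U) = gaussianWeight z := by
  rw [gaussianWeight, norm_sq_vecMul hU, gaussianWeight]

/-- By uniqueness of Haar measure, a real linear automorphism multiplies Lebesgue measure by a
constant. The open Hermitian unit ball is mapped to itself and has positive finite volume, so the
constant is 1. -/
theorem measurePreserving_vecMul {U : Matrix (Fin 3) (Fin 3) ℂ}
    (hU : U ∈ Matrix.unitaryGroup (Fin 3) ℂ) :
    MeasurePreserving (fun z : Fin 3 → ℂ => Matrix.vecMul z U) := by
  have hinv : ∀ z, Matrix.vecMul (Matrix.vecMul z U) (star U) = z := fun z => by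
    rw [Matrix.vecMul_vecMul, Matrix.mem_unitaryGroup_iff.1 hU, Matrix.vecMul_one]
  have hinv' : ∀ z, Matrix.vecMul (Matrix.vecMul z (star U)) U = z := fun z => by
    rw [Matrix.vecMul_vecMul, Matrix.mem_unitaryGroup_iff'.1 hU, Matrix.vecMul_one]
  let e : (Fin 3 → ℂ) ≃ₗ[ℝ] (Fin 3 → ℂ) :=
    { toFun := fun z => Matrix.vecMul z U
      invFun := fun z => Matrix.vecMul z (star U)
      map_add' := fun z w => Matrix.add_vecMul _ _ _
      map_smul' := fun c z => Matrix.smul_vecMul c z U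
      left_inv := hinv
      right_inv := hinv' }
  have hcont : Continuous fun z : Fin 3 → ℂ => Matrix.vecMul z U := by fun_prop
  refine ⟨hcont.measurable, ?_⟩
  have hhaar : (volume.map e : Measure (Fin 3 → ℂ)).IsAddHaarMeasure :=
    e.toContinuousLinearEquiv.isAddHaarMeasure_map volume
  obtain ⟨c, hc⟩ : ∃ c : NNReal, (volume.map e : Measure (Fin 3 → ℂ)) = c • volume := by
    exact ⟨_, Measure.isAddLeftInvariant_eq_smul _ _⟩
  set E : Set (Fin 3 → ℂ) := {z | ‖z 0‖ ^ 2 + ‖z 1‖ ^ 2 + ‖z 2‖ ^ 2 < 1} with hE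
  have hEo : IsOpen E := isOpen_lt (by fun_prop) continuous_const
  have hpre : e ⁻¹' E = E := by
    ext z
    show ‖Matrix.vecMul z U 0‖ ^ 2 + ‖Matrix.vecMul z U 1‖ ^ 2 + ‖Matrix.vecMul z U 2‖ ^ 2 < 1 ↔ _
    rw [norm_sq_vecMul hU]
    rfl
  have hpos : volume E ≠ 0 := (hEo.measure_pos volume ⟨0, by simp [hE]⟩).ne'
  have hfin : volume E ≠ ⊤ := by
    refine (measure_mono (t := Metric.closedBall 0 1) ?_).trans_lt
      measure_closedBall_lt_top |>.ne
    intro z hz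
    rw [mem_closedBall_zero_iff, pi_norm_le_iff_of_nonneg zero_le_one]
    have hz' : ‖z 0‖ ^ 2 + ‖z 1‖ ^ 2 + ‖z 2‖ ^ 2 < 1 := hz
    intro i
    refine (sq_le_one_iff₀ (norm_nonneg _)).1 ?_
    have h0 := sq_nonneg ‖z 0‖
    have h1 := sq_nonneg ‖z 1‖
    have h2 := sq_nonneg ‖z 2‖
    fin_cases i <;> simp only [Fin.zero_eta, Fin.mk_one, Fin.reduceFinMk] <;> linarith
  have h1 : (c : ENNReal) * volume E = 1 * volume E := by
    have h2 := congrArg (fun μ : Measure (Fin 3 → ℂ) => μ E) hc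
    rw [Measure.map_apply (show Measurable e from hcont.measurable) hEo.measurableSet, hpre, Measure.smul_apply] at h2
    rw [one_mul]
    exact h2.symm
  have h2 : (c : ENNReal) = 1 := (ENNReal.mul_left_inj hpos hfin).1 h1
  have h3 : c = 1 := by exact_mod_cast h2
  rw [h3, one_smul] at hc
  exact hc

/-- The component of `w` orthogonal to `z`, multiplied by `|z|²`. -/
def orthogonalPart (z w : Fin 3 → ℂ) : Fin 3 → ℂ := (z ⬝ᵥ star z) • w - (w ⬝ᵥ star z) • z

theorem orthogonalPart_vecMul {U : Matrix (Fin 3) (Fin 3) ℂ}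
    (hU : U ∈ Matrix.unitaryGroup (Fin 3) ℂ) (z w : Fin 3 → ℂ) :
    orthogonalPart (Matrix.vecMul z U) (Matrix.vecMul w U) = Matrix.vecMul (orthogonalPart z w) U := by
  rw [orthogonalPart, vecMul_dotProduct_star_vecMul hU, vecMul_dotProduct_star_vecMul hU,
    orthogonalPart, Matrix.sub_vecMul, Matrix.smul_vecMul, Matrix.smul_vecMul]

theorem dotProduct_star_orthogonalPart (z w : Fin 3 → ℂ) : z ⬝ᵥ star (orthogonalPart z w) = 0 := by
  have h1 : star (z ⬝ᵥ star z) = z ⬝ᵥ star z := by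
    simp [dotProduct, Fin.sum_univ_three]; ring
  have h2 : star (w ⬝ᵥ star z) = z ⬝ᵥ star w := by
    simp [dotProduct, Fin.sum_univ_three]; ring
  rw [orthogonalPart, star_sub, star_smul, star_smul, dotProduct_sub, dotProduct_smul,
    dotProduct_smul, h1, h2, smul_eq_mul, smul_eq_mul]
  ring

/-- The squared moduli of the first two coordinates of the two vectors obtained from `z, w` by the
Gram-Schmidt process. -/
noncomputable def gramSchmidtBlock (z w : Fin 3 → ℂ) : Fin 4 → ℝ :=
  let v := orthogonalPart z w
  let N := ‖z 0‖ ^ 2 + ‖z 1‖ ^ 2 + ‖z 2‖ ^ 2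
  let M := ‖v 0‖ ^ 2 + ‖v 1‖ ^ 2 + ‖v 2‖ ^ 2
  ![‖z 0‖ ^ 2 / N, ‖z 1‖ ^ 2 / N, ‖v 0‖ ^ 2 / M, ‖v 1‖ ^ 2 / M]

theorem measurable_gramSchmidtBlock :
    Measurable fun p : (Fin 3 → ℂ) × (Fin 3 → ℂ) => gramSchmidtBlock p.1 p.2 := by
  refine measurable_pi_lambda _ fun i => ?_
  fin_cases i <;> simp [gramSchmidtBlock, orthogonalPart, dotProduct, Fin.sum_univ_three] <;> fun_prop

open Matrix in
theorem exists_unitary_rows {a b : Fin 3 → ℂ} (ha : a ⬝ᵥ star a = 1) (hb : b ⬝ᵥ star b = 1)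
    (hab : a ⬝ᵥ star b = 0) : ∃ V ∈ Matrix.unitaryGroup (Fin 3) ℂ, V 0 = a ∧ V 1 = b := by
  have hba : b ⬝ᵥ star a = 0 := by
    rw [dotProduct_star, hab, star_zero]
  -- The third row is the conjugate of the cross product, because the cross product is orthogonal to
  -- a and b for the bilinear form rather than the Hermitian one.
  refine ⟨Matrix.of ![a, b, star (a ⨯₃ b)], ?_, rfl, rfl⟩
  have hc : star (a ⨯₃ b) ⬝ᵥ (a ⨯₃ b) = 1 := by
    have : star (a ⨯₃ b) = star a ⨯₃ star b := by
      ext i; fin_cases i <;> simp [cross_apply]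
    rw [this, cross_dot_cross, dotProduct_comm (star a) a, dotProduct_comm (star b) b,
      dotProduct_comm (star a) b, dotProduct_comm (star b) a, ha, hb, hab, hba]
    simp
  have hac : a ⬝ᵥ (a ⨯₃ b) = 0 := dot_self_cross a b
  have hbc : b ⬝ᵥ (a ⨯₃ b) = 0 := dot_cross_self a b
  have hca : star (a ⨯₃ b) ⬝ᵥ star a = 0 := by
    rw [star_dotProduct_star, hac, star_zero]
  have hcb : star (a ⨯₃ b) ⬝ᵥ star b = 0 := by
    rw [star_dotProduct_star, hbc, star_zero]
  rw [Matrix.mem_unitaryGroup_iff]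
  have key : ∀ i j, (Matrix.of ![a, b, star (a ⨯₃ b)] * star (Matrix.of ![a, b, star (a ⨯₃ b)])) i j =
      (![a, b, star (a ⨯₃ b)] i) ⬝ᵥ star (![a, b, star (a ⨯₃ b)] j) := fun i j => rfl
  ext i j
  rw [key]
  fin_cases i <;> fin_cases j <;> simp [ha, hb, hab, hba, hc, hac, hbc, hca, hcb]

/-- Gram-Schmidt commutes with right multiplication by a unitary matrix. So V need only have the
orthonormalized z and w as its first two rows, and V does not depend on U. -/
theorem exists_unitary_gramSchmidtBlock {z w : Fin 3 → ℂ} (hz : z ≠ 0) (hv : orthogonalPart z w ≠ 0) :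
    ∃ V ∈ Matrix.unitaryGroup (Fin 3) ℂ, ∀ U ∈ Matrix.unitaryGroup (Fin 3) ℂ,
      gramSchmidtBlock (Matrix.vecMul z U) (Matrix.vecMul w U) = blockModuli (V * U) := by
  have hpos : ∀ z : Fin 3 → ℂ, z ≠ 0 → 0 < ‖z 0‖ ^ 2 + ‖z 1‖ ^ 2 + ‖z 2‖ ^ 2 := by
    intro z hz
    obtain ⟨i, hi⟩ := Function.ne_iff.1 hz
    have hi' : 0 < ‖z i‖ ^ 2 := by have := norm_pos_iff.2 hi; positivity
    have h0 := sq_nonneg ‖z 0‖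
    have h1 := sq_nonneg ‖z 1‖
    have h2 := sq_nonneg ‖z 2‖
    fin_cases i <;> simp only [Fin.zero_eta, Fin.mk_one, Fin.reduceFinMk] at hi' <;> linarith
  set v := orthogonalPart z w with hvdef
  set N := ‖z 0‖ ^ 2 + ‖z 1‖ ^ 2 + ‖z 2‖ ^ 2 with hN
  set M := ‖v 0‖ ^ 2 + ‖v 1‖ ^ 2 + ‖v 2‖ ^ 2 with hM
  have hNpos : 0 < N := hpos z hz
  have hMpos : 0 < M := hpos v hv
  have hunit : ∀ (x : Fin 3 → ℂ) (r : ℝ), 0 < r → r = ‖x 0‖ ^ 2 + ‖x 1‖ ^ 2 + ‖x 2‖ ^ 2 →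
      (((√r)⁻¹ : ℝ) • x) ⬝ᵥ star (((√r)⁻¹ : ℝ) • x) = 1 := by
    intro x r hr hx
    rw [star_smul, smul_dotProduct, dotProduct_smul, dotProduct_star_self_eq, ← hx, smul_smul,
      star_trivial, ← mul_inv, Real.mul_self_sqrt hr.le, ← Complex.coe_smul, smul_eq_mul,
      ← Complex.ofReal_mul, inv_mul_cancel₀ hr.ne', Complex.ofReal_one]
  obtain ⟨V, hV, h0, h1⟩ := exists_unitary_rows (hunit z N hNpos hN) (hunit v M hMpos hM) (by
    rw [star_smul, smul_dotProduct, dotProduct_smul, dotProduct_star_orthogonalPart]; simp)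
  refine ⟨V, hV, fun U hU => ?_⟩
  have hrow : ∀ i j, (V * U) i j = Matrix.vecMul (V i) U j := fun i j => rfl
  have e : ∀ (x : Fin 3 → ℂ) (r : ℝ), 0 < r → ∀ j, ‖Matrix.vecMul (((√r)⁻¹ : ℝ) • x) U j‖ ^ 2 =
      ‖Matrix.vecMul x U j‖ ^ 2 / r := by
    intro x r hr j
    rw [Matrix.smul_vecMul, Pi.smul_apply, norm_smul, mul_pow, Real.norm_eq_abs, sq_abs, inv_pow,
      Real.sq_sqrt hr.le, div_eq_inv_mul]
  rw [blockModuli, hrow, hrow, hrow, hrow, h0, h1, e _ _ hNpos, e _ _ hNpos, e _ _ hMpos,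
    e _ _ hMpos, gramSchmidtBlock]
  rw [orthogonalPart_vecMul hU, norm_sq_vecMul hU, norm_sq_vecMul hU]

theorem ae_linear_ne_zero (φ : (Fin 3 → ℂ) →ₗ[ℂ] ℂ) (hφ : φ ≠ 0) :
    ∀ᵐ w : Fin 3 → ℂ, φ w ≠ 0 := by
  have h := Measure.addHaar_submodule (volume : Measure (Fin 3 → ℂ))
    ((LinearMap.ker φ).restrictScalars ℝ) (fun h => hφ (by
      ext1 i
      ext
      have h' : ∀ w, w ∈ (LinearMap.ker φ).restrictScalars ℝ := fun w => h ▸ Submodule.mem_top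
      simpa using h' _))
  show volume {w | ¬ φ w ≠ 0} = 0
  convert h using 2
  ext w
  simp

theorem ae_coord_ne_zero : ∀ᵐ z : Fin 3 → ℂ, z 0 ≠ 0 ∧ z 1 ≠ 0 ∧ z 2 ≠ 0 := by
  have h : ∀ i : Fin 3, ∀ᵐ z : Fin 3 → ℂ, z i ≠ 0 := fun i =>
    ae_linear_ne_zero (LinearMap.proj i) fun h => by
      have := LinearMap.congr_fun h (Pi.single i 1)
      simp at this
  filter_upwards [h 0, h 1, h 2] with z h0 h1 h2 using ⟨h0, h1, h2⟩

/-- If the orthogonal part vanishes, w is a multiple of z and the minor z₀w₁ - z₁w₀ vanishes. For z₀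
≠ 0 this is a nontrivial linear condition on w, hence null. -/
theorem ae_orthogonalPart_ne_zero {z : Fin 3 → ℂ} (hz : z 0 ≠ 0) :
    ∀ᵐ w : Fin 3 → ℂ, orthogonalPart z w ≠ 0 := by
  have h := ae_linear_ne_zero (z 0 • LinearMap.proj 1 - z 1 • LinearMap.proj 0) fun h => by
    have := LinearMap.congr_fun h (Pi.single 1 1)
    simp at this
    exact hz this
  filter_upwards [h] with w hw h0
  have hN : z ⬝ᵥ star z ≠ 0 := by
    rw [dotProduct_star_self_eq]
    have : 0 < ‖z 0‖ := norm_pos_iff.2 hz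
    have : 0 < ‖z 0‖ ^ 2 + ‖z 1‖ ^ 2 + ‖z 2‖ ^ 2 := by positivity
    exact_mod_cast this.ne'
  have e0 := congrFun h0 0
  have e1 := congrFun h0 1
  simp only [orthogonalPart, Pi.sub_apply, Pi.smul_apply, smul_eq_mul, Pi.zero_apply] at e0 e1
  refine hw ?_
  simp only [LinearMap.sub_apply, LinearMap.smul_apply, LinearMap.proj_apply, smul_eq_mul]
  refine (mul_eq_zero.1 (?_ : (z ⬝ᵥ star z) * (z 0 * w 1 - z 1 * w 0) = 0)).resolve_left hN
  linear_combination z 0 * e1 - z 1 * e0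

theorem measurable_blockModuli : Measurable blockModuli := by
  have : Continuous blockModuli := by
    refine continuous_pi fun i => ?_
    fin_cases i <;> simp [blockModuli] <;> fun_prop
  exact this.measurable

/-- Haar measure is the law of the unitary matrix obtained by orthonormalizing Gaussian vectors. -/
theorem lintegral_gaussian_gramSchmidtBlock (m : Measure (Matrix.unitaryGroup (Fin 3) ℂ))
    [m.IsHaarMeasure] [IsProbabilityMeasure m] {g : (Fin 4 → ℝ) → ENNReal} (hg : Measurable g) :
    ∫⁻ p : (Fin 3 → ℂ) × (Fin 3 → ℂ),
        gaussianWeight p.1 * gaussianWeight p.2 * g (gramSchmidtBlock p.1 p.2) =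
      (∫⁻ p : (Fin 3 → ℂ) × (Fin 3 → ℂ), gaussianWeight p.1 * gaussianWeight p.2) *
        ∫⁻ U : Matrix.unitaryGroup (Fin 3) ℂ, g (blockModuli U.1) ∂m := by
  have hw := measurable_gaussianWeight
  have hgs := measurable_gramSchmidtBlock
  have hbm := measurable_blockModuli
  have hval : Measurable fun U : Matrix.unitaryGroup (Fin 3) ℂ => U.1 := measurable_subtype_coe
  have hact : Measurable fun q : Matrix.unitaryGroup (Fin 3) ℂ × (Fin 3 → ℂ) =>
      Matrix.vecMul q.2 q.1.1 := by
    have hentry : ∀ i j, Measurable fun U : Matrix.unitaryGroup (Fin 3) ℂ => U.1 i j := fun i j =>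
      (measurable_pi_apply j).comp ((measurable_pi_apply i).comp hval)
    refine measurable_pi_lambda _ fun j => ?_
    simp only [Matrix.vecMul, dotProduct]
    refine Finset.measurable_sum _ fun i _ => ?_
    exact ((measurable_pi_apply i).comp measurable_snd).mul ((hentry i j).comp measurable_fst)
  have hjoint : Measurable fun q : Matrix.unitaryGroup (Fin 3) ℂ × (Fin 3 → ℂ) × (Fin 3 → ℂ) =>
      gaussianWeight q.2.1 * gaussianWeight q.2.2 *
        g (gramSchmidtBlock (Matrix.vecMul q.2.1 q.1.1) (Matrix.vecMul q.2.2 q.1.1)) := by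
    have h1 : Measurable fun q : Matrix.unitaryGroup (Fin 3) ℂ × (Fin 3 → ℂ) × (Fin 3 → ℂ) =>
        Matrix.vecMul q.2.1 q.1.1 := hact.comp (measurable_fst.prodMk measurable_snd.fst)
    have h2 : Measurable fun q : Matrix.unitaryGroup (Fin 3) ℂ × (Fin 3 → ℂ) × (Fin 3 → ℂ) =>
        Matrix.vecMul q.2.2 q.1.1 := hact.comp (measurable_fst.prodMk measurable_snd.snd)
    have h3 := hg.comp (hgs.comp (h1.prodMk h2))
    have h4 : Measurable fun q : Matrix.unitaryGroup (Fin 3) ℂ × (Fin 3 → ℂ) × (Fin 3 → ℂ) =>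
        gaussianWeight q.2.1 * gaussianWeight q.2.2 :=
      (hw.comp measurable_snd.fst).mul (hw.comp measurable_snd.snd)
    exact h4.mul h3
  have hinv : ∀ U : Matrix.unitaryGroup (Fin 3) ℂ,
      ∫⁻ p : (Fin 3 → ℂ) × (Fin 3 → ℂ),
        gaussianWeight p.1 * gaussianWeight p.2 * g (gramSchmidtBlock p.1 p.2) =
      ∫⁻ p : (Fin 3 → ℂ) × (Fin 3 → ℂ), gaussianWeight p.1 * gaussianWeight p.2 *
        g (gramSchmidtBlock (Matrix.vecMul p.1 U.1) (Matrix.vecMul p.2 U.1)) := by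
    intro U
    have hmp := (measurePreserving_vecMul U.2).prod (measurePreserving_vecMul U.2)
    have := hmp.lintegral_comp (f := fun p : (Fin 3 → ℂ) × (Fin 3 → ℂ) =>
      gaussianWeight p.1 * gaussianWeight p.2 * g (gramSchmidtBlock p.1 p.2)) (by fun_prop)
    rw [Measure.volume_eq_prod, ← this]
    refine lintegral_congr fun p => ?_
    simp only [Prod.map_fst, Prod.map_snd, gaussianWeight_vecMul U.2]
  have hae : ∀ᵐ p : (Fin 3 → ℂ) × (Fin 3 → ℂ), p.1 ≠ 0 ∧ orthogonalPart p.1 p.2 ≠ 0 := by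
    have hm : MeasurableSet {p : (Fin 3 → ℂ) × (Fin 3 → ℂ) |
        ¬ (p.1 ≠ 0 ∧ orthogonalPart p.1 p.2 ≠ 0)} := by
      have hc : Continuous fun p : (Fin 3 → ℂ) × (Fin 3 → ℂ) => orthogonalPart p.1 p.2 := by
        simp only [orthogonalPart, dotProduct]
        fun_prop
      exact (((measurableSet_singleton (0 : Fin 3 → ℂ)).preimage measurable_fst).compl.inter
        ((measurableSet_singleton (0 : Fin 3 → ℂ)).preimage hc.measurable).compl).compl
    show volume {p : (Fin 3 → ℂ) × (Fin 3 → ℂ) | ¬ (p.1 ≠ 0 ∧ orthogonalPart p.1 p.2 ≠ 0)} = 0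
    rw [Measure.volume_eq_prod, Measure.measure_prod_null hm]
    filter_upwards [ae_coord_ne_zero] with z hz
    have h := ae_orthogonalPart_ne_zero hz.1
    have hz0 : z ≠ 0 := fun h => hz.1 (by rw [h]; rfl)
    refine measure_mono_null (fun w hw => ?_) h
    intro h'
    exact hw ⟨hz0, h'⟩
  -- By `hinv` the Gaussian integral is unchanged when both vectors are multiplied by U, so it may
  -- be averaged over U; after exchanging the integrals, left invariance of `m` absorbs the matrix V
  -- attached to the pair.
  calc _ = ∫⁻ _ : Matrix.unitaryGroup (Fin 3) ℂ, (∫⁻ p : (Fin 3 → ℂ) × (Fin 3 → ℂ),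
        gaussianWeight p.1 * gaussianWeight p.2 * g (gramSchmidtBlock p.1 p.2)) ∂m := by
        rw [lintegral_const, measure_univ, mul_one]
    _ = ∫⁻ U : Matrix.unitaryGroup (Fin 3) ℂ, (∫⁻ p : (Fin 3 → ℂ) × (Fin 3 → ℂ),
        gaussianWeight p.1 * gaussianWeight p.2 *
          g (gramSchmidtBlock (Matrix.vecMul p.1 U.1) (Matrix.vecMul p.2 U.1))) ∂m :=
        lintegral_congr hinv
    _ = ∫⁻ p : (Fin 3 → ℂ) × (Fin 3 → ℂ), ∫⁻ U : Matrix.unitaryGroup (Fin 3) ℂ,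
        gaussianWeight p.1 * gaussianWeight p.2 *
          g (gramSchmidtBlock (Matrix.vecMul p.1 U.1) (Matrix.vecMul p.2 U.1)) ∂m := by
        refine lintegral_lintegral_swap (Measurable.aemeasurable ?_)
        exact hjoint
    _ = ∫⁻ p : (Fin 3 → ℂ) × (Fin 3 → ℂ), gaussianWeight p.1 * gaussianWeight p.2 *
          ∫⁻ U : Matrix.unitaryGroup (Fin 3) ℂ, g (blockModuli U.1) ∂m := by
        refine lintegral_congr_ae ?_
        filter_upwards [hae] with p hp
        obtain ⟨V, hV, h⟩ := exists_unitary_gramSchmidtBlock hp.1 hp.2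
        have hne : gaussianWeight p.1 * gaussianWeight p.2 ≠ ⊤ :=
          ENNReal.mul_ne_top ENNReal.ofReal_ne_top ENNReal.ofReal_ne_top
        rw [lintegral_const_mul' _ _ hne]
        congr 1
        rw [← lintegral_mul_left_eq_self (fun U : Matrix.unitaryGroup (Fin 3) ℂ =>
          g (blockModuli U.1)) ⟨V, hV⟩]
        exact lintegral_congr fun U => by rw [h U.1 U.2]; rfl
    _ = _ := by rw [lintegral_mul_const _ (by fun_prop)]

/-! ### The Gaussian integral in terms of the parameters. -/

theorem lintegral_fin_three {g : (Fin 3 → ℂ) → ENNReal} (hg : Measurable g) :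
    ∫⁻ w, g w = ∫⁻ a, ∫⁻ b, ∫⁻ c, g ![a, b, c] := by
  rw [lintegral_fin_succ hg]
  refine lintegral_congr fun x => ?_
  have h1 : Measurable fun y : Fin 2 → ℂ => g (Matrix.vecCons x y) :=
    hg.comp (measurable_vecCons.comp measurable_prodMk_left)
  rw [lintegral_fin_succ h1]
  refine lintegral_congr fun y => ?_
  have h2 : Measurable fun z : Fin 1 → ℂ => g (Matrix.vecCons x (Matrix.vecCons y z)) :=
    h1.comp (measurable_vecCons.comp measurable_prodMk_left)
  rw [lintegral_fin_succ h2]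
  exact lintegral_congr fun u => lintegral_fin_zero _

/-- In the orthonormal frame whose first vector is u, Gram-Schmidt merely deletes the coordinate a
of w. The common factor r², left because `orthogonalPart` is not normalized, cancels in the
quotients. -/
theorem gramSchmidtBlock_frame {u : Fin 3 → ℂ} {s r : ℝ} (hs : 0 < s) (hr : 0 < r)
    (hu : ‖u 0‖ ^ 2 + ‖u 1‖ ^ 2 + ‖u 2‖ ^ 2 = 1) (hsu : s ^ 2 = 1 - ‖u 0‖ ^ 2) (a b c : ℂ) :
    gramSchmidtBlock ((r : ℂ) • u) (Matrix.vecMul ![a, b, c] (frameMatrix u s)) =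
      ![‖u 0‖ ^ 2, ‖u 1‖ ^ 2, (1 - ‖u 0‖ ^ 2) * (‖b‖ ^ 2 / (‖b‖ ^ 2 + ‖c‖ ^ 2)),
        ‖c * star (u 2) - b * (star (u 0) * u 1)‖ ^ 2 /
          ((1 - ‖u 0‖ ^ 2) * (‖b‖ ^ 2 + ‖c‖ ^ 2))] := by
  have hM := frameMatrix_mem_unitaryGroup hs hu hsu
  have hz : (r : ℂ) • u = Matrix.vecMul ![(r : ℂ), 0, 0] (frameMatrix u s) := by
    ext i
    fin_cases i <;> simp [Matrix.vecMul, dotProduct, Fin.sum_univ_three, frameMatrix]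
  have hv : orthogonalPart ![(r : ℂ), 0, 0] ![a, b, c] = ![0, (r : ℂ) ^ 2 * b, (r : ℂ) ^ 2 * c] := by
    ext i
    fin_cases i <;> simp [orthogonalPart, dotProduct, Fin.sum_univ_three] <;> ring_nf <;> simp
  have e0 : Matrix.vecMul ![0, (r : ℂ) ^ 2 * b, (r : ℂ) ^ 2 * c] (frameMatrix u s) 0 =
      (r : ℂ) ^ 2 * b * s := by
    simp [Matrix.vecMul, dotProduct, Fin.sum_univ_three, frameMatrix]
  have e1 : Matrix.vecMul ![0, (r : ℂ) ^ 2 * b, (r : ℂ) ^ 2 * c] (frameMatrix u s) 1 =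
      (r : ℂ) ^ 2 * (c * star (u 2) - b * (star (u 0) * u 1)) / s := by
    simp [Matrix.vecMul, dotProduct, Fin.sum_univ_three, frameMatrix]
    ring
  have hn : ‖(r : ℂ) ^ 2‖ ^ 2 = r ^ 4 := by
    rw [norm_pow, Complex.norm_real, Real.norm_eq_abs, sq_abs]; ring
  have hsn : ‖(s : ℂ)‖ ^ 2 = 1 - ‖u 0‖ ^ 2 := by
    rw [Complex.norm_real, Real.norm_eq_abs, sq_abs, hsu]
  have hrn : ‖(r : ℂ)‖ ^ 2 = r ^ 2 := by
    rw [Complex.norm_real, Real.norm_eq_abs, sq_abs]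
  have hN : ‖((r : ℂ) • u) 0‖ ^ 2 + ‖((r : ℂ) • u) 1‖ ^ 2 + ‖((r : ℂ) • u) 2‖ ^ 2 = r ^ 2 := by
    simp only [Pi.smul_apply, smul_eq_mul, norm_mul, mul_pow, hrn]
    linear_combination r ^ 2 * hu
  have hpart : orthogonalPart ((r : ℂ) • u) (Matrix.vecMul ![a, b, c] (frameMatrix u s)) =
      Matrix.vecMul ![0, (r : ℂ) ^ 2 * b, (r : ℂ) ^ 2 * c] (frameMatrix u s) := by
    rw [hz, orthogonalPart_vecMul hM, hv]
  rw [gramSchmidtBlock, hN, hpart, norm_sq_vecMul hM, e0, e1]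
  simp only [Pi.smul_apply, smul_eq_mul, norm_mul, norm_div, mul_pow, div_pow, hrn, hsn, hn,
    Matrix.cons_val_zero, Matrix.cons_val_one, Matrix.cons_val, norm_zero]
  have hr0 := hr.ne'
  have h4 : r ^ 4 ≠ 0 := by positivity
  have hs1 : 1 - ‖u 0‖ ^ 2 ≠ 0 := by rw [← hsu]; positivity
  ext i
  fin_cases i
  · simp [hr0]
  · simp [hr0]
  · simp
    rw [← mul_add, mul_assoc, mul_div_mul_left _ _ h4]
    ring
  · simp
    rw [← mul_add, div_div, mul_left_comm (1 - _) (r ^ 4), mul_div_mul_left _ _ h4]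

/-- Rotating the last Gaussian coordinate aligns the phases. -/
theorem lintegral_align_phase {u : Fin 3 → ℂ} (b : ℂ) (hu2 : u 2 ≠ 0) (F : ℝ → ℝ → ENNReal) :
    ∫⁻ c, F (‖c‖ ^ 2) (‖c * star (u 2) - b * (star (u 0) * u 1)‖ ^ 2) =
      ∫⁻ c : ℂ, F (‖c‖ ^ 2) (‖b‖ ^ 2 * (‖u 0‖ ^ 2 * ‖u 1‖ ^ 2) + ‖c‖ ^ 2 * ‖u 2‖ ^ 2 -
        2 * (‖b‖ * (‖u 0‖ * ‖u 1‖) * ‖u 2‖) * c.re) := by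
  set d : ℂ := b * (star (u 0) * u 1) with hd
  have hdn : ‖d‖ = ‖b‖ * (‖u 0‖ * ‖u 1‖) := by simp [hd]
  -- κ is the phase of d, set to 1 when d = 0. Rotating c by κ u₂/|u₂| gives both terms of the
  -- difference the common phase κ, leaving a real offset, so that only |c| and Re c remain.
  obtain ⟨κ, hκ, hdκ⟩ : ∃ κ : ℂ, ‖κ‖ = 1 ∧ d = ‖d‖ * κ := by
    by_cases h : d = 0
    · exact ⟨1, by simp, by simp [h]⟩
    · refine ⟨d / ‖d‖, by simp [h], ?_⟩
      rw [mul_div_cancel₀]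
      simpa using h
  have hu2n : ‖u 2‖ ≠ 0 := norm_ne_zero_iff.2 hu2
  have hu2c : (‖u 2‖ : ℂ) ≠ 0 := by exact_mod_cast hu2n
  have hω : ‖κ * u 2 / ‖u 2‖‖ = 1 := by
    simp [hκ, hu2]
  rw [lintegral_complex_mul_unit hω]
  refine lintegral_congr fun c => ?_
  have e : κ * u 2 / ‖u 2‖ * c * star (u 2) - d = κ * (‖u 2‖ * c - ‖d‖) := by
    rw [mul_sub, mul_comm κ (‖d‖ : ℂ), ← hdκ]
    congr 1
    have h := Complex.mul_conj' (u 2)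
    rw [Complex.star_def]
    field_simp
    linear_combination (κ * c) * h
  have e2 : ‖(‖u 2‖ * c - ‖d‖ : ℂ)‖ ^ 2 = ‖d‖ ^ 2 + ‖c‖ ^ 2 * ‖u 2‖ ^ 2 - 2 * (‖d‖ * ‖u 2‖) * c.re := by
    rw [Complex.sq_norm, Complex.sq_norm c, Complex.normSq_apply, Complex.normSq_apply]
    simp
    ring
  rw [e, norm_mul, norm_mul, hω, hκ, one_mul, one_mul, e2, hdn, mul_pow, mul_pow]

theorem measurable_lintegral_angle {g : (Fin 4 → ℝ) → ENNReal} (hg : Measurable g) (p : ℝ × ℝ) :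
    Measurable fun τ => ∫⁻ θ in Ioo 0 Real.pi, g (paramPoint (p, τ, θ)) := by
  have h : Measurable fun q : ℝ × ℝ => g (paramPoint (p, q)) :=
    hg.comp (measurable_paramPoint.comp measurable_prodMk_left)
  exact h.lintegral_prod_right'

theorem measurable_lintegral_angle_angle {g : (Fin 4 → ℝ) → ENNReal} (hg : Measurable g) :
    Measurable fun p : ℝ × ℝ =>
      ∫⁻ τ in Ioo (0 : ℝ) 1, ∫⁻ θ in Ioo 0 Real.pi, g (paramPoint (p, τ, θ)) := by
  have hF : Measurable fun q => g (paramPoint q) := hg.comp measurable_paramPoint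
  have h := hF.lintegral_prod_right' (ν := (volume.restrict (Ioo (0 : ℝ) 1)).prod
    (volume.restrict (Ioo 0 Real.pi)))
  convert h using 2 with p
  exact (lintegral_prod _ (hF.comp measurable_prodMk_left).aemeasurable).symm

/-- Once the phases are aligned, polar coordinates for c give t = |c|² with weight e^(-t) and a flat
angle θ. Setting τ = |b|²/(|b|² + t) recovers `paramPoint`. -/
theorem lintegral_last_coordinate {g : (Fin 4 → ℝ) → ENNReal} (hg : Measurable g) {u : Fin 3 → ℂ}
    (hu : ‖u 0‖ ^ 2 + ‖u 1‖ ^ 2 + ‖u 2‖ ^ 2 = 1) (hu0 : ‖u 0‖ ^ 2 < 1) (hu2 : u 2 ≠ 0)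
    {b : ℂ} (hb : b ≠ 0) :
    ∫⁻ c : ℂ, ENNReal.ofReal (Real.exp (-‖c‖ ^ 2)) *
      g ![‖u 0‖ ^ 2, ‖u 1‖ ^ 2, (1 - ‖u 0‖ ^ 2) * (‖b‖ ^ 2 / (‖b‖ ^ 2 + ‖c‖ ^ 2)),
        ‖c * star (u 2) - b * (star (u 0) * u 1)‖ ^ 2 /
          ((1 - ‖u 0‖ ^ 2) * (‖b‖ ^ 2 + ‖c‖ ^ 2))] =
    ∫⁻ t in Ioi (0 : ℝ), ENNReal.ofReal (Real.exp (-t)) *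
      ∫⁻ θ in Ioo 0 Real.pi,
        g (paramPoint ((‖u 0‖ ^ 2, ‖u 1‖ ^ 2), ‖b‖ ^ 2 / (‖b‖ ^ 2 + t), θ)) := by
  have hc : 0 < 1 - ‖u 0‖ ^ 2 := by linarith
  have hvec : Measurable fun q : ℝ × ℝ => (![‖u 0‖ ^ 2, ‖u 1‖ ^ 2,
      (1 - ‖u 0‖ ^ 2) * (‖b‖ ^ 2 / (‖b‖ ^ 2 + q.1)),
      (‖b‖ ^ 2 * (‖u 0‖ ^ 2 * ‖u 1‖ ^ 2) + q.1 * ‖u 2‖ ^ 2 -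
        2 * (‖b‖ * (‖u 0‖ * ‖u 1‖) * ‖u 2‖) * q.2) / ((1 - ‖u 0‖ ^ 2) * (‖b‖ ^ 2 + q.1))] :
          Fin 4 → ℝ) := by
    refine measurable_pi_lambda _ fun i => ?_
    fin_cases i <;> simp <;> fun_prop
  rw [lintegral_align_phase b hu2 fun t y => ENNReal.ofReal (Real.exp (-t)) *
    g ![‖u 0‖ ^ 2, ‖u 1‖ ^ 2, (1 - ‖u 0‖ ^ 2) * (‖b‖ ^ 2 / (‖b‖ ^ 2 + t)),
      y / ((1 - ‖u 0‖ ^ 2) * (‖b‖ ^ 2 + t))]]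
  rw [lintegral_complex_polar (H := fun q => ENNReal.ofReal (Real.exp (-q.1)) *
    g ![‖u 0‖ ^ 2, ‖u 1‖ ^ 2, (1 - ‖u 0‖ ^ 2) * (‖b‖ ^ 2 / (‖b‖ ^ 2 + q.1)),
      (‖b‖ ^ 2 * (‖u 0‖ ^ 2 * ‖u 1‖ ^ 2) + q.1 * ‖u 2‖ ^ 2 -
        2 * (‖b‖ * (‖u 0‖ * ‖u 1‖) * ‖u 2‖) * q.2) / ((1 - ‖u 0‖ ^ 2) * (‖b‖ ^ 2 + q.1))])
    (by have := hg.comp hvec; fun_prop)]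
  refine setLIntegral_congr_fun measurableSet_Ioi fun t (ht : 0 < t) => ?_
  rw [← lintegral_const_mul' _ _ ENNReal.ofReal_ne_top]
  refine lintegral_congr fun θ => ?_
  have hb2 : 0 < ‖b‖ := norm_pos_iff.2 hb
  have hz : 1 - ‖u 0‖ ^ 2 - ‖u 1‖ ^ 2 = ‖u 2‖ ^ 2 := by linarith
  have hbt : 0 < ‖b‖ ^ 2 + t := by positivity
  have hsqrt : √(‖b‖ ^ 2 / (‖b‖ ^ 2 + t) * (1 - ‖b‖ ^ 2 / (‖b‖ ^ 2 + t)) *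
      (‖u 0‖ ^ 2 * ‖u 1‖ ^ 2 * ‖u 2‖ ^ 2)) =
      ‖b‖ * (‖u 0‖ * ‖u 1‖) * ‖u 2‖ * √t / (‖b‖ ^ 2 + t) := by
    rw [show ‖b‖ ^ 2 / (‖b‖ ^ 2 + t) * (1 - ‖b‖ ^ 2 / (‖b‖ ^ 2 + t)) *
      (‖u 0‖ ^ 2 * ‖u 1‖ ^ 2 * ‖u 2‖ ^ 2) =
        (‖b‖ * (‖u 0‖ * ‖u 1‖) * ‖u 2‖ * √t / (‖b‖ ^ 2 + t)) ^ 2 by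
      rw [div_pow, mul_pow, Real.sq_sqrt ht.le]
      field_simp
      ring]
    exact Real.sqrt_sq (by positivity)
  congr 2
  simp only [paramPoint]
  rw [hz, hsqrt]
  congr 4
  field_simp
  ring

theorem lintegral_complex_exp_ratio {Φ : ℝ → ENNReal} (hΦ : Measurable Φ) :
    ∫⁻ b : ℂ, ENNReal.ofReal (Real.exp (-‖b‖ ^ 2)) *
      (∫⁻ t in Ioi (0 : ℝ), ENNReal.ofReal (Real.exp (-t)) * Φ (‖b‖ ^ 2 / (‖b‖ ^ 2 + t))) =
      ENNReal.ofReal Real.pi * ∫⁻ τ in Ioo (0 : ℝ) 1, Φ τ := by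
  have hinner : Measurable fun a : ℝ => ∫⁻ t in Ioi (0 : ℝ), ENNReal.ofReal (Real.exp (-t)) *
      Φ (a / (a + t)) := by
    have : Measurable fun q : ℝ × ℝ => ENNReal.ofReal (Real.exp (-q.2)) * Φ (q.1 / (q.1 + q.2)) := by
      fun_prop
    exact this.lintegral_prod_right'
  rw [lintegral_complex_radial (h := fun a => ENNReal.ofReal (Real.exp (-a)) *
    (∫⁻ t in Ioi (0 : ℝ), ENNReal.ofReal (Real.exp (-t)) * Φ (a / (a + t)))) (by fun_prop)]
  congr 1
  rw [← lintegral_exp_ratio hΦ]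
  refine lintegral_congr fun a => ?_
  rw [← lintegral_const_mul' _ _ ENNReal.ofReal_ne_top]
  simp_rw [mul_assoc]

theorem lintegral_complex_exp_neg_sq :
    ∫⁻ a : ℂ, ENNReal.ofReal (Real.exp (-‖a‖ ^ 2)) = ENNReal.ofReal Real.pi := by
  rw [lintegral_complex_radial (h := fun a => ENNReal.ofReal (Real.exp (-a))) (by fun_prop)]
  have h1 := setLIntegral_exp_neg_mul_pow 0
  simp only [pow_zero, mul_one, Nat.factorial_zero, Nat.cast_one, ENNReal.ofReal_one] at h1
  rw [h1, mul_one]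

theorem gaussianWeight_vec (a b c : ℂ) : gaussianWeight ![a, b, c] =
    ENNReal.ofReal (Real.exp (-‖a‖ ^ 2)) * (ENNReal.ofReal (Real.exp (-‖b‖ ^ 2)) *
      ENNReal.ofReal (Real.exp (-‖c‖ ^ 2))) := by
  rw [← ENNReal.ofReal_mul (Real.exp_pos _).le, ← ENNReal.ofReal_mul (Real.exp_pos _).le,
    ← Real.exp_add, ← Real.exp_add, gaussianWeight]
  congr 2
  simp
  ring

theorem measurable_gramSchmidtBlock_right (z : Fin 3 → ℂ) :
    Measurable fun w => gramSchmidtBlock z w := by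
  have h := measurable_gramSchmidtBlock
  generalize gramSchmidtBlock = F at *
  exact h.comp measurable_prodMk_left

theorem lintegral_vecMul_fin_three {M : Matrix (Fin 3) (Fin 3) ℂ}
    (hM : M ∈ Matrix.unitaryGroup (Fin 3) ℂ) {h : (Fin 3 → ℂ) → ENNReal} (hh : Measurable h) :
    ∫⁻ w, h w = ∫⁻ a, ∫⁻ b, ∫⁻ c, h (Matrix.vecMul ![a, b, c] M) := by
  have hmp := measurePreserving_vecMul hM
  rw [← hmp.lintegral_comp hh]
  exact lintegral_fin_three (hh.comp hmp.measurable)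

/-- In the frame coordinates a does not enter the block and integrates to π. The variables |b|² and
|c|² are exponential, so τ is uniform, at the cost of another factor π. -/
theorem lintegral_gaussian_unit {g : (Fin 4 → ℝ) → ENNReal} (hg : Measurable g) {u : Fin 3 → ℂ}
    (hu : ‖u 0‖ ^ 2 + ‖u 1‖ ^ 2 + ‖u 2‖ ^ 2 = 1) (hu0 : ‖u 0‖ ^ 2 < 1) (hu2 : u 2 ≠ 0)
    {r : ℝ} (hr : 0 < r) :
    ∫⁻ w, gaussianWeight w * g (gramSchmidtBlock ((r : ℂ) • u) w) =
      ENNReal.ofReal Real.pi * (ENNReal.ofReal Real.pi * ∫⁻ τ in Ioo (0 : ℝ) 1,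
        ∫⁻ θ in Ioo 0 Real.pi, g (paramPoint ((‖u 0‖ ^ 2, ‖u 1‖ ^ 2), τ, θ))) := by
  have hs : 0 < √(1 - ‖u 0‖ ^ 2) := Real.sqrt_pos.2 (by linarith)
  have hsu : √(1 - ‖u 0‖ ^ 2) ^ 2 = 1 - ‖u 0‖ ^ 2 := Real.sq_sqrt (by linarith)
  generalize √(1 - ‖u 0‖ ^ 2) = s at hs hsu
  have hM := frameMatrix_mem_unitaryGroup hs hu hsu
  have hw := measurable_gaussianWeight
  have hgz : Measurable fun w => gaussianWeight w * g (gramSchmidtBlock ((r : ℂ) • u) w) :=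
    hw.mul (hg.comp (measurable_gramSchmidtBlock_right _))
  rw [lintegral_vecMul_fin_three hM hgz]
  have hpt : ∀ a b c : ℂ, gaussianWeight (Matrix.vecMul ![a, b, c] (frameMatrix u s)) *
      g (gramSchmidtBlock ((r : ℂ) • u) (Matrix.vecMul ![a, b, c] (frameMatrix u s))) =
      ENNReal.ofReal (Real.exp (-‖a‖ ^ 2)) * (ENNReal.ofReal (Real.exp (-‖b‖ ^ 2)) *
      (ENNReal.ofReal (Real.exp (-‖c‖ ^ 2)) *
        g ![‖u 0‖ ^ 2, ‖u 1‖ ^ 2, (1 - ‖u 0‖ ^ 2) * (‖b‖ ^ 2 / (‖b‖ ^ 2 + ‖c‖ ^ 2)),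
        ‖c * star (u 2) - b * (star (u 0) * u 1)‖ ^ 2 /
          ((1 - ‖u 0‖ ^ 2) * (‖b‖ ^ 2 + ‖c‖ ^ 2))])) := fun a b c => by
    rw [gaussianWeight_vecMul hM, gramSchmidtBlock_frame hs hr hu hsu, gaussianWeight_vec, mul_assoc,
      mul_assoc]
  simp only [hpt, lintegral_const_mul' _ _ ENNReal.ofReal_ne_top]
  clear hpt hgz
  rw [← lintegral_complex_exp_ratio (measurable_lintegral_angle hg (‖u 0‖ ^ 2, ‖u 1‖ ^ 2))]
  rw [lintegral_mul_const _ (by fun_prop), lintegral_complex_exp_neg_sq]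
  congr 1
  refine lintegral_congr_ae ?_
  filter_upwards [Measure.ae_ne volume (0 : ℂ)] with b hb
  rw [← lintegral_last_coordinate hg hu hu0 hu2 hb]

theorem lintegral_gaussian_second {g : (Fin 4 → ℝ) → ENNReal} (hg : Measurable g) {z : Fin 3 → ℂ}
    (hz : z 0 ≠ 0 ∧ z 1 ≠ 0 ∧ z 2 ≠ 0) :
    ∫⁻ w, gaussianWeight w * g (gramSchmidtBlock z w) =
      ENNReal.ofReal Real.pi * (ENNReal.ofReal Real.pi * ∫⁻ τ in Ioo (0 : ℝ) 1,
        ∫⁻ θ in Ioo 0 Real.pi,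
        g (paramPoint ((‖z 0‖ ^ 2 / (‖z 0‖ ^ 2 + ‖z 1‖ ^ 2 + ‖z 2‖ ^ 2),
          ‖z 1‖ ^ 2 / (‖z 0‖ ^ 2 + ‖z 1‖ ^ 2 + ‖z 2‖ ^ 2)), τ, θ))) := by
  have n0 : 0 < ‖z 0‖ := norm_pos_iff.2 hz.1
  have n1 : 0 < ‖z 1‖ := norm_pos_iff.2 hz.2.1
  have n2 : 0 < ‖z 2‖ := norm_pos_iff.2 hz.2.2
  obtain ⟨N, hN⟩ : ∃ N, N = ‖z 0‖ ^ 2 + ‖z 1‖ ^ 2 + ‖z 2‖ ^ 2 := ⟨_, rfl⟩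
  rw [← hN]
  have hNpos : 0 < N := by rw [hN]; positivity
  have hr : 0 < √N := Real.sqrt_pos.2 hNpos
  have hrc : (√N : ℂ) ≠ 0 := by exact_mod_cast hr.ne'
  obtain ⟨u, hu_def⟩ : ∃ u : Fin 3 → ℂ, u = (√N : ℂ)⁻¹ • z := ⟨_, rfl⟩
  have hzu : z = (√N : ℂ) • u := by rw [hu_def, smul_smul, mul_inv_cancel₀ hrc, one_smul]
  have hun : ∀ i, ‖u i‖ ^ 2 = ‖z i‖ ^ 2 / N := fun i => by
    rw [hu_def, Pi.smul_apply, smul_eq_mul, norm_mul, mul_pow, norm_inv, Complex.norm_real,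
      Real.norm_eq_abs, inv_pow, sq_abs, Real.sq_sqrt hNpos.le, inv_mul_eq_div]
  have hu : ‖u 0‖ ^ 2 + ‖u 1‖ ^ 2 + ‖u 2‖ ^ 2 = 1 := by
    rw [hun, hun, hun, ← add_div, ← add_div, ← hN, div_self hNpos.ne']
  have hu1 : 0 < ‖u 1‖ ^ 2 := by rw [hun]; positivity
  have hu2 : u 2 ≠ 0 := by
    rw [hu_def, Pi.smul_apply, smul_eq_mul]
    exact mul_ne_zero (inv_ne_zero hrc) hz.2.2
  have hu0 : ‖u 0‖ ^ 2 < 1 := by nlinarith [sq_nonneg ‖u 2‖]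
  rw [← hun, ← hun, ← lintegral_gaussian_unit hg hu hu0 hu2 hr, ← hzu]

theorem lintegral_gaussian_simplex {I : ℝ × ℝ → ENNReal} (hI : Measurable I) :
    ∫⁻ z : Fin 3 → ℂ, gaussianWeight z *
      I (‖z 0‖ ^ 2 / (‖z 0‖ ^ 2 + ‖z 1‖ ^ 2 + ‖z 2‖ ^ 2),
        ‖z 1‖ ^ 2 / (‖z 0‖ ^ 2 + ‖z 1‖ ^ 2 + ‖z 2‖ ^ 2)) =
      ENNReal.ofReal Real.pi ^ 3 * (2 * ∫⁻ p in openTriangle, I p) := by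
  have hw := measurable_gaussianWeight
  have hmz : Measurable fun z : Fin 3 → ℂ => gaussianWeight z *
      I (‖z 0‖ ^ 2 / (‖z 0‖ ^ 2 + ‖z 1‖ ^ 2 + ‖z 2‖ ^ 2),
          ‖z 1‖ ^ 2 / (‖z 0‖ ^ 2 + ‖z 1‖ ^ 2 + ‖z 2‖ ^ 2)) := by fun_prop
  have hm2 : ∀ x y, Measurable fun t : ℝ => ENNReal.ofReal (Real.exp (-(x + y + t))) *
      I (x / (x + y + t), y / (x + y + t)) := fun x y => by fun_prop
  have hm1 : ∀ x, Measurable fun y : ℝ => ∫⁻ t in Ioi (0 : ℝ),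
      ENNReal.ofReal (Real.exp (-(x + y + t))) * I (x / (x + y + t), y / (x + y + t)) := fun x => by
    have : Measurable fun q : ℝ × ℝ => ENNReal.ofReal (Real.exp (-(x + q.1 + q.2))) *
      I (x / (x + q.1 + q.2), q.1 / (x + q.1 + q.2)) := by fun_prop
    exact this.lintegral_prod_right'
  have hm0 : Measurable fun x : ℝ => ∫⁻ y in Ioi (0 : ℝ), ∫⁻ t in Ioi (0 : ℝ),
      ENNReal.ofReal (Real.exp (-(x + y + t))) * I (x / (x + y + t), y / (x + y + t)) := by
    have h1 : Measurable fun q : (ℝ × ℝ) × ℝ => ENNReal.ofReal (Real.exp (-(q.1.1 + q.1.2 + q.2))) *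
      I (q.1.1 / (q.1.1 + q.1.2 + q.2), q.1.2 / (q.1.1 + q.1.2 + q.2)) := by fun_prop
    have h2 : Measurable fun q : ℝ × ℝ => ∫⁻ t in Ioi (0 : ℝ),
      ENNReal.ofReal (Real.exp (-(q.1 + q.2 + t))) * I (q.1 / (q.1 + q.2 + t), q.2 / (q.1 + q.2 + t)) :=
      h1.lintegral_prod_right'
    exact h2.lintegral_prod_right'
  have hpi : ENNReal.ofReal Real.pi ≠ ⊤ := ENNReal.ofReal_ne_top
  rw [← lintegral_exp_simplex hI, lintegral_fin_three hmz]
  have e1 : ∀ a b : ℂ, ∫⁻ c : ℂ, ENNReal.ofReal (Real.exp (-(‖a‖ ^ 2 + ‖b‖ ^ 2 + ‖c‖ ^ 2))) *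
      I (‖a‖ ^ 2 / (‖a‖ ^ 2 + ‖b‖ ^ 2 + ‖c‖ ^ 2), ‖b‖ ^ 2 / (‖a‖ ^ 2 + ‖b‖ ^ 2 + ‖c‖ ^ 2)) =
      ENNReal.ofReal Real.pi * ∫⁻ t in Ioi (0 : ℝ),
        ENNReal.ofReal (Real.exp (-(‖a‖ ^ 2 + ‖b‖ ^ 2 + t))) *
          I (‖a‖ ^ 2 / (‖a‖ ^ 2 + ‖b‖ ^ 2 + t), ‖b‖ ^ 2 / (‖a‖ ^ 2 + ‖b‖ ^ 2 + t)) :=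
    fun a b => lintegral_complex_radial (hm2 (‖a‖ ^ 2) (‖b‖ ^ 2))
  simp only [gaussianWeight, Matrix.cons_val_zero, Matrix.cons_val_one, Matrix.cons_val]
  simp_rw [e1, lintegral_const_mul' _ _ hpi]
  have e2 : ∀ a : ℂ, ∫⁻ b : ℂ, ∫⁻ t in Ioi (0 : ℝ),
        ENNReal.ofReal (Real.exp (-(‖a‖ ^ 2 + ‖b‖ ^ 2 + t))) *
          I (‖a‖ ^ 2 / (‖a‖ ^ 2 + ‖b‖ ^ 2 + t), ‖b‖ ^ 2 / (‖a‖ ^ 2 + ‖b‖ ^ 2 + t)) =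
      ENNReal.ofReal Real.pi * ∫⁻ y in Ioi (0 : ℝ), ∫⁻ t in Ioi (0 : ℝ),
        ENNReal.ofReal (Real.exp (-(‖a‖ ^ 2 + y + t))) *
          I (‖a‖ ^ 2 / (‖a‖ ^ 2 + y + t), y / (‖a‖ ^ 2 + y + t)) :=
    fun a => lintegral_complex_radial (hm1 (‖a‖ ^ 2))
  simp_rw [e2, lintegral_const_mul' _ _ hpi]
  have e3 := lintegral_complex_radial hm0
  rw [e3]
  ring

/-- The factor π³ and the 2 come from the first vector, whose normalized squared moduli are uniform
on the triangle; π² comes from the second vector. -/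
theorem lintegral_gaussian_eq_paramMeasure {g : (Fin 4 → ℝ) → ENNReal} (hg : Measurable g) :
    ∫⁻ p : (Fin 3 → ℂ) × (Fin 3 → ℂ),
        gaussianWeight p.1 * gaussianWeight p.2 * g (gramSchmidtBlock p.1 p.2) =
      2 * ENNReal.ofReal Real.pi ^ 5 * ∫⁻ q, g (paramPoint q) ∂paramMeasure := by
  have hw := measurable_gaussianWeight
  have hgs : Measurable fun p : (Fin 3 → ℂ) × (Fin 3 → ℂ) => g (gramSchmidtBlock p.1 p.2) :=
    hg.comp measurable_gramSchmidtBlock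
  have hpi : ENNReal.ofReal Real.pi ≠ ⊤ := ENNReal.ofReal_ne_top
  have hgp : Measurable fun q => g (paramPoint q) := hg.comp measurable_paramPoint
  have hprod : Measurable fun p : (Fin 3 → ℂ) × (Fin 3 → ℂ) =>
      gaussianWeight p.1 * gaussianWeight p.2 * g (gramSchmidtBlock p.1 p.2) :=
    ((hw.comp measurable_fst).mul (hw.comp measurable_snd)).mul hgs
  have hI := lintegral_gaussian_simplex (measurable_lintegral_angle_angle hg)
  rw [Measure.volume_eq_prod, lintegral_prod _ hprod.aemeasurable, lintegral_paramMeasure hgp]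
  have key : ∀ᵐ z : Fin 3 → ℂ, ∫⁻ w, gaussianWeight z * gaussianWeight w * g (gramSchmidtBlock z w) =
      ENNReal.ofReal Real.pi ^ 2 * (gaussianWeight z * ∫⁻ τ in Ioo (0 : ℝ) 1,
        ∫⁻ θ in Ioo 0 Real.pi,
        g (paramPoint ((‖z 0‖ ^ 2 / (‖z 0‖ ^ 2 + ‖z 1‖ ^ 2 + ‖z 2‖ ^ 2),
          ‖z 1‖ ^ 2 / (‖z 0‖ ^ 2 + ‖z 1‖ ^ 2 + ‖z 2‖ ^ 2)), τ, θ))) := by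
    filter_upwards [ae_coord_ne_zero] with z hz
    simp_rw [mul_assoc]
    rw [lintegral_const_mul' _ _ (by exact ENNReal.ofReal_ne_top), lintegral_gaussian_second hg hz]
    ring
  rw [lintegral_congr_ae key, lintegral_const_mul' _ _ (ENNReal.pow_ne_top hpi), hI]
  ring

/-! ### The probability laws and the Haar case. -/

theorem unistochasticMeasure_univ {k : ℝ} (hk : 1 / 2 < k) :
    0 < unistochasticMeasure k univ ∧ unistochasticMeasure k univ < ⊤ := by
  obtain ⟨C, hC0, hC, h⟩ := map_jarlskogX_unistochasticMeasure hk
  have h1 := congrArg (fun μ : Measure ℝ => μ univ) h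
  simp only [Measure.map_apply measurable_jarlskogX MeasurableSet.univ, preimage_univ,
    Measure.smul_apply, lawWithDensity_jarlskogDensity_univ hk, smul_eq_mul, mul_one] at h1
  rw [h1]
  exact ⟨pos_iff_ne_zero.2 hC0, hC.lt_top⟩

theorem map_jarlskogX_unistochasticProb {k : ℝ} (hk : 1 / 2 < k) :
    (unistochasticProb k).map jarlskogX = lawWithDensity 1 (jarlskogDensity k) := by
  obtain ⟨C, hC0, hC, h⟩ := map_jarlskogX_unistochasticMeasure hk
  have h1 := congrArg (fun μ : Measure ℝ => μ univ) h
  simp only [Measure.map_apply measurable_jarlskogX MeasurableSet.univ, preimage_univ,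
    Measure.smul_apply, lawWithDensity_jarlskogDensity_univ hk, smul_eq_mul, mul_one] at h1
  rw [unistochasticProb, Measure.map_smul, h, h1, smul_smul, ENNReal.inv_mul_cancel hC0 hC,
    one_smul]

theorem identDistrib_jarlskogX_mul {k : ℝ} (hk : 1 / 2 < k) {Ω : Type*} [MeasurableSpace Ω]
    {P : Measure Ω} {X₀ X₁ X₂ : Ω → ℝ}
    (h0 : HasLaw X₀ (betaMeasure (k - 1 / 2) 1) P) (h1 : HasLaw X₁ (betaMeasure k (1 / 3)) P)
    (h2 : HasLaw X₂ (betaMeasure k (2 / 3)) P) (hind : iIndepFun ![X₀, X₁, X₂] P) :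
    IdentDistrib jarlskogX (fun ω => X₀ ω * X₁ ω * X₂ ω) (unistochasticProb k) P := by
  have hk0 : 0 < k := by linarith
  have := isProbabilityMeasureBeta (α := k - 1 / 2) (β := 1) (by linarith) one_pos
  have := isProbabilityMeasureBeta (α := k) (β := 1 / 3) hk0 (by norm_num)
  have := isProbabilityMeasureBeta (α := k) (β := 2 / 3) hk0 (by norm_num)
  have hm : ∀ i, AEMeasurable (![X₀, X₁, X₂] i) P := fun i => by
    fin_cases i
    exacts [h0.aemeasurable, h1.aemeasurable, h2.aemeasurable]
  have h12 : IndepFun X₁ X₂ P := hind.indepFun (show (1 : Fin 3) ≠ 2 by decide)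
  have h012 : IndepFun X₀ (X₁ * X₂) P :=
    hind.indepFun_mul_right₀ hm 0 1 2 (by decide) (by decide)
  have hlaw := h012.hasLaw_mul h0 (h12.hasLaw_mul h1 h2)
  rw [Measure.mconv_comm (betaMeasure k (1 / 3)), betaMeasure_mconv hk] at hlaw
  have he : (fun ω => X₀ ω * X₁ ω * X₂ ω) = X₀ * (X₁ * X₂) := by
    ext ω
    exact mul_assoc _ _ _
  rw [he]
  exact ⟨measurable_jarlskogX.aemeasurable, hlaw.aemeasurable,
    by rw [map_jarlskogX_unistochasticProb hk, hlaw.map_eq]⟩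

theorem lintegral_blockModuli_haar (m : Measure (Matrix.unitaryGroup (Fin 3) ℂ))
    [m.IsHaarMeasure] [IsProbabilityMeasure m] {g : (Fin 4 → ℝ) → ENNReal} (hg : Measurable g) :
    ∫⁻ U : Matrix.unitaryGroup (Fin 3) ℂ, g (blockModuli U.1) ∂m =
      (paramMeasure univ)⁻¹ * ∫⁻ q, g (paramPoint q) ∂paramMeasure := by
  -- Taking g = 1 evaluates the Gaussian normalization by the same formula, so the factor 2π⁵
  -- cancels.
  have hone := lintegral_gaussian_eq_paramMeasure (g := fun _ => 1) measurable_const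
  simp only [mul_one, lintegral_const, one_mul] at hone
  have h := (lintegral_gaussian_gramSchmidtBlock m hg).symm.trans
    (lintegral_gaussian_eq_paramMeasure hg)
  have hp0 : 2 * ENNReal.ofReal Real.pi ^ 5 ≠ 0 := by
    have := Real.pi_pos
    positivity
  have hpt : 2 * ENNReal.ofReal Real.pi ^ 5 ≠ ⊤ :=
    ENNReal.mul_ne_top ENNReal.ofNat_ne_top (ENNReal.pow_ne_top ENNReal.ofReal_ne_top)
  have hV : paramMeasure univ = ENNReal.ofReal (Real.pi / 2) := by
    have h1 := congrArg (fun μ : Measure ℝ => μ univ) map_paramX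
    simpa only [Measure.map_apply measurable_paramX MeasurableSet.univ, preimage_univ,
      Measure.smul_apply, lawWithDensity_jarlskogDensity_univ (show (1 / 2 : ℝ) < 1 by norm_num),
      smul_eq_mul, mul_one] using h1
  have hV0 : paramMeasure univ ≠ 0 := by
    rw [hV]
    simpa using Real.pi_pos
  have hVt : paramMeasure univ ≠ ⊤ := hV ▸ ENNReal.ofReal_ne_top
  rw [hone, mul_assoc] at h
  rw [← (ENNReal.mul_right_inj hp0 hpt).1 h, ← mul_assoc, ENNReal.inv_mul_cancel hV0 hVt, one_mul]

theorem map_sqModuli_haar (m : Measure (Matrix.unitaryGroup (Fin 3) ℂ))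
    [m.IsHaarMeasure] [IsProbabilityMeasure m] :
    m.map (fun U : Matrix.unitaryGroup (Fin 3) ℂ => sqModuli U.1) = unistochasticProb 1 := by
  have hB := continuous_birkhoffParam.measurable
  have hf : (fun U : Matrix.unitaryGroup (Fin 3) ℂ => sqModuli U.1) =
      fun U => birkhoffParam (blockModuli U.1) :=
    funext fun U => sqModuli_eq_birkhoffParam U.2
  have hQ : unistochasticMeasure 1 = paramMeasure.map (birkhoffParam ∘ paramPoint) := by
    rw [unistochasticMeasure_eq]
    simp
  have hBp : Measurable (birkhoffParam ∘ paramPoint) := hB.comp measurable_paramPoint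
  rw [hf, unistochasticProb, hQ, Measure.map_apply hBp MeasurableSet.univ, preimage_univ]
  refine Measure.ext_of_lintegral _ fun g hg => ?_
  have hBm : Measurable fun U : Matrix.unitaryGroup (Fin 3) ℂ => birkhoffParam (blockModuli U.1) :=
    hB.comp (measurable_blockModuli.comp measurable_subtype_coe)
  rw [lintegral_map hg hBm,
    lintegral_blockModuli_haar m (g := fun b => g (birkhoffParam b)) (hg.comp hB),
    lintegral_smul_measure, lintegral_map hg hBp]
  rfl

theorem map_jarlskog_sq_haar (m : Measure (Matrix.unitaryGroup (Fin 3) ℂ))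
    [m.IsHaarMeasure] [IsProbabilityMeasure m] :
    m.map (fun U : Matrix.unitaryGroup (Fin 3) ℂ => 108 * jarlskog U.1 ^ 2) =
      lawWithDensity 1 (jarlskogDensity 1) := by
  have hf : (fun U : Matrix.unitaryGroup (Fin 3) ℂ => 108 * jarlskog U.1 ^ 2) =
      jarlskogX ∘ fun U : Matrix.unitaryGroup (Fin 3) ℂ => sqModuli U.1 :=
    funext fun U => (jarlskogX_sqModuli U.2).symm
  have hs : Measurable fun U : Matrix.unitaryGroup (Fin 3) ℂ => sqModuli U.1 := by
    rw [show (fun U : Matrix.unitaryGroup (Fin 3) ℂ => sqModuli U.1) =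
      fun U => birkhoffParam (blockModuli U.1) from
        funext fun U => sqModuli_eq_birkhoffParam U.2]
    exact continuous_birkhoffParam.measurable.comp (measurable_blockModuli.comp measurable_subtype_coe)
  rw [hf, ← Measure.map_map measurable_jarlskogX hs, map_sqModuli_haar,
    map_jarlskogX_unistochasticProb (by norm_num)]

theorem mul_sq_mem_Ioc {y : ℝ} (hy : y ∈ Ioc 0 (1 / (6 * √3))) : 108 * y ^ 2 ∈ Ioc (0 : ℝ) 1 := by
  have h3 : (√3 : ℝ) ^ 2 = 3 := Real.sq_sqrt (by norm_num)
  have hr : (1 / (6 * √3) : ℝ) ^ 2 = 1 / 108 := by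
    rw [div_pow, mul_pow, h3]
    norm_num
  have := pow_le_pow_left₀ hy.1.le hy.2 2
  have := hy.1
  exact ⟨by positivity, by linarith⟩

theorem image_mul_sq_Ioc : (fun y : ℝ => 108 * y ^ 2) '' Ioc 0 (1 / (6 * √3)) = Ioc 0 1 := by
  refine Subset.antisymm (image_subset_iff.2 fun y hy => mul_sq_mem_Ioc hy) fun x hx => ?_
  have h3 : (√3 : ℝ) ^ 2 = 3 := Real.sq_sqrt (by norm_num)
  have hr : (1 / (6 * √3) : ℝ) ^ 2 = 1 / 108 := by
    rw [div_pow, mul_pow, h3]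
    norm_num
  refine ⟨√(x / 108), ⟨Real.sqrt_pos.2 (div_pos hx.1 (by norm_num)), ?_⟩, ?_⟩
  · rw [Real.sqrt_le_left (by positivity), hr]
    linarith [hx.2]
  · simp only
    rw [Real.sq_sqrt (div_pos hx.1 (by norm_num)).le]
    ring

theorem aemeasurable_jarlskogDensity_comp_mul_sq (k : ℝ) :
    AEMeasurable (fun y => 216 * y * jarlskogDensity k (108 * y ^ 2))
      (volume.restrict (Ioc 0 (1 / (6 * √3)))) := by
  have h : AEMeasurable (fun y : ℝ => ∫ t in (108 * y ^ 2)..1, densityIntegrand t)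
      (volume.restrict (Ioc 0 (1 / (6 * √3)))) := by
    refine aemeasurable_restrict_of_antitoneOn measurableSet_Ioc fun x hx y hy hxy => ?_
    have hx' := mul_sq_mem_Ioc hx
    have hle : 108 * x ^ 2 ≤ 108 * y ^ 2 :=
      mul_le_mul_of_nonneg_left (pow_le_pow_left₀ hx.1.le hxy 2) (by norm_num)
    refine intervalIntegral.integral_mono_interval hle (mul_sq_mem_Ioc hy).2 le_rfl ?_
      (densityIntegrand_intervalIntegrable hx'.1 hx'.2)
    exact ae_restrict_of_forall_mem measurableSet_Ioc fun t ht =>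
      densityIntegrand_nonneg (hx'.1.trans ht.1) ht.2
  unfold jarlskogDensity
  fun_prop

/-- The substitution x = 108y², dx = 216y dy; the endpoint 1/(6√3) is the positive root of 108y² =
1. -/
theorem map_sqrt_lawWithDensity :
    (lawWithDensity 1 (jarlskogDensity 1)).map (fun x => √(x / 108)) =
      lawWithDensity (1 / (6 * √3)) (fun y => 216 * y * jarlskogDensity 1 (108 * y ^ 2)) := by
  have hs : Measurable fun x : ℝ => √(x / 108) := by fun_prop
  refine Measure.ext_of_lintegral _ fun g hg => ?_
  rw [lintegral_map hg hs, lintegral_lawWithDensity 1 (f := fun x => g √(x / 108)) (hg.comp hs),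
    lintegral_lawWithDensity' (aemeasurable_jarlskogDensity_comp_mul_sq 1) hg, ← image_mul_sq_Ioc,
    lintegral_image_eq_lintegral_abs_deriv_mul measurableSet_Ioc (f' := fun y => 216 * y)
      (fun y _ => ?_) ?_]
  · refine setLIntegral_congr_fun measurableSet_Ioc fun y hy => ?_
    have hy0 : 0 ≤ 216 * y := by linarith [hy.1]
    have hsq : √(108 * y ^ 2 / 108) = y := by
      rw [mul_div_cancel_left₀ _ (by norm_num), Real.sqrt_sq hy.1.le]
    rw [hsq, abs_of_nonneg hy0, ENNReal.ofReal_mul hy0, mul_assoc]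
  · intro x hx y hy hxy
    have hxy' : x ^ 2 = y ^ 2 := mul_left_cancel₀ (by norm_num : (108 : ℝ) ≠ 0) hxy
    exact (pow_left_inj₀ hx.1.le hy.1.le two_ne_zero).1 hxy'
  · have h := ((hasDerivAt_pow 2 y).const_mul (108 : ℝ)).hasDerivWithinAt
      (s := Ioc 0 (1 / (6 * √3)))
    rwa [show 108 * (((2 : ℕ) : ℝ) * y ^ (2 - 1)) = 216 * y by push_cast; ring] at h

theorem map_abs_jarlskog_haar (m : Measure (Matrix.unitaryGroup (Fin 3) ℂ))
    [m.IsHaarMeasure] [IsProbabilityMeasure m] :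
    m.map (fun U : Matrix.unitaryGroup (Fin 3) ℂ => |jarlskog U.1|) =
      lawWithDensity (1 / (6 * √3)) (fun y => 216 * y * jarlskogDensity 1 (108 * y ^ 2)) := by
  have hJ : Measurable fun U : Matrix.unitaryGroup (Fin 3) ℂ => jarlskog U.1 := by
    have hc : Continuous jarlskog := by
      unfold jarlskog
      fun_prop
    exact hc.measurable.comp measurable_subtype_coe
  rw [← map_sqrt_lawWithDensity, ← map_jarlskog_sq_haar m,
    Measure.map_map (by fun_prop) ((hJ.pow_const 2).const_mul 108)]
  congr 1
  ext U
  rw [Function.comp_apply, mul_div_cancel_left₀ _ (by norm_num), Real.sqrt_sq_eq_abs]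

theorem mainTheorem2 :
    (∀ U ∈ Matrix.unitaryGroup (Fin 3) ℂ, jarlskogX (sqModuli U) = 108 * jarlskog U ^ 2) ∧
    (∀ k : ℝ, 1 / 2 < k →
      (0 < unistochasticMeasure k univ ∧ unistochasticMeasure k univ < ⊤) ∧
      (∀ (Ω : Type*) [MeasurableSpace Ω] (P : Measure Ω) [IsProbabilityMeasure P]
        (X₀ X₁ X₂ : Ω → ℝ),
        HasLaw X₀ (betaMeasure (k - 1 / 2) 1) P →
        HasLaw X₁ (betaMeasure k (1 / 3)) P →
        HasLaw X₂ (betaMeasure k (2 / 3)) P →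
        iIndepFun ![X₀, X₁, X₂] P →
        IdentDistrib jarlskogX (fun ω => X₀ ω * X₁ ω * X₂ ω) (unistochasticProb k) P) ∧
      (∀ x ∈ Ioc (0 : ℝ) 1,
        IntervalIntegrable densityIntegrand volume x 1 ∧ 0 ≤ jarlskogDensity k x) ∧
      (unistochasticProb k).map jarlskogX = lawWithDensity 1 (jarlskogDensity k)) ∧
    (∀ (m : Measure (Matrix.unitaryGroup (Fin 3) ℂ)) [m.IsHaarMeasure] [IsProbabilityMeasure m],
      m.map (fun U : Matrix.unitaryGroup (Fin 3) ℂ => sqModuli U.1) = unistochasticProb 1 ∧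
      m.map (fun U : Matrix.unitaryGroup (Fin 3) ℂ => 108 * jarlskog U.1 ^ 2) =
        lawWithDensity 1 (jarlskogDensity 1) ∧
      m.map (fun U : Matrix.unitaryGroup (Fin 3) ℂ => |jarlskog U.1|) =
        lawWithDensity (1 / (6 * √3)) (fun y => 216 * y * jarlskogDensity 1 (108 * y ^ 2))) := by
  refine ⟨fun U hU => jarlskogX_sqModuli hU, fun k hk => ⟨unistochasticMeasure_univ hk,
    fun Ω _ P _ X₀ X₁ X₂ h0 h1 h2 hind => identDistrib_jarlskogX_mul hk h0 h1 h2 hind,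
    fun x hx => ⟨densityIntegrand_intervalIntegrable hx.1 hx.2, jarlskogDensity_nonneg hk hx.1 hx.2⟩,
    map_jarlskogX_unistochasticProb hk⟩, fun m _ _ => ⟨map_sqModuli_haar m,
    map_jarlskog_sq_haar m, map_abs_jarlskog_haar m⟩⟩
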